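/- Let $N\ge 1$ and let $\Omega\subset\mathbb{R}^N$ be a bounded smooth domain (open and connected). Let $h\in L^\infty(\Omega)$ be nonnegative and not a.e. zero, put $\Omega_0=\operatorname{interior}\{x\in\Omega : h(x)=0\}$, and assume $|\Omega_0|>0$ and $h>0$ a.e. in $\Omega\setminus\Omega_0$. Let $g:\mathbb{R}\to\mathbb{R}$ be continuous, differentiable at $0$, such that $\lim_{|t|\to\infty}g(t)/t$ exists in $\mathbb{R}$ and $g(t)t-2\int_0^t g(s)\,ds\le C|t|+C$ for all $t\in\mathbb{R}$ and some constant $C$. Let $f:\mathbb{R}\to\mathbb{R}$ be continuous with $f(0)=0$, put $F(t)=\int_0^t f(s)\,ds$, and assume that for some $p>1$: - there is $R>0$ with $(p+1)F(t)\le f(t)t$ for $|t|\ge R$; - $F(t)>0$ for all $t\ne 0$; - $|f(t)|\le C'(1+|t|^p)$ for all $t\in\mathbb{R}$ and some constant $C'$; - $(f(t)-f(s))(t-s)\ge C''|t-s|^{p+1}$ for all $t,s\in\mathbb{R}$ and some constant $C''>0$. Let $H_D^1(\Omega_0)=\{v\in H_0^1(\Omega): v=0 \text{ a.e. in }\Omega\setminus\Omega_0\}$,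 and let $\lambda_1(\Omega_0)$ be the smallest $\mu\in\mathbb{R}$ for which there is $\psi\in H_D^1(\Omega_0)$, $\psi\neq 0$, with $\int_\Omega\nabla\psi\cdot\nabla w=\mu\int_\Omega\psi w$ for all $w\in H_D^1(\Omega_0)$. If $g(t)/t\ge\lambda_1(\Omega_0)$ for all $t\neq 0$, then the problem $$-\Delta u=g(u)-h(x)f(u)\ \text{ in }\Omega,\qquad u=0\ \text{ on }\partial\Omega,$$ has no positive solution: there is no $u\in H_0^1(\Omega)$ with $u>0$ a.e. in $\Omega$ and $g(u)-hf(u)\in L^1_{\mathrm{loc}}(\Omega)$ such that $$\int_\Omega\{\nabla u\cdot\nabla\varphi-g(u)\varphi+h(x)f(u)\varphi\}\,dx=0\qquad\text{for all }\varphi\in C_c^\infty(\Omega).$$ -/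

import Mathlib

open MeasureTheory Filter Topology Set
open scoped ContDiff

noncomputable section

/-- `C_c^∞(Ω)`. -/
structure IsTestFunction {N : ℕ} (Ω : Set (EuclideanSpace ℝ (Fin N)))
    (φ : EuclideanSpace ℝ (Fin N) → ℝ) : Prop where
  smooth : ContDiff ℝ ∞ φ
  compact : HasCompactSupport φ
  support_subset : tsupport φ ⊆ Ω

/-- The function `u` belongs to `H_0^1(Ω)` and `Du` is its weak gradient: the pair `(u, Du)` is a
limit in `L²(Ω) × L²(Ω; ℝ^N)` of pairs `(φ, ∇φ)` with `φ ∈ C_c^∞(Ω)`. That is, `u` lies in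
the closure of `C_c^∞(Ω)` in `H^1(Ω)`. Only the values in `Ω`, up to null sets, matter, and
`Du` is determined by `u` almost everywhere in `Ω`. -/
structure MemH10 {N : ℕ} (Ω : Set (EuclideanSpace ℝ (Fin N)))
    (u : EuclideanSpace ℝ (Fin N) → ℝ)
    (Du : EuclideanSpace ℝ (Fin N) → EuclideanSpace ℝ (Fin N)) : Prop where
  memLp : MemLp u 2 (volume.restrict Ω)
  grad_memLp : MemLp Du 2 (volume.restrict Ω)
  approx : ∃ φ : ℕ → EuclideanSpace ℝ (Fin N) → ℝ,
    (∀ n, IsTestFunction Ω (φ n)) ∧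
    Tendsto (fun n => eLpNorm (fun x => φ n x - u x) 2 (volume.restrict Ω)) atTop (𝓝 0) ∧
    Tendsto (fun n => eLpNorm (fun x => gradient (φ n) x - Du x) 2 (volume.restrict Ω))
      atTop (𝓝 0)

/-- `H_D^1(Ω₀)`: the functions of `H_0^1(Ω)` that vanish a.e. in `Ω \ Ω₀`. -/
def MemHD1 {N : ℕ} (Ω Ω₀ : Set (EuclideanSpace ℝ (Fin N)))
    (u : EuclideanSpace ℝ (Fin N) → ℝ)
    (Du : EuclideanSpace ℝ (Fin N) → EuclideanSpace ℝ (Fin N)) : Prop :=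
  MemH10 Ω u Du ∧ ∀ᵐ x ∂(volume.restrict (Ω \ Ω₀)), u x = 0

/-- `μ` is an eigenvalue of the Dirichlet form `∫ |∇u|²` with form domain `H_D^1(Ω₀)`. -/
def IsDirichletEigenvalue {N : ℕ} (Ω Ω₀ : Set (EuclideanSpace ℝ (Fin N))) (μ : ℝ) : Prop :=
  ∃ (ψ : EuclideanSpace ℝ (Fin N) → ℝ)
    (Dψ : EuclideanSpace ℝ (Fin N) → EuclideanSpace ℝ (Fin N)),
    MemHD1 Ω Ω₀ ψ Dψ ∧ (¬ ψ =ᵐ[volume.restrict Ω] 0) ∧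
    ∀ (w : EuclideanSpace ℝ (Fin N) → ℝ)
      (Dw : EuclideanSpace ℝ (Fin N) → EuclideanSpace ℝ (Fin N)),
      MemHD1 Ω Ω₀ w Dw → ∫ x in Ω, inner ℝ (Dψ x) (Dw x) = μ * ∫ x in Ω, ψ x * w x

/-- `λ₁(Ω₀)`, the smallest eigenvalue of the Dirichlet form on `H_D^1(Ω₀)`. -/
def firstEigenvalue {N : ℕ} (Ω Ω₀ : Set (EuclideanSpace ℝ (Fin N))) : ℝ :=
  sInf {μ : ℝ | IsDirichletEigenvalue Ω Ω₀ μ}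

/-- A bounded smooth domain: open, connected, bounded, and near each of its boundary points
equal to `{Φ < 0}` for a `C^∞` function `Φ` with nonzero differential at that point. -/
structure IsSmoothBoundedDomain {N : ℕ} (Ω : Set (EuclideanSpace ℝ (Fin N))) : Prop where
  isOpen : IsOpen Ω
  isConnected : IsConnected Ω
  isBounded : Bornology.IsBounded Ω
  smooth_boundary : ∀ x ∈ frontier Ω, ∃ W ∈ 𝓝 x, ∃ Φ : EuclideanSpace ℝ (Fin N) → ℝ,
    ContDiff ℝ ∞ Φ ∧ fderiv ℝ Φ x ≠ 0 ∧ Ω ∩ W = {y ∈ W | Φ y < 0}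

/-- `Ω₀`, the interior of the zero set of `h` in `Ω`. -/
def zeroInterior {N : ℕ} (Ω : Set (EuclideanSpace ℝ (Fin N)))
    (h : EuclideanSpace ℝ (Fin N) → ℝ) : Set (EuclideanSpace ℝ (Fin N)) :=
  interior {x ∈ Ω | h x = 0}

/-- The weight `h`: bounded, nonnegative, nonzero, vanishing on an open set `Ω₀` of positive
measure, and positive a.e. elsewhere. -/
structure IsDegenerateWeight {N : ℕ} (Ω : Set (EuclideanSpace ℝ (Fin N)))
    (h : EuclideanSpace ℝ (Fin N) → ℝ) : Prop where
  memLp_top : MemLp h ⊤ (volume.restrict Ω)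
  nonneg : ∀ᵐ x ∂(volume.restrict Ω), 0 ≤ h x
  ne_zero : ¬ h =ᵐ[volume.restrict Ω] 0
  pos_off : ∀ᵐ x ∂(volume.restrict (Ω \ zeroInterior Ω h)), 0 < h x
  volume_pos : 0 < volume (zeroInterior Ω h)

/-- The assumptions on `g`: continuous, asymptotically linear at `0` and at infinity, with
`g(t) t - 2 G(t) ≤ C |t| + C`, where `G` is the primitive of `g` vanishing at `0`. -/
structure IsAsymptoticallyLinear (g : ℝ → ℝ) : Prop where
  continuous : Continuous g
  differentiableAt_zero : DifferentiableAt ℝ g 0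
  slope_infty : ∃ l : ℝ, Tendsto (fun t => g t / t) atTop (𝓝 l) ∧
    Tendsto (fun t => g t / t) atBot (𝓝 l)
  growth : ∃ C : ℝ, ∀ t : ℝ, g t * t - 2 * (∫ s in (0 : ℝ)..t, g s) ≤ C * |t| + C

/-- The assumptions on `f`, where `F(t) = ∫ s in 0..t, f s`; the exponent `p > 1` is common to
all conditions. -/
structure IsSuperlinear (f : ℝ → ℝ) : Prop where
  continuous : Continuous f
  map_zero : f 0 = 0
  exists_exponent : ∃ p : ℝ, 1 < p ∧
    (∃ R : ℝ, 0 < R ∧ ∀ t : ℝ, R ≤ |t| → (p + 1) * (∫ s in (0 : ℝ)..t, f s) ≤ f t * t) ∧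
    (∀ t : ℝ, t ≠ 0 → 0 < ∫ s in (0 : ℝ)..t, f s) ∧
    (∃ C : ℝ, ∀ t : ℝ, |f t| ≤ C * (1 + |t| ^ p)) ∧
    (∃ C : ℝ, 0 < C ∧ ∀ t s : ℝ, C * |t - s| ^ (p + 1) ≤ (f t - f s) * (t - s))

/-- `u`, with weak gradient `Du`, is a weak solution in `H_0^1(Ω)` of `-Δu = g(u) - h(x) f(u)`
in `Ω`, `u = 0` on `∂Ω`. Local integrability of the right-hand side makes sense of the weak
formulation. -/
structure IsWeakSolution {N : ℕ} (Ω : Set (EuclideanSpace ℝ (Fin N)))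
    (h : EuclideanSpace ℝ (Fin N) → ℝ) (g f : ℝ → ℝ)
    (u : EuclideanSpace ℝ (Fin N) → ℝ)
    (Du : EuclideanSpace ℝ (Fin N) → EuclideanSpace ℝ (Fin N)) : Prop where
  memH10 : MemH10 Ω u Du
  rhs_locallyIntegrable : LocallyIntegrableOn (fun x => g (u x) - h x * f (u x)) Ω
  weak_eq : ∀ φ : EuclideanSpace ℝ (Fin N) → ℝ, IsTestFunction Ω φ →
    ∫ x in Ω, (inner ℝ (Du x) (gradient φ x) - g (u x) * φ x + h x * f (u x) * φ x) = 0

end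

/-!
Write `Ω₀ = zeroInterior Ω h` and `λ = firstEigenvalue Ω Ω₀`, and suppose that `u > 0` is a weak
solution. For smooth positive data the argument is Picone's: testing the equation with `ψ² / u`,
where `ψ` is a first eigenfunction on `Ω₀`, gives

  `∫ g(u) / u * ψ² = ∫ ∇u · ∇(ψ² / u) = ∫ |∇ψ|² - ∫ |∇ψ - (ψ / u) ∇u|²`,

because `h` vanishes where `ψ` does not. As `g(u) / u ≥ λ` and `∫ |∇ψ|² = λ ∫ ψ²`, the last integral
vanishes, so `ψ / u` should be locally constant in the connected set `Ω`, which is impossible: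
`ψ` vanishes outside `Ω₀`, which has positive measure in `Ω`, but is not zero.

* The eigenfunction comes from the direct method (`exists_firstEigenfunction`). The compactness of
  `H_0^1(Ω)` in `L²(Ω)` (`exists_cauchySeq_subseq`) follows from the estimate
  `MemH10.lintegral_mollify_sub_sq_le` of the distance between a function and its mollification.
* `ψ² / u` is not an admissible test function, and `g(u) - h f(u)` is only locally integrable.
  Admissible test functions (`IsAdmissible`) are compactly supported and bounded; those used are
  `T_δ(φ, ψ)² / (u + ε)`, where `φ` is a test function close to `ψ` and `T_δ` a smooth truncation
  (`softTrunc`) that vanishes when either argument does. Letting `φ → ψ`, `δ → 0` and `ε → 0` gives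
  `u ∇ψ = ψ ∇u` almost everywhere (`IsWeakSolution.smul_gradient_eq`).
* Where `u` is locally bounded below by a positive constant, this identity says that
  `arctan (ψ / u)` has zero gradient, so `ψ` is locally a multiple of `u`
  (`exists_ae_eq_const_mul`).
* In `Ω₀` the solution is superharmonic, its mollifications decrease with the scale, and `u` is
  bounded below near every point (`IsWeakSolution.exists_lower_bound_zeroInterior`). So there is a
  point near which `ψ = κ u` with `κ ≠ 0`.
* Elsewhere in `Ω` no strong maximum principle is at hand, since `h f(u)` need not be controlled by
  `u`. But `h = 0` wherever `ψ ≠ 0`, so on any ball `B` inside the open set `proportionalSet Ω u ψ`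
  the weight vanishes, and a barrier adapted to a slightly larger ball bounds `u` below beyond the
  boundary of `B` (`IsWeakSolution.exists_lower_bound_larger_ball`); only `f(t) → 0` as
  `t → 0` is used there. Hence the proportional set is closed in `Ω`, and it is all of `Ω` by
  connectedness. Then `ψ ≠ 0`, and so `h = 0`, almost everywhere in `Ω`, contrary to hypothesis.
-/

noncomputable section

local notation "𝔼" N => EuclideanSpace ℝ (Fin N)

/-! ### Convergence in `L²` -/

section LTwo

variable {α F : Type*} [MeasurableSpace α] {μ : Measure α} [NormedAddCommGroup F]

theorem eLpNorm_two_sq (f : α → F) : eLpNorm f 2 μ ^ 2 = ∫⁻ x, ‖f x‖ₑ ^ 2 ∂μ := by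
  rw [eLpNorm_eq_lintegral_rpow_enorm_toReal (by norm_num) (by norm_num), ← ENNReal.rpow_natCast,
    ← ENNReal.rpow_mul]
  simp

theorem tendsto_eLpNorm_two_iff {f : ℕ → α → F} :
    Tendsto (fun n => eLpNorm (f n) 2 μ) atTop (𝓝 0) ↔
      Tendsto (fun n => ∫⁻ x, ‖f n x‖ₑ ^ 2 ∂μ) atTop (𝓝 0) := by
  simp_rw [← eLpNorm_two_sq]
  constructor
  · intro h
    simpa [Function.comp_def] using ((ENNReal.continuous_pow 2).tendsto 0).comp h
  · intro h
    have := (ENNReal.continuous_rpow_const (y := (1 / 2 : ℝ))).tendsto 0 |>.comp h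
    have e : (fun x : ENNReal => x ^ (1 / 2 : ℝ)) ∘ (fun n => eLpNorm (f n) 2 μ ^ 2)
        = fun n => eLpNorm (f n) 2 μ := by
      funext n
      simp only [Function.comp]
      rw [← ENNReal.rpow_natCast, ← ENNReal.rpow_mul]
      simp
    rw [e] at this
    simpa using this

/-- Dominated convergence to `0` in `L²`. -/
theorem tendsto_eLpNorm_two_of_dominated {f : ℕ → α → F} {G : α → ℝ}
    (hf : ∀ n, AEStronglyMeasurable (f n) μ) (hG : MemLp G 2 μ)
    (hle : ∀ n, ∀ᵐ x ∂μ, ‖f n x‖ ≤ G x)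
    (hlim : ∀ᵐ x ∂μ, Tendsto (fun n => f n x) atTop (𝓝 0)) :
    Tendsto (fun n => eLpNorm (f n) 2 μ) atTop (𝓝 0) := by
  rw [tendsto_eLpNorm_two_iff]
  have h0 : ∫⁻ x, (0 : ENNReal) ∂μ = 0 := by simp
  rw [← h0]
  refine tendsto_lintegral_of_dominated_convergence' (fun x => ‖G x‖ₑ ^ 2)
    (fun n => (hf n).enorm.pow_const 2) ?_ ?_ ?_
  · intro n
    filter_upwards [hle n] with x hx
    gcongr
    exact enorm_le_iff_norm_le.2 (hx.trans (le_abs_self _))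
  · rw [← eLpNorm_two_sq]
    exact ENNReal.pow_ne_top hG.eLpNorm_ne_top
  · filter_upwards [hlim] with x hx
    have := ((ENNReal.continuous_pow 2).tendsto _).comp (hx.enorm)
    simpa [Function.comp_def] using this

/-- `L²` convergence is stable under multiplication by uniformly bounded, almost everywhere
convergent factors. -/
theorem tendsto_eLpNorm_two_smul [NormedSpace ℝ F] {s : ℕ → α → ℝ} {s' : α → ℝ}
    {V : ℕ → α → F} {V' : α → F} {M : ℝ}
    (hs : ∀ n, AEStronglyMeasurable (s n) μ)
    (hV : ∀ n, AEStronglyMeasurable (V n) μ) (hV' : MemLp V' 2 μ)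
    (hbd : ∀ n x, |s n x| ≤ M) (hlim : ∀ᵐ x ∂μ, Tendsto (fun n => s n x) atTop (𝓝 (s' x)))
    (hVV : Tendsto (fun n => eLpNorm (fun x => V n x - V' x) 2 μ) atTop (𝓝 0)) :
    Tendsto (fun n => eLpNorm (fun x => s n x • V n x - s' x • V' x) 2 μ) atTop (𝓝 0) := by
  have hs' : AEStronglyMeasurable s' μ := aestronglyMeasurable_of_tendsto_ae _ hs hlim
  have hbd' : ∀ᵐ x ∂μ, |s' x| ≤ M := by
    filter_upwards [hlim] with x hx
    exact le_of_tendsto hx.abs (Eventually.of_forall fun n => hbd n x)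
  have h1 : Tendsto (fun n => eLpNorm (fun x => (s n x - s' x) • V' x) 2 μ) atTop (𝓝 0) := by
    refine tendsto_eLpNorm_two_of_dominated (G := fun x => 2 * M * ‖V' x‖)
      (fun n => ((hs n).sub hs').smul hV'.1) (hV'.norm.const_mul _) ?_ ?_
    · intro n
      filter_upwards [hbd'] with x hx
      rw [norm_smul]
      gcongr
      calc ‖s n x - s' x‖ ≤ ‖s n x‖ + ‖s' x‖ := norm_sub_le _ _
        _ ≤ 2 * M := by
          have := hbd n x
          rw [Real.norm_eq_abs, Real.norm_eq_abs]; linarith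
    · filter_upwards [hlim] with x hx
      have : Tendsto (fun n => s n x - s' x) atTop (𝓝 0) := by
        simpa using hx.sub_const (s' x)
      simpa using this.smul_const (V' x)
  have h2 : Tendsto (fun n => ENNReal.ofReal M * eLpNorm (fun x => V n x - V' x) 2 μ)
      atTop (𝓝 0) := by
    simpa using ENNReal.Tendsto.const_mul hVV (Or.inr ENNReal.ofReal_ne_top)
  refine tendsto_of_tendsto_of_tendsto_of_le_of_le tendsto_const_nhds
    (by simpa using h2.add h1) (fun _ => zero_le) ?_
  intro n
  have e : (fun x => s n x • V n x - s' x • V' x)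
      = (fun x => s n x • (V n x - V' x)) + fun x => (s n x - s' x) • V' x := by
    funext x; simp [smul_sub, sub_smul]
  beta_reduce
  rw [e]
  refine (eLpNorm_add_le ((hs n).smul ((hV n).sub hV'.1)) (((hs n).sub hs').smul hV'.1)
    (by norm_num)).trans (add_le_add ?_ le_rfl)
  refine eLpNorm_le_mul_eLpNorm_of_ae_le_mul (Eventually.of_forall fun x => ?_) 2
  change ‖s n x • (V n x - V' x)‖ ≤ _
  rw [norm_smul]
  gcongr
  exact hbd n x

theorem tendsto_eLpNorm_two_add {V W : ℕ → α → F} {V' W' : α → F}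
    (hV : ∀ n, AEStronglyMeasurable (fun x => V n x - V' x) μ)
    (hW : ∀ n, AEStronglyMeasurable (fun x => W n x - W' x) μ)
    (hVV : Tendsto (fun n => eLpNorm (fun x => V n x - V' x) 2 μ) atTop (𝓝 0))
    (hWW : Tendsto (fun n => eLpNorm (fun x => W n x - W' x) 2 μ) atTop (𝓝 0)) :
    Tendsto (fun n => eLpNorm (fun x => (V n x + W n x) - (V' x + W' x)) 2 μ) atTop (𝓝 0) := by
  refine tendsto_of_tendsto_of_tendsto_of_le_of_le tendsto_const_nhds
    (by simpa using hVV.add hWW) (fun _ => zero_le) fun n => ?_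
  have e : (fun x => (V n x + W n x) - (V' x + W' x))
      = (fun x => V n x - V' x) + fun x => W n x - W' x := by
    funext x; simp [add_sub_add_comm]
  rw [e]
  exact eLpNorm_add_le (hV n) (hW n) (by norm_num)

theorem MeasureTheory.MemLp.integrable_inner_two [InnerProductSpace ℝ F] {U V : α → F}
    (hU : MemLp U 2 μ) (hV : MemLp V 2 μ) : Integrable (fun x => inner ℝ (U x) (V x)) μ := by
  refine (L2.integrable_inner (𝕜 := ℝ) (hU.toLp U) (hV.toLp V)).congr ?_
  filter_upwards [hU.coeFn_toLp, hV.coeFn_toLp] with x h1 h2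
  rw [h1, h2]

/-- The `L²` pairing with a fixed factor is continuous. -/
theorem tendsto_integral_inner [InnerProductSpace ℝ F] {V : ℕ → α → F} {U V' : α → F}
    (hU : MemLp U 2 μ) (hV : ∀ n, MemLp (V n) 2 μ) (hV' : MemLp V' 2 μ)
    (hVV : Tendsto (fun n => eLpNorm (fun x => V n x - V' x) 2 μ) atTop (𝓝 0)) :
    Tendsto (fun n => ∫ x, inner ℝ (U x) (V n x) ∂μ) atTop (𝓝 (∫ x, inner ℝ (U x) (V' x) ∂μ)) := by
  have key : ∀ {W : α → F} (hW : MemLp W 2 μ),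
      ∫ x, inner ℝ (U x) (W x) ∂μ = inner ℝ (hU.toLp U) (hW.toLp W) := by
    intro W hW
    rw [L2.inner_def]
    refine integral_congr_ae ?_
    filter_upwards [hU.coeFn_toLp, hW.coeFn_toLp] with x h1 h2
    rw [h1, h2]
  rw [key hV']
  have : (fun n => ∫ x, inner ℝ (U x) (V n x) ∂μ)
      = fun n => inner ℝ (hU.toLp U) ((hV n).toLp (V n)) := by
    funext n; exact key (hV n)
  rw [this]
  exact tendsto_const_nhds.inner ((Lp.tendsto_Lp_iff_tendsto_eLpNorm'' V hV V' hV').2 hVV)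

theorem tendsto_lintegral_sq {V : ℕ → α → F} {V' : α → F}
    (hV : ∀ n, MemLp (V n) 2 μ) (hV' : MemLp V' 2 μ)
    (hVV : Tendsto (fun n => eLpNorm (fun x => V n x - V' x) 2 μ) atTop (𝓝 0)) :
    Tendsto (fun n => ∫⁻ x, ‖V n x‖ₑ ^ 2 ∂μ) atTop (𝓝 (∫⁻ x, ‖V' x‖ₑ ^ 2 ∂μ)) := by
  have ht : Tendsto (fun n => eLpNorm (V n) 2 μ) atTop (𝓝 (eLpNorm V' 2 μ)) := by
    have := ((Lp.tendsto_Lp_iff_tendsto_eLpNorm'' _ hV _ hV').2 hVV).enorm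
    simpa [Lp.enorm_toLp] using this
  simp_rw [← eLpNorm_two_sq]
  exact ((ENNReal.continuous_pow 2).tendsto _).comp ht

theorem MeasureTheory.MemLp.lintegral_enorm_sq {V : α → F} (hV : MemLp V 2 μ) :
    ∫⁻ x, ‖V x‖ₑ ^ 2 ∂μ = ENNReal.ofReal (∫ x, ‖V x‖ ^ 2 ∂μ) := by
  rw [ofReal_integral_eq_lintegral_ofReal (hV.integrable_norm_pow (by norm_num))
    (Eventually.of_forall fun x => by positivity)]
  refine lintegral_congr fun x => ?_
  rw [ENNReal.ofReal_pow (norm_nonneg _), ofReal_norm]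

end LTwo

/-! ### Test functions obtained by composition -/

section Admissible

variable {N : ℕ} {Ω : Set (𝔼 N)}

theorem ContDiff.continuous_gradient {φ : (𝔼 N) → ℝ} (hφ : ContDiff ℝ ∞ φ) :
    Continuous (gradient φ) :=
  (InnerProductSpace.toDual ℝ (𝔼 N)).symm.continuous.comp (hφ.continuous_fderiv (by simp))

theorem gradient_eq_zero_of_notMem_tsupport {φ : (𝔼 N) → ℝ} {x : 𝔼 N} (hx : x ∉ tsupport φ) :
    gradient φ x = 0 := by
  have : φ =ᶠ[𝓝 x] fun _ => 0 := notMem_tsupport_iff_eventuallyEq.1 hx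
  rw [this.gradient_eq]
  simp

theorem IsTestFunction.hasCompactSupport_gradient {φ : (𝔼 N) → ℝ} (hφ : IsTestFunction Ω φ) :
    HasCompactSupport (gradient φ) :=
  HasCompactSupport.intro hφ.compact fun _ hx => gradient_eq_zero_of_notMem_tsupport hx

theorem IsTestFunction.hasGradientAt {φ : (𝔼 N) → ℝ} (hφ : IsTestFunction Ω φ) (x : 𝔼 N) :
    HasGradientAt φ (gradient φ x) x :=
  ((hφ.smooth.differentiable (by simp)) x).hasGradientAt

theorem IsTestFunction.memLp {φ : (𝔼 N) → ℝ} (hφ : IsTestFunction Ω φ) (μ : Measure (𝔼 N))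
    [IsFiniteMeasureOnCompacts μ] : MemLp φ 2 μ :=
  hφ.smooth.continuous.memLp_of_hasCompactSupport hφ.compact

theorem IsTestFunction.gradient_memLp {φ : (𝔼 N) → ℝ} (hφ : IsTestFunction Ω φ)
    (μ : Measure (𝔼 N)) [IsFiniteMeasureOnCompacts μ] : MemLp (gradient φ) 2 μ :=
  hφ.smooth.continuous_gradient.memLp_of_hasCompactSupport hφ.hasCompactSupport_gradient

theorem MemH10.exists_ae_approx {u : (𝔼 N) → ℝ} {Du : (𝔼 N) → 𝔼 N} (hu : MemH10 Ω u Du) :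
    ∃ φ : ℕ → (𝔼 N) → ℝ, (∀ n, IsTestFunction Ω (φ n)) ∧
      Tendsto (fun n => eLpNorm (fun x => φ n x - u x) 2 (volume.restrict Ω)) atTop (𝓝 0) ∧
      Tendsto (fun n => eLpNorm (fun x => gradient (φ n) x - Du x) 2 (volume.restrict Ω))
        atTop (𝓝 0) ∧
      (∀ᵐ x ∂volume.restrict Ω, Tendsto (fun n => φ n x) atTop (𝓝 (u x))) ∧
      (∀ᵐ x ∂volume.restrict Ω, Tendsto (fun n => gradient (φ n) x) atTop (𝓝 (Du x))) := by
  obtain ⟨φ, hφ, h1, h2⟩ := hu.approx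
  obtain ⟨n1, hn1, h3⟩ := (tendstoInMeasure_of_tendsto_eLpNorm (p := 2) (by norm_num)
    (fun n => ((hφ n).memLp (volume.restrict Ω)).1) hu.memLp.1 h1).exists_seq_tendsto_ae
  obtain ⟨n2, hn2, h4⟩ := (tendstoInMeasure_of_tendsto_eLpNorm (p := 2) (by norm_num)
    (fun n => ((hφ (n1 n)).gradient_memLp (volume.restrict Ω)).1) hu.grad_memLp.1
    (h2.comp hn1.tendsto_atTop)).exists_seq_tendsto_ae
  refine ⟨fun n => φ (n1 (n2 n)), fun n => hφ _,
    h1.comp (hn1.tendsto_atTop.comp hn2.tendsto_atTop),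
    h2.comp (hn1.tendsto_atTop.comp hn2.tendsto_atTop), ?_, h4⟩
  filter_upwards [h3] with x hx
  exact hx.comp hn2.tendsto_atTop

/-- `w`, with weak gradient `Dw`, is a bounded function of `H_0^1(Ω)` with compact support in `Ω`,
given as a limit of test functions that are uniformly bounded and supported in a common compact
set. Such functions may be inserted into an equation whose right-hand side is only locally
integrable. -/
structure IsAdmissible (Ω : Set (𝔼 N)) (w : (𝔼 N) → ℝ) (Dw : (𝔼 N) → 𝔼 N) : Prop where
  grad_memLp : MemLp Dw 2 (volume.restrict Ω)
  approx : ∃ (φ : ℕ → (𝔼 N) → ℝ) (K : Set (𝔼 N)) (M : ℝ), IsCompact K ∧ K ⊆ Ω ∧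
    (∀ n, IsTestFunction Ω (φ n)) ∧ (∀ n, ∀ x ∉ K, φ n x = 0) ∧ (∀ n x, |φ n x| ≤ M) ∧
    (∀ᵐ x ∂volume.restrict Ω, Tendsto (fun n => φ n x) atTop (𝓝 (w x))) ∧
    Tendsto (fun n => eLpNorm (fun x => gradient (φ n) x - Dw x) 2 (volume.restrict Ω))
      atTop (𝓝 0)

/-- The chain rule for `x ↦ S(x, b(x), c(x))`, where `b, c ∈ H_0^1(Ω)` and `S` is smooth, bounded,
with bounded partial derivatives `Sx`, `Sb`, `Sc`, and vanishes for `x` outside a compact subset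
of `Ω`. -/
theorem IsAdmissible.comp (hΩb : Bornology.IsBounded Ω)
    {b c : (𝔼 N) → ℝ} {Db Dc : (𝔼 N) → 𝔼 N} (hb : MemH10 Ω b Db) (hc : MemH10 Ω c Dc)
    {S Sb Sc : (𝔼 N) → ℝ → ℝ → ℝ} {Sx : (𝔼 N) → ℝ → ℝ → 𝔼 N} {K : Set (𝔼 N)} {M : ℝ}
    (hK : IsCompact K) (hKΩ : K ⊆ Ω)
    (hS : ContDiff ℝ ∞ (fun p : (𝔼 N) × ℝ × ℝ => S p.1 p.2.1 p.2.2))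
    (hgrad : ∀ (β γ : (𝔼 N) → ℝ) (β' γ' : 𝔼 N) (x : 𝔼 N), HasGradientAt β β' x →
      HasGradientAt γ γ' x → HasGradientAt (fun y => S y (β y) (γ y))
        (Sx x (β x) (γ x) + Sb x (β x) (γ x) • β' + Sc x (β x) (γ x) • γ') x)
    (hSx : Continuous (fun p : (𝔼 N) × ℝ × ℝ => Sx p.1 p.2.1 p.2.2))
    (hSb : Continuous (fun p : (𝔼 N) × ℝ × ℝ => Sb p.1 p.2.1 p.2.2))
    (hSc : Continuous (fun p : (𝔼 N) × ℝ × ℝ => Sc p.1 p.2.1 p.2.2))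
    (hSM : ∀ x s t, |S x s t| ≤ M) (hSxM : ∀ x s t, ‖Sx x s t‖ ≤ M)
    (hSbM : ∀ x s t, |Sb x s t| ≤ M) (hScM : ∀ x s t, |Sc x s t| ≤ M)
    (hSK : ∀ x ∉ K, ∀ s t, S x s t = 0) :
    IsAdmissible Ω (fun x => S x (b x) (c x))
      (fun x => Sx x (b x) (c x) + Sb x (b x) (c x) • Db x + Sc x (b x) (c x) • Dc x) := by
  obtain ⟨β, hβ, -, hβ2, hβ3, -⟩ := hb.exists_ae_approx
  obtain ⟨γ, hγ, -, hγ2, hγ3, -⟩ := hc.exists_ae_approx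
  set μ := volume.restrict Ω with hμ
  have : IsFiniteMeasure μ := ⟨by simpa [hμ] using hΩb.measure_lt_top⟩
  have hpair : ∀ n, Continuous (fun x => ((x, β n x, γ n x) : (𝔼 N) × ℝ × ℝ)) := fun n =>
    continuous_id.prodMk ((hβ n).smooth.continuous.prodMk (hγ n).smooth.continuous)
  have hlimp : ∀ᵐ x ∂μ, Tendsto (fun n => ((x, β n x, γ n x) : (𝔼 N) × ℝ × ℝ)) atTop
      (𝓝 (x, b x, c x)) := by
    filter_upwards [hβ3, hγ3] with x h1 h2
    exact tendsto_const_nhds.prodMk_nhds (h1.prodMk_nhds h2)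
  have gradEq : ∀ n, gradient (fun y => S y (β n y) (γ n y)) = fun x =>
      Sx x (β n x) (γ n x) + Sb x (β n x) (γ n x) • gradient (β n) x
        + Sc x (β n x) (γ n x) • gradient (γ n) x := fun n => by
    funext x
    exact (hgrad _ _ _ _ x ((hβ n).hasGradientAt x) ((hγ n).hasGradientAt x)).gradient
  have mSx : ∀ n, AEStronglyMeasurable (fun x => Sx x (β n x) (γ n x)) μ := fun n =>
    (hSx.comp (hpair n)).aestronglyMeasurable
  have mSb : ∀ n, AEStronglyMeasurable (fun x => Sb x (β n x) (γ n x)) μ := fun n =>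
    (hSb.comp (hpair n)).aestronglyMeasurable
  have mSc : ∀ n, AEStronglyMeasurable (fun x => Sc x (β n x) (γ n x)) μ := fun n =>
    (hSc.comp (hpair n)).aestronglyMeasurable
  have lSx : ∀ᵐ x ∂μ, Tendsto (fun n => Sx x (β n x) (γ n x)) atTop (𝓝 (Sx x (b x) (c x))) := by
    filter_upwards [hlimp] with x hx
    exact (hSx.tendsto _).comp hx
  have lSb : ∀ᵐ x ∂μ, Tendsto (fun n => Sb x (β n x) (γ n x)) atTop (𝓝 (Sb x (b x) (c x))) := by
    filter_upwards [hlimp] with x hx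
    exact (hSb.tendsto _).comp hx
  have lSc : ∀ᵐ x ∂μ, Tendsto (fun n => Sc x (β n x) (γ n x)) atTop (𝓝 (Sc x (b x) (c x))) := by
    filter_upwards [hlimp] with x hx
    exact (hSc.tendsto _).comp hx
  have mSx' := aestronglyMeasurable_of_tendsto_ae _ mSx lSx
  have mSb' := aestronglyMeasurable_of_tendsto_ae _ mSb lSb
  have mSc' := aestronglyMeasurable_of_tendsto_ae _ mSc lSc
  have hgβ := fun n => ((hβ n).gradient_memLp μ).1
  have hgγ := fun n => ((hγ n).gradient_memLp μ).1
  have memSx : MemLp (fun x => Sx x (b x) (c x)) 2 μ :=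
    MemLp.of_bound mSx' M (Eventually.of_forall fun x => hSxM _ _ _)
  have memSb : MemLp (fun x => Sb x (b x) (c x) • Db x) 2 μ := by
    refine (hb.grad_memLp.const_smul M).mono (mSb'.smul hb.grad_memLp.1)
      (Eventually.of_forall fun x => ?_)
    simp only [Pi.smul_apply, norm_smul]
    gcongr
    exact (hSbM _ _ _).trans (le_abs_self M)
  have memSc : MemLp (fun x => Sc x (b x) (c x) • Dc x) 2 μ := by
    refine (hc.grad_memLp.const_smul M).mono (mSc'.smul hc.grad_memLp.1)
      (Eventually.of_forall fun x => ?_)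
    simp only [Pi.smul_apply, norm_smul]
    gcongr
    exact (hScM _ _ _).trans (le_abs_self M)
  refine ⟨(memSx.add memSb).add memSc, fun n x => S x (β n x) (γ n x), K, M, hK, hKΩ, ?_, ?_,
    fun n x => hSM _ _ _, ?_, ?_⟩
  · intro n
    have hsub : Function.support (fun x => S x (β n x) (γ n x)) ⊆ K := by
      intro x hx
      by_contra hxK
      exact hx (hSK x hxK _ _)
    exact ⟨hS.comp (contDiff_id.prodMk ((hβ n).smooth.prodMk (hγ n).smooth)),
      HasCompactSupport.intro hK fun x hx => hSK x hx _ _,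
      (closure_minimal hsub hK.isClosed).trans hKΩ⟩
  · intro n x hx
    exact hSK x hx _ _
  · filter_upwards [hlimp] with x hx
    exact (hS.continuous.tendsto _).comp hx
  · simp_rw [gradEq]
    have t1 : Tendsto (fun n => eLpNorm (fun x => Sx x (β n x) (γ n x) - Sx x (b x) (c x)) 2 μ)
        atTop (𝓝 0) := by
      refine tendsto_eLpNorm_two_of_dominated (G := fun _ => 2 * M)
        (fun n => (mSx n).sub mSx') (memLp_const _) ?_ ?_
      · intro n
        refine Eventually.of_forall fun x => (norm_sub_le _ _).trans ?_
        have h1 := hSxM x (β n x) (γ n x)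
        have h2 := hSxM x (b x) (c x)
        linarith
      · filter_upwards [lSx] with x hx
        simpa using hx.sub_const (Sx x (b x) (c x))
    have t2 := tendsto_eLpNorm_two_smul mSb hgβ hb.grad_memLp (fun n x => hSbM _ _ _) lSb hβ2
    have t3 := tendsto_eLpNorm_two_smul mSc hgγ hc.grad_memLp (fun n x => hScM _ _ _) lSc hγ2
    have m1 := fun n => (mSx n).sub mSx'
    have m2 := fun n => ((mSb n).smul (hgβ n)).sub memSb.1
    have m3 := fun n => ((mSc n).smul (hgγ n)).sub memSc.1
    refine tendsto_eLpNorm_two_add (fun n => ?_) m3 (tendsto_eLpNorm_two_add m1 m2 t1 t2) t3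
    exact ((mSx n).add ((mSb n).smul (hgβ n))).sub (memSx.1.add memSb.1)

theorem IsTestFunction.isAdmissible {φ : (𝔼 N) → ℝ} (hφ : IsTestFunction Ω φ) :
    IsAdmissible Ω φ (gradient φ) := by
  obtain ⟨M, hM⟩ := hφ.compact.exists_bound_of_continuous hφ.smooth.continuous
  refine ⟨hφ.gradient_memLp _, fun _ => φ, tsupport φ, M, hφ.compact, hφ.support_subset,
    fun _ => hφ, fun _ x hx => image_eq_zero_of_notMem_tsupport hx, fun _ x => hM x,
    Eventually.of_forall fun x => tendsto_const_nhds, ?_⟩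
  simp

/-- A weak solution satisfies its equation against every admissible function. -/
theorem IsWeakSolution.integral_inner_eq {h u : (𝔼 N) → ℝ} {g f : ℝ → ℝ} {Du : (𝔼 N) → 𝔼 N}
    (hu : IsWeakSolution Ω h g f u Du)
    {w : (𝔼 N) → ℝ} {Dw : (𝔼 N) → 𝔼 N} (hw : IsAdmissible Ω w Dw) :
    IntegrableOn (fun x => (g (u x) - h x * f (u x)) * w x) Ω ∧
      ∫ x in Ω, inner ℝ (Du x) (Dw x) = ∫ x in Ω, (g (u x) - h x * f (u x)) * w x := by
  obtain ⟨φ, K, M, hK, hKΩ, hφ, hφK, hφM, hlim, hgrad⟩ := hw.approx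
  set r : (𝔼 N) → ℝ := fun x => g (u x) - h x * f (u x) with hr
  have hloc : LocallyIntegrableOn r Ω := hu.rhs_locallyIntegrable
  have hrK : IntegrableOn r K := hloc.integrableOn_compact_subset hKΩ hK
  have hmr : AEStronglyMeasurable r (volume.restrict Ω) := hloc.aestronglyMeasurable
  have hbound : Integrable (fun x => M * ‖K.indicator r x‖) (volume.restrict Ω) := by
    refine Integrable.const_mul (Integrable.norm ?_) M
    exact ((integrable_indicator_iff hK.measurableSet).2 hrK).restrict
  have hM0 : 0 ≤ M := (abs_nonneg _).trans (hφM 0 0)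
  have hle : ∀ n, ∀ x, ‖r x * φ n x‖ ≤ M * ‖K.indicator r x‖ := by
    intro n x
    by_cases hx : x ∈ K
    · rw [indicator_of_mem hx, norm_mul, mul_comm]
      gcongr
      exact hφM n x
    · simp [hφK n x hx, hx]
  have hmn : ∀ n, AEStronglyMeasurable (fun x => r x * φ n x) (volume.restrict Ω) := fun n =>
    hmr.mul (hφ n).smooth.continuous.aestronglyMeasurable
  have hlim' : ∀ᵐ x ∂volume.restrict Ω,
      Tendsto (fun n => r x * φ n x) atTop (𝓝 (r x * w x)) := by
    filter_upwards [hlim] with x hx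
    exact hx.const_mul _
  have hint : ∀ n, IntegrableOn (fun x => r x * φ n x) Ω := fun n =>
    hbound.mono' (hmn n) (Eventually.of_forall (hle n))
  have hT1 := tendsto_integral_of_dominated_convergence _ hmn hbound
    (fun n => Eventually.of_forall (hle n)) hlim'
  have hT2 := tendsto_integral_inner hu.memH10.grad_memLp
    (fun n => (hφ n).gradient_memLp (volume.restrict Ω)) hw.grad_memLp hgrad
  have heq : ∀ n, ∫ x in Ω, inner ℝ (Du x) (gradient (φ n) x) = ∫ x in Ω, r x * φ n x := by
    intro n
    have h0 := hu.weak_eq (φ n) (hφ n)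
    have h1 : Integrable (fun x => inner ℝ (Du x) (gradient (φ n) x)) (volume.restrict Ω) :=
      hu.memH10.grad_memLp.integrable_inner_two ((hφ n).gradient_memLp (volume.restrict Ω))
    rw [← sub_eq_zero, ← integral_sub h1 (hint n), ← h0]
    refine integral_congr_ae (Eventually.of_forall fun x => ?_)
    simp only [hr]
    ring
  refine ⟨?_, ?_⟩
  · refine hbound.mono' (aestronglyMeasurable_of_tendsto_ae _ hmn hlim') ?_
    filter_upwards [hlim'] with x hx
    exact le_of_tendsto hx.norm (Eventually.of_forall fun n => hle n x)
  · simp_rw [heq] at hT2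
    exact tendsto_nhds_unique hT2 hT1

end Admissible

/-! ### Mollification -/

section Mollify

theorem sq_lintegral_le {α : Type*} [MeasurableSpace α] (ν : Measure α) {F : α → ENNReal}
    (hF : AEMeasurable F ν) : (∫⁻ x, F x ∂ν) ^ 2 ≤ ν univ * ∫⁻ x, F x ^ 2 ∂ν := by
  have h := ENNReal.lintegral_mul_le_Lp_mul_Lq ν Real.HolderConjugate.two_two
    (f := fun _ => 1) aemeasurable_const hF
  simp only [Pi.mul_apply, one_mul, ENNReal.one_rpow, lintegral_const] at h
  calc (∫⁻ x, F x ∂ν) ^ 2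
      ≤ (ν univ ^ (1 / 2 : ℝ) * (∫⁻ x, F x ^ (2 : ℝ) ∂ν) ^ (1 / 2 : ℝ)) ^ 2 := by gcongr
    _ = ν univ * ∫⁻ x, F x ^ 2 ∂ν := by
      rw [mul_pow, ← ENNReal.rpow_natCast, ← ENNReal.rpow_natCast, ← ENNReal.rpow_mul,
        ← ENNReal.rpow_mul]
      simp

variable {N : ℕ}

/-- On a convex set, the `L²` modulus of continuity is controlled by the gradient. -/
theorem lintegral_translate_sub_sq_le {φ : (𝔼 N) → ℝ} (hφ : ContDiff ℝ ∞ φ) {D : Set (𝔼 N)}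
    (hD : Convex ℝ D) (hDm : MeasurableSet D) (y : 𝔼 N) :
    ∫⁻ x in D ∩ {x | x + y ∈ D}, ‖φ (x + y) - φ x‖ₑ ^ 2
      ≤ ‖y‖ₑ ^ 2 * ∫⁻ x in D, ‖gradient φ x‖ₑ ^ 2 := by
  have hgc : Continuous (gradient φ) := ContDiff.continuous_gradient hφ
  have hsm : MeasurableSet (D ∩ {x | x + y ∈ D}) :=
    hDm.inter (measurable_id.add_const y hDm)
  have hpt : ∀ x, ‖φ (x + y) - φ x‖ₑ ^ 2
      ≤ ∫⁻ t in Ioc (0 : ℝ) 1, ‖y‖ₑ ^ 2 * ‖gradient φ (x + t • y)‖ₑ ^ 2 := by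
    intro x
    have hder : ∀ t : ℝ, HasDerivAt (fun t : ℝ => φ (x + t • y))
        (inner ℝ (gradient φ (x + t • y)) y) t := by
      intro t
      have h1 : HasDerivAt (fun t : ℝ => x + t • y) y t := by
        simpa using ((hasDerivAt_id t).smul_const y).const_add x
      have h2 := ((hφ.differentiable (by simp)) (x + t • y)).hasFDerivAt
      rw [inner_gradient_left]
      exact h2.comp_hasDerivAt t h1
    have hcont : Continuous (fun t : ℝ => inner ℝ (gradient φ (x + t • y)) y) :=
      (hgc.comp (by fun_prop)).inner continuous_const
    have hftc := intervalIntegral.integral_eq_sub_of_hasDerivAt (fun t _ => hder t)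
      (hcont.intervalIntegrable 0 1)
    simp only [one_smul, zero_smul, add_zero] at hftc
    rw [← hftc, intervalIntegral.integral_of_le zero_le_one]
    calc ‖∫ t in Ioc (0 : ℝ) 1, inner ℝ (gradient φ (x + t • y)) y‖ₑ ^ 2
        ≤ (∫⁻ t in Ioc (0 : ℝ) 1, ‖inner ℝ (gradient φ (x + t • y)) y‖ₑ) ^ 2 := by
          gcongr; exact enorm_integral_le_lintegral_enorm _
      _ ≤ (volume.restrict (Ioc (0 : ℝ) 1)) univ
            * ∫⁻ t in Ioc (0 : ℝ) 1, ‖inner ℝ (gradient φ (x + t • y)) y‖ₑ ^ 2 :=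
          sq_lintegral_le _ hcont.enorm.measurable.aemeasurable
      _ = ∫⁻ t in Ioc (0 : ℝ) 1, ‖inner ℝ (gradient φ (x + t • y)) y‖ₑ ^ 2 := by simp
      _ ≤ _ := by
          refine lintegral_mono fun t => ?_
          rw [← mul_pow, ← enorm_norm y, ← enorm_norm (gradient φ _), ← enorm_mul]
          gcongr
          refine enorm_le_iff_norm_le.2 ?_
          rw [norm_mul, norm_norm, norm_norm, mul_comm]
          exact norm_inner_le_norm _ _
  calc ∫⁻ x in D ∩ {x | x + y ∈ D}, ‖φ (x + y) - φ x‖ₑ ^ 2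
      ≤ ∫⁻ x in D ∩ {x | x + y ∈ D}, ∫⁻ t in Ioc (0 : ℝ) 1,
          ‖y‖ₑ ^ 2 * ‖gradient φ (x + t • y)‖ₑ ^ 2 := lintegral_mono hpt
    _ = ∫⁻ t in Ioc (0 : ℝ) 1, ∫⁻ x in D ∩ {x | x + y ∈ D},
          ‖y‖ₑ ^ 2 * ‖gradient φ (x + t • y)‖ₑ ^ 2 := by
        refine lintegral_lintegral_swap ?_
        refine Measurable.aemeasurable ?_
        refine Continuous.measurable ?_
        refine ENNReal.continuous_const_mul (by simp) |>.comp ?_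
        refine (ENNReal.continuous_pow 2).comp ?_
        exact (hgc.comp (by fun_prop)).enorm
    _ ≤ ∫⁻ t in Ioc (0 : ℝ) 1, ‖y‖ₑ ^ 2 * ∫⁻ x in D, ‖gradient φ x‖ₑ ^ 2 := by
        refine setLIntegral_mono' measurableSet_Ioc fun t ht => ?_
        rw [lintegral_const_mul' _ _ (by simp)]
        refine mul_le_mul' le_rfl ?_
        rw [← lintegral_indicator hsm, ← lintegral_indicator hDm,
          ← lintegral_add_right_eq_self (μ := volume)
            (D.indicator fun x => ‖gradient φ x‖ₑ ^ 2) (t • y)]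
        refine lintegral_mono fun x => ?_
        by_cases hx : x ∈ D ∩ {x | x + y ∈ D}
        · rw [indicator_of_mem hx,
            indicator_of_mem (hD.add_smul_mem hx.1 hx.2 (Ioc_subset_Icc_self ht))]
        · simp [indicator_of_notMem hx]
    _ = _ := by simp

/-- The radial bump `exp (-1 / (1 - |y|²))`, extended by zero outside the unit ball. -/
def radialBump (y : 𝔼 N) : ℝ := expNegInvGlue (1 - ‖y‖ ^ 2)

/-- The nonnegative radial kernel `K`, supported in the unit ball, with
`∇ (radialBump) (y) = - K(y) y`. It is not normalised. -/
def radialKernel (y : 𝔼 N) : ℝ :=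
  ((1 - ‖y‖ ^ 2)⁻¹ ^ 2 * expNegInvGlue (1 - ‖y‖ ^ 2)) * 2

theorem contDiff_radialBump : ContDiff ℝ ∞ (radialBump : (𝔼 N) → ℝ) :=
  expNegInvGlue.contDiff.comp (contDiff_const.sub (contDiff_norm_sq ℝ))

theorem continuous_radialKernel : Continuous (radialKernel : (𝔼 N) → ℝ) := by
  have h := expNegInvGlue.continuous_polynomial_eval_inv_mul (Polynomial.X ^ 2)
  simp only [Polynomial.eval_pow, Polynomial.eval_X] at h
  exact (h.comp (by fun_prop : Continuous fun y : 𝔼 N => 1 - ‖y‖ ^ 2)).mul continuous_const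

theorem radialKernel_nonneg (y : 𝔼 N) : 0 ≤ radialKernel y := by
  have := expNegInvGlue.nonneg (1 - ‖y‖ ^ 2)
  unfold radialKernel
  positivity

theorem radialKernel_pos {y : 𝔼 N} (hy : ‖y‖ < 1) : 0 < radialKernel y := by
  have h0 : 0 < 1 - ‖y‖ ^ 2 := by nlinarith [norm_nonneg y]
  have := expNegInvGlue.pos_of_pos h0
  unfold radialKernel
  positivity

theorem radialKernel_eq_zero {y : 𝔼 N} (hy : 1 ≤ ‖y‖) : radialKernel y = 0 := by
  have h0 : 1 - ‖y‖ ^ 2 ≤ 0 := by nlinarith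
  simp [radialKernel, expNegInvGlue.zero_of_nonpos h0]

theorem radialBump_nonneg (y : 𝔼 N) : 0 ≤ radialBump y := expNegInvGlue.nonneg _

theorem radialBump_eq_zero {y : 𝔼 N} (hy : 1 ≤ ‖y‖) : radialBump y = 0 :=
  expNegInvGlue.zero_of_nonpos (by nlinarith)

theorem hasCompactSupport_radialKernel : HasCompactSupport (radialKernel : (𝔼 N) → ℝ) :=
  HasCompactSupport.intro (isCompact_closedBall (0 : 𝔼 N) 1) fun y hy =>
    radialKernel_eq_zero (by simpa using (not_le.1 (by simpa using hy)).le)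

theorem hasGradientAt_radialBump (y : 𝔼 N) :
    HasGradientAt radialBump (-(radialKernel y • y)) y := by
  have h1 : HasDerivAt expNegInvGlue
      ((1 - ‖y‖ ^ 2)⁻¹ ^ 2 * expNegInvGlue (1 - ‖y‖ ^ 2)) (1 - ‖y‖ ^ 2) := by
    simpa using expNegInvGlue.hasDerivAt_polynomial_eval_inv_mul 1 (1 - ‖y‖ ^ 2)
  have h2 : HasFDerivAt (fun y : 𝔼 N => 1 - ‖y‖ ^ 2) (-(2 • innerSL ℝ y)) y := by
    simpa using ((hasStrictFDerivAt_norm_sq y).hasFDerivAt).const_sub 1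
  rw [hasGradientAt_iff_hasFDerivAt]
  refine (h1.comp_hasFDerivAt y h2).congr_fderiv ?_
  ext z
  simp [radialKernel]
  ring

/-- The total mass of `radialKernel`. -/
def radialMass (N : ℕ) : ℝ := ∫ y : 𝔼 N, radialKernel y

theorem integrable_radialKernel : Integrable (radialKernel : (𝔼 N) → ℝ) :=
  continuous_radialKernel.integrable_of_hasCompactSupport hasCompactSupport_radialKernel

theorem radialMass_pos (N : ℕ) : 0 < radialMass N :=
  continuous_radialKernel.integral_pos_of_hasCompactSupport_nonneg_nonzero
    hasCompactSupport_radialKernel radialKernel_nonneg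
    (x := 0) (radialKernel_pos (by simp)).ne'

theorem lintegral_radialKernel :
    ∫⁻ y : 𝔼 N, ENNReal.ofReal (radialKernel y) = ENNReal.ofReal (radialMass N) :=
  (ofReal_integral_eq_lintegral_ofReal integrable_radialKernel
    (Eventually.of_forall radialKernel_nonneg)).symm

/-- Mollification at scale `s` converges in `L²` at the rate `s ‖∇φ‖₂`. -/
theorem lintegral_mollify_sub_sq_le {Ω : Set (𝔼 N)} {φ : (𝔼 N) → ℝ} (hφ : IsTestFunction Ω φ)
    (s : ℝ) :
    ∫⁻ x, ‖(∫ y, φ (x + s • y) * radialKernel y) - radialMass N * φ x‖ₑ ^ 2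
      ≤ ENNReal.ofReal (radialMass N) ^ 2 * ‖s‖ₑ ^ 2 * ∫⁻ x, ‖gradient φ x‖ₑ ^ 2 := by
  have hc := hφ.smooth.continuous
  set k : (𝔼 N) → ENNReal := fun y => ENNReal.ofReal (radialKernel y) with hk
  have hkm : Measurable k := continuous_radialKernel.measurable.ennreal_ofReal
  have hint : ∀ x, Integrable fun y => φ (x + s • y) * radialKernel y := fun x =>
    ((hc.comp (by fun_prop)).mul continuous_radialKernel).integrable_of_hasCompactSupport
      hasCompactSupport_radialKernel.mul_left
  have hpt : ∀ x, ‖(∫ y, φ (x + s • y) * radialKernel y) - radialMass N * φ x‖ₑ ^ 2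
      ≤ ENNReal.ofReal (radialMass N) * ∫⁻ y, k y * ‖φ (x + s • y) - φ x‖ₑ ^ 2 := by
    intro x
    have hm : Measurable fun y : 𝔼 N => ‖φ (x + s • y) - φ x‖ₑ :=
      (((hc.comp (by fun_prop)).sub continuous_const).enorm).measurable
    have e : (∫ y, φ (x + s • y) * radialKernel y) - radialMass N * φ x
        = ∫ y, (φ (x + s • y) - φ x) * radialKernel y := by
      rw [radialMass, ← integral_mul_const, ← integral_sub (hint x)
        (integrable_radialKernel.mul_const _)]
      congr 1 with y
      ring
    rw [e]
    calc ‖∫ y, (φ (x + s • y) - φ x) * radialKernel y‖ₑ ^ 2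
        ≤ (∫⁻ y, k y * ‖φ (x + s • y) - φ x‖ₑ) ^ 2 := by
          gcongr
          refine (enorm_integral_le_lintegral_enorm _).trans (lintegral_mono fun y => ?_)
          rw [enorm_mul, mul_comm, Real.enorm_of_nonneg (radialKernel_nonneg y)]
      _ = (∫⁻ y, ‖φ (x + s • y) - φ x‖ₑ ∂(volume.withDensity k)) ^ 2 := by
          rw [lintegral_withDensity_eq_lintegral_mul _ hkm hm]; rfl
      _ ≤ (volume.withDensity k) univ
            * ∫⁻ y, ‖φ (x + s • y) - φ x‖ₑ ^ 2 ∂(volume.withDensity k) :=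
          sq_lintegral_le _ hm.aemeasurable
      _ = _ := by
          rw [lintegral_withDensity_eq_lintegral_mul _ hkm (hm.pow_const 2),
            withDensity_apply _ MeasurableSet.univ, setLIntegral_univ, lintegral_radialKernel]
          rfl
  have hjm : Measurable (Function.uncurry fun x y : 𝔼 N => k y * ‖φ (x + s • y) - φ x‖ₑ ^ 2) := by
    have : Continuous fun p : (𝔼 N) × 𝔼 N => φ (p.1 + s • p.2) - φ p.1 :=
      (hc.comp (by fun_prop)).sub (hc.comp continuous_fst)
    exact (hkm.comp measurable_snd).mul (this.enorm.measurable.pow_const 2)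
  calc ∫⁻ x, ‖(∫ y, φ (x + s • y) * radialKernel y) - radialMass N * φ x‖ₑ ^ 2
      ≤ ∫⁻ x, ENNReal.ofReal (radialMass N) * ∫⁻ y, k y * ‖φ (x + s • y) - φ x‖ₑ ^ 2 :=
        lintegral_mono hpt
    _ = ENNReal.ofReal (radialMass N) * ∫⁻ y, ∫⁻ x, k y * ‖φ (x + s • y) - φ x‖ₑ ^ 2 := by
        rw [lintegral_const_mul' _ _ (by simp), lintegral_lintegral_swap hjm.aemeasurable]
    _ ≤ ENNReal.ofReal (radialMass N) *
          ∫⁻ y, k y * (‖s‖ₑ ^ 2 * ∫⁻ x, ‖gradient φ x‖ₑ ^ 2) := by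
        refine mul_le_mul' le_rfl (lintegral_mono fun y => ?_)
        rw [lintegral_const_mul' _ _ (by simp [hk])]
        by_cases hy : 1 ≤ ‖y‖
        · simp [hk, radialKernel_eq_zero hy]
        · refine mul_le_mul' le_rfl ?_
          have h1 := lintegral_translate_sub_sq_le hφ.smooth convex_univ MeasurableSet.univ (s • y)
          simp only [mem_univ, ofPred_true, inter_self, setLIntegral_univ] at h1
          refine h1.trans (mul_le_mul' ?_ le_rfl)
          gcongr
          refine enorm_le_iff_norm_le.2 ?_
          rw [norm_smul]
          exact mul_le_of_le_one_right (norm_nonneg _) (not_le.1 hy).le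
    _ = _ := by
        rw [lintegral_mul_const _ hkm, lintegral_radialKernel]
        ring

/-- The kernel at scale `s` centred at `x`. -/
def scaledKernel (s : ℝ) (x z : 𝔼 N) : ℝ := (s ^ N)⁻¹ * radialKernel (s⁻¹ • (z - x))

theorem continuous_scaledKernel (s : ℝ) :
    Continuous fun p : (𝔼 N) × 𝔼 N => scaledKernel s p.1 p.2 :=
  continuous_const.mul (continuous_radialKernel.comp (by fun_prop))

theorem exists_scaledKernel_le (N : ℕ) (s : ℝ) :
    ∃ C, ∀ x z : 𝔼 N, |scaledKernel s x z| ≤ C := by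
  obtain ⟨C, hC⟩ := hasCompactSupport_radialKernel.exists_bound_of_continuous
    (continuous_radialKernel (N := N))
  refine ⟨|(s ^ N)⁻¹| * C, fun x z => ?_⟩
  rw [scaledKernel, abs_mul]
  gcongr
  exact hC _

theorem integral_mul_scaledKernel {s : ℝ} (hs : 0 < s) (v : (𝔼 N) → ℝ) (x : 𝔼 N) :
    ∫ z, v z * scaledKernel s x z = ∫ y, v (x + s • y) * radialKernel y := by
  have h1 := Measure.integral_comp_smul (volume : Measure (𝔼 N))
    (fun z => v (x + z) * radialKernel (s⁻¹ • z)) s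
  have h2 : ∀ y : 𝔼 N, s⁻¹ • s • y = y := fun y => inv_smul_smul₀ hs.ne' y
  simp only [h2, finrank_euclideanSpace, Fintype.card_fin] at h1
  rw [h1, ← integral_add_left_eq_self (μ := volume) (fun z => v z * scaledKernel s x z) x,
    smul_eq_mul, ← integral_const_mul, abs_of_pos (by positivity)]
  congr 1 with z
  simp only [scaledKernel, add_sub_cancel_left]
  ring

theorem IsTestFunction.setIntegral_mul {Ω : Set (𝔼 N)} {φ : (𝔼 N) → ℝ} (hφ : IsTestFunction Ω φ)
    (k : (𝔼 N) → ℝ) : ∫ z in Ω, φ z * k z = ∫ z, φ z * k z :=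
  setIntegral_eq_integral_of_forall_compl_eq_zero fun z hz => by
    rw [image_eq_zero_of_notMem_tsupport fun h => hz (hφ.support_subset h), zero_mul]

theorem IsTestFunction.setLIntegral_gradient {Ω : Set (𝔼 N)} {φ : (𝔼 N) → ℝ}
    (hφ : IsTestFunction Ω φ) :
    ∫⁻ x, ‖gradient φ x‖ₑ ^ 2 = ∫⁻ x in Ω, ‖gradient φ x‖ₑ ^ 2 := by
  refine (setLIntegral_eq_of_support_subset ?_).symm
  intro x hx
  by_contra hxΩ
  refine hx ?_
  simp [gradient_eq_zero_of_notMem_tsupport fun h => hxΩ (hφ.support_subset h)]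

theorem memLp_scaledKernel {Ω : Set (𝔼 N)} (hΩb : Bornology.IsBounded Ω) (s : ℝ) (x : 𝔼 N) :
    MemLp (scaledKernel s x) 2 (volume.restrict Ω) := by
  have : IsFiniteMeasure (volume.restrict Ω) := ⟨by simpa using hΩb.measure_lt_top⟩
  obtain ⟨C, hC⟩ := exists_scaledKernel_le N s
  exact MemLp.of_bound ((continuous_scaledKernel s).comp
    (continuous_const.prodMk continuous_id)).aestronglyMeasurable C
    (Eventually.of_forall fun z => hC x z)

theorem MemH10.lintegral_mollify_sub_sq_le {Ω : Set (𝔼 N)} (hΩb : Bornology.IsBounded Ω)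
    {u : (𝔼 N) → ℝ} {Du : (𝔼 N) → 𝔼 N} (hu : MemH10 Ω u Du) {s : ℝ} (hs : 0 < s) :
    ∫⁻ x in Ω, ‖(∫ z in Ω, u z * scaledKernel s x z) - radialMass N * u x‖ₑ ^ 2
      ≤ ENNReal.ofReal (radialMass N) ^ 2 * ‖s‖ₑ ^ 2 * ∫⁻ x in Ω, ‖Du x‖ₑ ^ 2 := by
  obtain ⟨φ, hφ, h1, h2, h3, -⟩ := hu.exists_ae_approx
  set μ := volume.restrict Ω with hμ
  have hconv : ∀ x, Tendsto (fun n => ∫ z in Ω, φ n z * scaledKernel s x z) atTop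
      (𝓝 (∫ z in Ω, u z * scaledKernel s x z)) := by
    intro x
    have := tendsto_integral_inner (memLp_scaledKernel hΩb s x)
      (fun n => (hφ n).memLp (volume.restrict Ω)) hu.memLp h1
    simpa using this
  have hgr : Tendsto (fun n => ∫⁻ x in Ω, ‖gradient (φ n) x‖ₑ ^ 2) atTop
      (𝓝 (∫⁻ x in Ω, ‖Du x‖ₑ ^ 2)) :=
    tendsto_lintegral_sq (fun n => (hφ n).gradient_memLp μ) hu.grad_memLp h2
  have hle : ∀ n, ∫⁻ x in Ω, ‖(∫ z in Ω, φ n z * scaledKernel s x z) - radialMass N * φ n x‖ₑ ^ 2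
      ≤ ENNReal.ofReal (radialMass N) ^ 2 * ‖s‖ₑ ^ 2 * ∫⁻ x in Ω, ‖gradient (φ n) x‖ₑ ^ 2 := by
    intro n
    rw [← (hφ n).setLIntegral_gradient]
    refine le_trans ?_ (_root_.lintegral_mollify_sub_sq_le (hφ n) s)
    refine (setLIntegral_le_lintegral _ _).trans_eq ?_
    congr 1 with x
    rw [(hφ n).setIntegral_mul, integral_mul_scaledKernel hs]
  have hmeas : ∀ n, AEMeasurable (fun x =>
      ‖(∫ z in Ω, φ n z * scaledKernel s x z) - radialMass N * φ n x‖ₑ ^ 2) μ := by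
    intro n
    have hj : StronglyMeasurable (Function.uncurry fun x z => φ n z * scaledKernel s x z) :=
      (((hφ n).smooth.continuous.comp continuous_snd).mul
        (continuous_scaledKernel s)).stronglyMeasurable
    have h4 : StronglyMeasurable fun x => ∫ z in Ω, φ n z * scaledKernel s x z :=
      hj.integral_prod_right
    exact ((h4.sub ((hφ n).smooth.continuous.stronglyMeasurable.const_mul _)).enorm.pow_const
      2).aemeasurable
  calc ∫⁻ x in Ω, ‖(∫ z in Ω, u z * scaledKernel s x z) - radialMass N * u x‖ₑ ^ 2
      = ∫⁻ x in Ω, liminf (fun n =>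
          ‖(∫ z in Ω, φ n z * scaledKernel s x z) - radialMass N * φ n x‖ₑ ^ 2) atTop := by
        refine lintegral_congr_ae ?_
        filter_upwards [h3] with x hx
        refine (Tendsto.liminf_eq ?_).symm
        exact ((ENNReal.continuous_pow 2).tendsto _).comp
          ((hconv x).sub (hx.const_mul _)).enorm
    _ ≤ liminf (fun n => ∫⁻ x in Ω,
          ‖(∫ z in Ω, φ n z * scaledKernel s x z) - radialMass N * φ n x‖ₑ ^ 2) atTop :=
        lintegral_liminf_le' hmeas
    _ ≤ liminf (fun n => ENNReal.ofReal (radialMass N) ^ 2 * ‖s‖ₑ ^ 2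
          * ∫⁻ x in Ω, ‖gradient (φ n) x‖ₑ ^ 2) atTop :=
        liminf_le_liminf (Eventually.of_forall hle)
    _ = _ := (ENNReal.Tendsto.const_mul hgr (Or.inr (by finiteness))).liminf_eq

end Mollify

/-! ### Minimisation of a Rayleigh quotient -/

/-- Minimisation of the quotient `‖p.2‖² / ‖p.1‖²` over a closed subspace in which bounded
sequences have a subsequence with convergent first components: the minimum `l` is attained, and a
minimiser satisfies the Euler-Lagrange equation. -/
theorem Submodule.exists_minimizer {X Y : Type*} [NormedAddCommGroup X] [InnerProductSpace ℝ X]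
    [CompleteSpace X] [NormedAddCommGroup Y] [InnerProductSpace ℝ Y] [CompleteSpace Y]
    (V : Submodule ℝ (X × Y)) (hV : IsClosed (V : Set (X × Y))) (hne : ∃ p ∈ V, p.1 ≠ 0)
    (hcpt : ∀ (v : ℕ → X × Y) (M : ℝ), (∀ n, v n ∈ V) → (∀ n, ‖v n‖ ≤ M) →
      ∃ σ : ℕ → ℕ, StrictMono σ ∧ CauchySeq fun n => (v (σ n)).1) :
    ∃ l : ℝ, 0 ≤ l ∧ (∃ p ∈ V, p.1 ≠ 0 ∧
        ∀ w ∈ V, inner ℝ p.2 w.2 = l * inner ℝ p.1 w.1) ∧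
      ∀ w ∈ V, l * ‖w.1‖ ^ 2 ≤ ‖w.2‖ ^ 2 := by
  set S : Set ℝ := {a | ∃ p ∈ V, ‖p.1‖ = 1 ∧ ‖p.2‖ ^ 2 = a} with hS
  have hSb : BddBelow S := ⟨0, by rintro a ⟨p, -, -, rfl⟩; positivity⟩
  have hnorm : ∀ w ∈ V, w.1 ≠ 0 → ‖w.2‖ ^ 2 / ‖w.1‖ ^ 2 ∈ S := by
    intro w hw h0
    have h0' : ‖w.1‖ ≠ 0 := norm_ne_zero_iff.2 h0
    refine ⟨‖w.1‖⁻¹ • w, V.smul_mem _ hw, ?_, ?_⟩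
    · simp [norm_smul, h0']
    · simp only [Prod.smul_snd, norm_smul, norm_inv, norm_norm]
      field_simp
  obtain ⟨p0, hp0, hp0'⟩ := hne
  have hSne : S.Nonempty := ⟨_, hnorm p0 hp0 hp0'⟩
  set l := sInf S with hl
  have hl0 : 0 ≤ l := Real.sInf_nonneg (by rintro a ⟨p, -, -, rfl⟩; positivity)
  have hray : ∀ w ∈ V, l * ‖w.1‖ ^ 2 ≤ ‖w.2‖ ^ 2 := by
    intro w hw
    by_cases h0 : w.1 = 0
    · simp [h0]
    · have h1 : l ≤ ‖w.2‖ ^ 2 / ‖w.1‖ ^ 2 := csInf_le hSb (hnorm w hw h0)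
      have h2 : 0 < ‖w.1‖ ^ 2 := by have := norm_pos_iff.2 h0; positivity
      exact (le_div_iff₀ h2).1 h1
  have hseq : ∀ n : ℕ, ∃ p ∈ V, ‖p.1‖ = 1 ∧ ‖p.2‖ ^ 2 < l + 1 / ((n : ℝ) + 1) := by
    intro n
    have : l < l + 1 / ((n : ℝ) + 1) := by
      have : (0 : ℝ) < 1 / ((n : ℝ) + 1) := by positivity
      linarith
    obtain ⟨a, ⟨p, hp, hp1, rfl⟩, ha⟩ := exists_lt_of_csInf_lt hSne this
    exact ⟨p, hp, hp1, ha⟩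
  choose v hvV hv1 hv2 using hseq
  have hbd : ∀ n, ‖v n‖ ≤ l + 2 := by
    intro n
    have h1 := hv2 n
    have h2 : 1 / ((n : ℝ) + 1) ≤ 1 := by
      rw [div_le_one (by positivity)]; linarith [(Nat.cast_nonneg n : (0 : ℝ) ≤ n)]
    refine max_le (by rw [hv1]; linarith) ?_
    nlinarith [norm_nonneg (v n).2]
  obtain ⟨σ, hσ, hc1⟩ := hcpt v (l + 2) hvV hbd
  have hpar : ∀ n m, ‖(v n).2 - (v m).2‖ ^ 2
      ≤ 2 / ((n : ℝ) + 1) + 2 / ((m : ℝ) + 1) + l * ‖(v n).1 - (v m).1‖ ^ 2 := by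
    intro n m
    have h1 := parallelogram_law_with_norm ℝ (v n).1 (v m).1
    have h2 := parallelogram_law_with_norm ℝ (v n).2 (v m).2
    have h3 := hray _ (V.add_mem (hvV n) (hvV m))
    simp only [Prod.fst_add, Prod.snd_add] at h3
    have h4 := hv2 n
    have h5 := hv2 m
    rw [hv1, hv1] at h1
    have h6 : ‖(v n).1 + (v m).1‖ ^ 2 = 4 - ‖(v n).1 - (v m).1‖ ^ 2 := by nlinarith
    rw [h6] at h3
    have e1 : 2 / ((n : ℝ) + 1) = 2 * (1 / ((n : ℝ) + 1)) := by ring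
    have e2 : 2 / ((m : ℝ) + 1) = 2 * (1 / ((m : ℝ) + 1)) := by ring
    rw [e1, e2]
    nlinarith
  have hc2 : CauchySeq fun n => (v (σ n)).2 := by
    rw [Metric.cauchySeq_iff]
    intro ε hε
    obtain ⟨n1, hn1⟩ := Metric.cauchySeq_iff.1 hc1 (ε / (2 * (l + 1))) (by positivity)
    obtain ⟨n2, hn2⟩ := exists_nat_gt (8 / ε ^ 2)
    have hε2 : 0 < ε ^ 2 := by positivity
    have hsmall : ∀ n, n2 ≤ n → 2 / ((σ n : ℝ) + 1) < ε ^ 2 / 4 := by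
      intro n hn
      have h1 : (n2 : ℝ) ≤ σ n := by exact_mod_cast hn.trans (hσ.id_le n)
      rw [div_lt_iff₀ (by positivity)]
      rw [div_lt_iff₀ hε2] at hn2
      nlinarith
    refine ⟨max n1 n2, fun m hm n hn => ?_⟩
    have h1 := hn1 m (le_of_max_le_left hm) n (le_of_max_le_left hn)
    rw [dist_eq_norm] at h1 ⊢
    have h2 := hpar (σ m) (σ n)
    have h3 := hsmall m (le_of_max_le_right hm)
    have h4 := hsmall n (le_of_max_le_right hn)
    have h5 : l * ‖(v (σ m)).1 - (v (σ n)).1‖ ^ 2 ≤ ε ^ 2 / 4 := by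
      calc l * ‖(v (σ m)).1 - (v (σ n)).1‖ ^ 2 ≤ (l + 1) ^ 2 * (ε / (2 * (l + 1))) ^ 2 := by
            gcongr
            nlinarith
        _ = ε ^ 2 / 4 := by field_simp; norm_num
    exact lt_of_pow_lt_pow_left₀ 2 hε.le (by linarith)
  obtain ⟨x, hx⟩ := cauchySeq_tendsto_of_complete hc1
  obtain ⟨y, hy⟩ := cauchySeq_tendsto_of_complete hc2
  have hxyV : (x, y) ∈ V :=
    hV.mem_of_tendsto (hx.prodMk_nhds hy) (Eventually.of_forall fun n => hvV (σ n))
  have hx1 : ‖x‖ = 1 := by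
    refine tendsto_nhds_unique hx.norm ?_
    simp [hv1]
  have hy1 : ‖y‖ ^ 2 ≤ l := by
    have t1 : Tendsto (fun n => l + 1 / ((σ n : ℝ) + 1)) atTop (𝓝 (l + 0)) :=
      tendsto_const_nhds.add (tendsto_one_div_add_atTop_nhds_zero_nat.comp hσ.tendsto_atTop)
    rw [add_zero] at t1
    exact le_of_tendsto_of_tendsto (hy.norm.pow 2) t1
      (Eventually.of_forall fun n => (hv2 (σ n)).le)
  refine ⟨l, hl0, ⟨(x, y), hxyV, ?_, ?_⟩, hray⟩
  · intro h
    have h' : x = 0 := h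
    simp [h'] at hx1
  · intro w hw
    simp only
    -- The nonnegative quadratic `t ↦ 2 t B + t² C` has a vanishing linear coefficient.
    set B := inner ℝ y w.2 - l * inner ℝ x w.1 with hB
    set C := ‖w.2‖ ^ 2 - l * ‖w.1‖ ^ 2 with hC
    have hC0 : 0 ≤ C := by have := hray w hw; linarith
    have hq : ∀ t : ℝ, 0 ≤ 2 * t * B + t ^ 2 * C := by
      intro t
      have h1 := hray _ (V.add_mem hxyV (V.smul_mem t hw))
      simp only [Prod.fst_add, Prod.snd_add, Prod.smul_fst, Prod.smul_snd] at h1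
      rw [norm_add_sq_real, norm_add_sq_real, norm_smul, norm_smul, real_inner_smul_right,
        real_inner_smul_right, hx1, mul_pow, mul_pow, Real.norm_eq_abs, sq_abs] at h1
      rw [hB, hC]
      nlinarith
    have h2 := hq (-B / (C + 1))
    have h3 : 2 * (-B / (C + 1)) * B + (-B / (C + 1)) ^ 2 * C
        = -(B ^ 2 * (C + 2) / (C + 1) ^ 2) := by
      field_simp
      ring
    rw [h3] at h2
    have h4 : B ^ 2 * (C + 2) / (C + 1) ^ 2 ≤ 0 := by linarith
    have h5 : B ^ 2 ≤ 0 := by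
      have : 0 < (C + 2) / (C + 1) ^ 2 := by positivity
      rw [mul_div_assoc] at h4
      exact nonpos_of_mul_nonpos_left h4 this
    have h6 : B = 0 := by nlinarith
    linarith

/-! ### Compactness of the embedding of `H_0^1` into `L²` -/

section Rellich

variable {N : ℕ} {Ω : Set (𝔼 N)}

/-- Bounded sequences in a separable Hilbert space have weakly convergent subsequences. -/
theorem exists_subseq_tendsto_inner {X : Type*} [NormedAddCommGroup X] [InnerProductSpace ℝ X]
    [CompleteSpace X] [TopologicalSpace.SeparableSpace X] (v : ℕ → X) {M : ℝ}
    (hv : ∀ n, ‖v n‖ ≤ M) :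
    ∃ σ : ℕ → ℕ, StrictMono σ ∧ ∃ a : X → ℝ, ∀ k,
      Tendsto (fun n => inner ℝ (v (σ n)) k) atTop (𝓝 (a k)) := by
  have hc := WeakDual.isSeqCompact_closedBall ℝ X (0 : StrongDual ℝ X) M
  obtain ⟨a, -, σ, hσ, ha⟩ := hc (x := fun n =>
    StrongDual.toWeakDual (InnerProductSpace.toDual ℝ X (v n))) (fun n => by
      have : ‖InnerProductSpace.toDual ℝ X (v n)‖ ≤ M := by simpa using hv n
      simpa using this)
  refine ⟨σ, hσ, fun k => a k, fun k => ?_⟩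
  exact ((WeakDual.eval_continuous k).tendsto a).comp ha

/-- The Rellich-Kondrachov theorem: mollifications of a weakly convergent sequence converge
pointwise and boundedly, hence in `L²`, and they approximate the sequence uniformly in `L²`. -/
theorem exists_cauchySeq_subseq (hΩb : Bornology.IsBounded Ω)
    (v : ℕ → Lp ℝ 2 (volume.restrict Ω)) (Dv : ℕ → Lp (𝔼 N) 2 (volume.restrict Ω))
    (hv : ∀ n, MemH10 Ω (v n) (Dv n)) {M : ℝ} (hM : ∀ n, ‖v n‖ ≤ M) (hDM : ∀ n, ‖Dv n‖ ≤ M) :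
    ∃ σ : ℕ → ℕ, StrictMono σ ∧ CauchySeq fun n => v (σ n) := by
  have : IsFiniteMeasure (volume.restrict Ω) := ⟨by simpa using hΩb.measure_lt_top⟩
  have : Fact ((2 : ENNReal) ≠ ⊤) := ⟨by norm_num⟩
  obtain ⟨σ, hσ, a, ha⟩ := exists_subseq_tendsto_inner v hM
  refine ⟨σ, hσ, ?_⟩
  have hM0 : 0 ≤ M := (norm_nonneg _).trans (hM 0)
  have hm := radialMass_pos N
  -- `A s n` is the mollification at scale `s` of the `n`-th term of the subsequence.
  set A : ℝ → ℕ → (𝔼 N) → ℝ := fun s n x => ∫ z in Ω, v (σ n) z * scaledKernel s x z with hA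
  have hAinner : ∀ s n x, A s n x = inner ℝ (v (σ n)) ((memLp_scaledKernel hΩb s x).toLp _) := by
    intro s n x
    rw [L2.inner_def]
    refine integral_congr_ae ?_
    filter_upwards [(memLp_scaledKernel hΩb s x).coeFn_toLp] with z hz
    rw [hz]
    simp [mul_comm]
  have hAm : ∀ s n, AEStronglyMeasurable (A s n) (volume.restrict Ω) := by
    intro s n
    have hj : StronglyMeasurable
        (Function.uncurry fun x z : 𝔼 N => v (σ n) z * scaledKernel s x z) :=
      ((Lp.stronglyMeasurable (v (σ n))).comp_measurable measurable_snd).mul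
        (continuous_scaledKernel s).stronglyMeasurable
    exact hj.integral_prod_right.aestronglyMeasurable
  have hAb : ∀ s, ∃ C, ∀ n x, |A s n x| ≤ C := by
    intro s
    obtain ⟨C, hC⟩ := exists_scaledKernel_le N s
    have hC0 : 0 ≤ C := (abs_nonneg _).trans (hC 0 0)
    refine ⟨M * (measureUnivNNReal (volume.restrict Ω) ^ (2 : ENNReal).toReal⁻¹ * C), fun n x => ?_⟩
    rw [hAinner]
    refine (abs_real_inner_le_norm _ _).trans ?_
    refine mul_le_mul (hM _) ?_ (norm_nonneg _) hM0
    refine Lp.norm_le_of_ae_bound hC0 ?_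
    filter_upwards [(memLp_scaledKernel hΩb s x).coeFn_toLp] with z hz
    rw [hz]
    exact hC x z
  have hAmem : ∀ s n, MemLp (A s n) 2 (volume.restrict Ω) := fun s n => by
    obtain ⟨C, hC⟩ := hAb s
    exact MemLp.of_bound (hAm s n) C (Eventually.of_forall fun x => hC n x)
  -- At a fixed scale, weak convergence gives bounded pointwise convergence.
  have hAcauchy : ∀ s, CauchySeq fun n => (hAmem s n).toLp (A s n) := by
    intro s
    obtain ⟨C, hC⟩ := hAb s
    set L : (𝔼 N) → ℝ := fun x => a ((memLp_scaledKernel hΩb s x).toLp _) with hL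
    have hlim : ∀ x, Tendsto (fun n => A s n x) atTop (𝓝 (L x)) := by
      intro x
      simp_rw [hAinner]
      exact ha _
    have hLm : AEStronglyMeasurable L (volume.restrict Ω) :=
      aestronglyMeasurable_of_tendsto_ae _ (hAm s) (Eventually.of_forall hlim)
    have hLC : ∀ x, |L x| ≤ C := fun x =>
      le_of_tendsto (hlim x).abs (Eventually.of_forall fun n => hC n x)
    have hLmem : MemLp L 2 (volume.restrict Ω) := MemLp.of_bound hLm C (Eventually.of_forall hLC)
    refine Tendsto.cauchySeq (x := hLmem.toLp L) ?_
    refine (Lp.tendsto_Lp_iff_tendsto_eLpNorm'' _ (hAmem s) L hLmem).2 ?_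
    refine tendsto_eLpNorm_two_of_dominated (G := fun _ => 2 * C)
      (fun n => (hAm s n).sub hLm) (memLp_const _) ?_ ?_
    · intro n
      refine Eventually.of_forall fun x => (norm_sub_le _ _).trans ?_
      have h1 := hC n x
      have h2 := hLC x
      rw [Real.norm_eq_abs, Real.norm_eq_abs]
      linarith
    · exact Eventually.of_forall fun x => by simpa using (hlim x).sub_const (L x)
  have hAv : ∀ s, 0 < s → ∀ n,
      ‖(hAmem s n).toLp (A s n) - radialMass N • v (σ n)‖ ≤ radialMass N * s * M := by
    intro s hs n
    have h1 := (hv (σ n)).lintegral_mollify_sub_sq_le hΩb hs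
    have h2 : ‖(hAmem s n).toLp (A s n) - radialMass N • v (σ n)‖ₑ ^ 2
        ≤ (ENNReal.ofReal (radialMass N) * ‖s‖ₑ * ‖Dv (σ n)‖ₑ) ^ 2 := by
      rw [mul_pow, mul_pow, Lp.enorm_def, Lp.enorm_def, eLpNorm_two_sq, eLpNorm_two_sq]
      refine le_trans (le_of_eq ?_) h1
      refine lintegral_congr_ae ?_
      filter_upwards [Lp.coeFn_sub ((hAmem s n).toLp (A s n)) (radialMass N • v (σ n)),
        (hAmem s n).coeFn_toLp, Lp.coeFn_smul (radialMass N) (v (σ n))] with x e1 e2 e3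
      rw [e1, Pi.sub_apply, e2, e3]
      rfl
    have h3 := (ENNReal.pow_le_pow_left_iff two_ne_zero).1 h2
    have h4 : ‖(hAmem s n).toLp (A s n) - radialMass N • v (σ n)‖ₑ
        ≤ ENNReal.ofReal (radialMass N * s * M) := by
      refine h3.trans ?_
      rw [ENNReal.ofReal_mul (by positivity), ENNReal.ofReal_mul hm.le,
        Real.enorm_of_nonneg hs.le, ← ofReal_norm]
      gcongr
      exact hDM _
    rw [← ofReal_norm] at h4
    exact (ENNReal.ofReal_le_ofReal_iff (by positivity)).1 h4
  rw [Metric.cauchySeq_iff]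
  intro ε hε
  set s := ε / (4 * (M + 1)) with hs
  have hs0 : 0 < s := by positivity
  have hsM : s * M ≤ ε / 4 := by
    rw [hs, div_mul_eq_mul_div, div_le_div_iff₀ (by positivity) (by norm_num)]
    nlinarith
  obtain ⟨n0, hn0⟩ := Metric.cauchySeq_iff.1 (hAcauchy s) (radialMass N * (ε / 2)) (by positivity)
  refine ⟨n0, fun i hi j hj => ?_⟩
  have h1 := hn0 i hi j hj
  rw [dist_eq_norm] at h1 ⊢
  have h2 := hAv s hs0 i
  have h3 := hAv s hs0 j
  have h4 : radialMass N * ‖v (σ i) - v (σ j)‖ < radialMass N * ε := by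
    have e : radialMass N • (v (σ i) - v (σ j))
        = ((hAmem s i).toLp (A s i) - (hAmem s j).toLp (A s j))
          - ((hAmem s i).toLp (A s i) - radialMass N • v (σ i))
          + ((hAmem s j).toLp (A s j) - radialMass N • v (σ j)) := by
      rw [smul_sub]; abel
    have e2 : radialMass N * ‖v (σ i) - v (σ j)‖ = ‖radialMass N • (v (σ i) - v (σ j))‖ := by
      rw [norm_smul, Real.norm_of_nonneg hm.le]
    rw [e2, e]
    refine lt_of_le_of_lt ((norm_add_le _ _).trans (add_le_add (norm_sub_le _ _) le_rfl)) ?_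
    nlinarith
  exact lt_of_mul_lt_mul_left h4 hm.le

end Rellich

/-! ### The first eigenfunction -/

section Eigenfunction

variable {N : ℕ} {Ω Ω₀ : Set (𝔼 N)}

theorem IsTestFunction.memH10 {φ : (𝔼 N) → ℝ} (hφ : IsTestFunction Ω φ) :
    MemH10 Ω φ (gradient φ) :=
  ⟨hφ.memLp _, hφ.gradient_memLp _, fun _ => φ, fun _ => hφ, by simp, by simp⟩

theorem isTestFunction_zero : IsTestFunction Ω (fun _ : 𝔼 N => (0 : ℝ)) :=
  ⟨contDiff_const, HasCompactSupport.zero, by simp [tsupport]⟩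

theorem IsTestFunction.smul_add {φ ψ : (𝔼 N) → ℝ} (hφ : IsTestFunction Ω φ)
    (hψ : IsTestFunction Ω ψ) (c : ℝ) : IsTestFunction Ω (fun x => c * φ x + ψ x) := by
  refine ⟨(contDiff_const.mul hφ.smooth).add hψ.smooth, (hφ.compact.mul_left).add hψ.compact, ?_⟩
  refine (tsupport_add _ _).trans (union_subset ?_ hψ.support_subset)
  exact (closure_mono (Function.support_const_smul_subset c φ)).trans hφ.support_subset

theorem IsTestFunction.gradient_smul_add {φ ψ : (𝔼 N) → ℝ} (hφ : IsTestFunction Ω φ)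
    (hψ : IsTestFunction Ω ψ) (c : ℝ) (x : 𝔼 N) :
    gradient (fun x => c * φ x + ψ x) x = c • gradient φ x + gradient ψ x := by
  refine HasGradientAt.gradient ?_
  rw [hasGradientAt_iff_hasFDerivAt]
  have h1 := (hφ.hasGradientAt x).hasFDerivAt
  have h2 := (hψ.hasGradientAt x).hasFDerivAt
  refine ((h1.const_mul c).add h2).congr_fderiv ?_
  ext z
  simp

theorem MemH10.smul_add {u v : (𝔼 N) → ℝ} {Du Dv : (𝔼 N) → 𝔼 N} (hu : MemH10 Ω u Du)
    (hv : MemH10 Ω v Dv) (c : ℝ) :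
    MemH10 Ω (fun x => c * u x + v x) (fun x => c • Du x + Dv x) := by
  obtain ⟨φ, hφ, h1, h2⟩ := hu.approx
  obtain ⟨ψ, hψ, h3, h4⟩ := hv.approx
  refine ⟨(hu.memLp.const_mul c).add hv.memLp, (hu.grad_memLp.const_smul c).add hv.grad_memLp,
    fun n x => c * φ n x + ψ n x, fun n => (hφ n).smul_add (hψ n) c, ?_, ?_⟩
  · refine tendsto_eLpNorm_two_add (V := fun n x => c * φ n x) (V' := fun x => c * u x)
      (fun n => ((((hφ n).memLp _).1.const_mul c).sub (hu.memLp.1.const_mul c)))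
      (fun n => (((hψ n).memLp _).1.sub hv.memLp.1)) ?_ h3
    exact tendsto_eLpNorm_two_smul (s := fun _ _ => c) (s' := fun _ => c) (M := |c|)
      (fun n => aestronglyMeasurable_const) (fun n => ((hφ n).memLp _).1) hu.memLp
      (fun _ _ => le_rfl) (Eventually.of_forall fun _ => tendsto_const_nhds) h1
  · simp_rw [fun n => (hφ n).gradient_smul_add (hψ n) c]
    refine tendsto_eLpNorm_two_add (V := fun n x => c • gradient (φ n) x)
      (V' := fun x => c • Du x)
      (fun n => ((((hφ n).gradient_memLp _).1.const_smul c).sub (hu.grad_memLp.1.const_smul c)))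
      (fun n => (((hψ n).gradient_memLp _).1.sub hv.grad_memLp.1)) ?_ h4
    exact tendsto_eLpNorm_two_smul (s := fun _ _ => c) (s' := fun _ => c) (M := |c|)
      (fun n => aestronglyMeasurable_const) (fun n => ((hφ n).gradient_memLp _).1) hu.grad_memLp
      (fun _ _ => le_rfl) (Eventually.of_forall fun _ => tendsto_const_nhds) h2

theorem MemH10.congr {u v : (𝔼 N) → ℝ} {Du Dv : (𝔼 N) → 𝔼 N} (hu : MemH10 Ω u Du)
    (h1 : u =ᵐ[volume.restrict Ω] v) (h2 : Du =ᵐ[volume.restrict Ω] Dv) : MemH10 Ω v Dv := by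
  obtain ⟨φ, hφ, h3, h4⟩ := hu.approx
  refine ⟨(memLp_congr_ae h1).1 hu.memLp, (memLp_congr_ae h2).1 hu.grad_memLp, φ, hφ, ?_, ?_⟩
  · refine h3.congr fun n => eLpNorm_congr_ae ?_
    filter_upwards [h1] with x hx
    rw [hx]
  · refine h4.congr fun n => eLpNorm_congr_ae ?_
    filter_upwards [h2] with x hx
    rw [hx]

theorem ae_restrict_diff_of_ae {p : (𝔼 N) → Prop} (h : ∀ᵐ x ∂volume.restrict Ω, p x) :
    ∀ᵐ x ∂volume.restrict (Ω \ Ω₀), p x :=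
  ae_mono (Measure.restrict_mono sdiff_subset le_rfl) h

theorem MemHD1.congr {u v : (𝔼 N) → ℝ} {Du Dv : (𝔼 N) → 𝔼 N} (hu : MemHD1 Ω Ω₀ u Du)
    (h1 : u =ᵐ[volume.restrict Ω] v) (h2 : Du =ᵐ[volume.restrict Ω] Dv) :
    MemHD1 Ω Ω₀ v Dv := by
  refine ⟨hu.1.congr h1 h2, ?_⟩
  filter_upwards [hu.2, ae_restrict_diff_of_ae h1] with x h3 h4
  rw [← h4, h3]

theorem MemHD1.smul_add {u v : (𝔼 N) → ℝ} {Du Dv : (𝔼 N) → 𝔼 N} (hu : MemHD1 Ω Ω₀ u Du)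
    (hv : MemHD1 Ω Ω₀ v Dv) (c : ℝ) :
    MemHD1 Ω Ω₀ (fun x => c * u x + v x) (fun x => c • Du x + Dv x) := by
  refine ⟨hu.1.smul_add hv.1 c, ?_⟩
  filter_upwards [hu.2, hv.2] with x h1 h2
  simp [h1, h2]

theorem MemHD1.zero : MemHD1 Ω Ω₀ (fun _ : 𝔼 N => (0 : ℝ)) (fun _ => 0) := by
  refine ⟨isTestFunction_zero.memH10.congr (Eventually.of_forall fun _ => rfl)
    (Eventually.of_forall fun x => ?_), Eventually.of_forall fun _ => rfl⟩
  simp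

/-- `H_D^1(Ω₀)`, embedded in `L² × L²` by `u ↦ (u, ∇u)`. -/
def dirichletSubmodule (Ω Ω₀ : Set (𝔼 N)) :
    Submodule ℝ (Lp ℝ 2 (volume.restrict Ω) × Lp (𝔼 N) 2 (volume.restrict Ω)) where
  carrier := {p | MemHD1 Ω Ω₀ p.1 p.2}
  add_mem' := by
    intro p q hp hq
    refine (MemHD1.smul_add hp hq 1).congr ?_ ?_
    · filter_upwards [Lp.coeFn_add p.1 q.1] with x hx
      refine Eq.trans ?_ hx.symm
      simp
    · filter_upwards [Lp.coeFn_add p.2 q.2] with x hx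
      refine Eq.trans ?_ hx.symm
      simp
  zero_mem' := by
    refine MemHD1.zero.congr ?_ ?_
    · exact (Lp.coeFn_zero ℝ 2 _).symm
    · exact (Lp.coeFn_zero (𝔼 N) 2 _).symm
  smul_mem' := by
    intro c p hp
    refine (MemHD1.smul_add hp MemHD1.zero c).congr ?_ ?_
    · filter_upwards [Lp.coeFn_smul c p.1] with x hx
      refine Eq.trans ?_ hx.symm
      simp
    · filter_upwards [Lp.coeFn_smul c p.2] with x hx
      refine Eq.trans ?_ hx.symm
      simp

theorem MemH10.of_tendsto {u : ℕ → (𝔼 N) → ℝ} {Du : ℕ → (𝔼 N) → 𝔼 N} {v : (𝔼 N) → ℝ}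
    {Dv : (𝔼 N) → 𝔼 N} (hu : ∀ n, MemH10 Ω (u n) (Du n)) (hv : MemLp v 2 (volume.restrict Ω))
    (hDv : MemLp Dv 2 (volume.restrict Ω))
    (t1 : Tendsto (fun n => eLpNorm (fun x => u n x - v x) 2 (volume.restrict Ω)) atTop (𝓝 0))
    (t2 : Tendsto (fun n => eLpNorm (fun x => Du n x - Dv x) 2 (volume.restrict Ω))
      atTop (𝓝 0)) : MemH10 Ω v Dv := by
  have hex : ∀ n : ℕ, ∃ φ, IsTestFunction Ω φ ∧
      eLpNorm (fun x => φ x - u n x) 2 (volume.restrict Ω) ≤ (n : ENNReal)⁻¹ ∧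
      eLpNorm (fun x => gradient φ x - Du n x) 2 (volume.restrict Ω) ≤ (n : ENNReal)⁻¹ := by
    intro n
    obtain ⟨φ, hφ, h1, h2⟩ := (hu n).approx
    have hn : (0 : ENNReal) < (n : ENNReal)⁻¹ := by simp
    obtain ⟨k, hk1, hk2⟩ := ((h1.eventually_le_const hn).and (h2.eventually_le_const hn)).exists
    exact ⟨φ k, hφ k, hk1, hk2⟩
  choose φ hφ h1 h2 using hex
  refine ⟨hv, hDv, φ, hφ, ?_, ?_⟩
  · refine tendsto_of_tendsto_of_tendsto_of_le_of_le tendsto_const_nhds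
      (by simpa using ENNReal.tendsto_inv_nat_nhds_zero.add t1) (fun _ => zero_le) fun n => ?_
    have e : (fun x => φ n x - v x) = (fun x => φ n x - u n x) + fun x => u n x - v x := by
      funext x; simp
    beta_reduce
    rw [e]
    exact (eLpNorm_add_le (((hφ n).memLp _).1.sub (hu n).memLp.1) ((hu n).memLp.1.sub hv.1)
      (by norm_num)).trans (add_le_add (h1 n) le_rfl)
  · refine tendsto_of_tendsto_of_tendsto_of_le_of_le tendsto_const_nhds
      (by simpa using ENNReal.tendsto_inv_nat_nhds_zero.add t2) (fun _ => zero_le) fun n => ?_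
    have e : (fun x => gradient (φ n) x - Dv x)
        = (fun x => gradient (φ n) x - Du n x) + fun x => Du n x - Dv x := by
      funext x; simp
    beta_reduce
    rw [e]
    exact (eLpNorm_add_le (((hφ n).gradient_memLp _).1.sub (hu n).grad_memLp.1)
      ((hu n).grad_memLp.1.sub hDv.1) (by norm_num)).trans (add_le_add (h2 n) le_rfl)

theorem isClosed_dirichletSubmodule :
    IsClosed (dirichletSubmodule Ω Ω₀ : Set (Lp ℝ 2 (volume.restrict Ω) ×
      Lp (𝔼 N) 2 (volume.restrict Ω))) := by
  refine IsSeqClosed.isClosed ?_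
  intro p q hp hpq
  have hp' : ∀ n, MemHD1 Ω Ω₀ (p n).1 (p n).2 := hp
  have t1 := (Lp.tendsto_Lp_iff_tendsto_eLpNorm' _ _).1 ((continuous_fst.tendsto q).comp hpq)
  have t2 := (Lp.tendsto_Lp_iff_tendsto_eLpNorm' _ _).1 ((continuous_snd.tendsto q).comp hpq)
  have hqD : MemHD1 Ω Ω₀ q.1 q.2 := by
    refine ⟨MemH10.of_tendsto (fun n => (hp' n).1) (Lp.memLp _) (Lp.memLp _) t1 t2, ?_⟩
    obtain ⟨ns, -, hns⟩ := (tendstoInMeasure_of_tendsto_eLpNorm (p := 2) (by norm_num)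
      (fun n => (Lp.memLp (p n).1).1) (Lp.memLp q.1).1 t1).exists_seq_tendsto_ae
    have hall : ∀ᵐ x ∂volume.restrict (Ω \ Ω₀), ∀ n, (p n).1 x = 0 :=
      ae_all_iff.2 fun n => (hp' n).2
    filter_upwards [hall, ae_restrict_diff_of_ae hns] with x hx hlim
    refine tendsto_nhds_unique hlim ?_
    simp [hx]
  exact hqD

/-- The infimum defining `firstEigenvalue` is attained, at the minimum of the Rayleigh quotient. -/
theorem exists_firstEigenfunction (hΩb : Bornology.IsBounded Ω) (hΩ₀ : IsOpen Ω₀)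
    (hsub : Ω₀ ⊆ Ω) (hne : Ω₀.Nonempty) :
    0 ≤ firstEigenvalue Ω Ω₀ ∧ ∃ ψ Dψ, MemHD1 Ω Ω₀ ψ Dψ ∧ (¬ ψ =ᵐ[volume.restrict Ω] 0) ∧
      ∫ x in Ω, ‖Dψ x‖ ^ 2 = firstEigenvalue Ω Ω₀ * ∫ x in Ω, ψ x ^ 2 := by
  set μ := volume.restrict Ω with hμ
  obtain ⟨x0, hx0⟩ := hne
  obtain ⟨φ, hφ1, hφ2, hφ3, -, hφ5⟩ :=
    exists_contDiff_tsupport_subset (n := ⊤) (hΩ₀.mem_nhds hx0)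
  have hφ : IsTestFunction Ω φ := ⟨hφ3, hφ2, hφ1.trans hsub⟩
  have hφD : MemHD1 Ω Ω₀ φ (gradient φ) := by
    refine ⟨hφ.memH10, ae_restrict_of_ae_restrict_of_subset (t := Ω₀ᶜ) (fun x hx => hx.2)
      ((ae_restrict_iff' hΩ₀.measurableSet.compl).2 (Eventually.of_forall fun x hx => ?_))⟩
    exact image_eq_zero_of_notMem_tsupport fun h => hx (hφ1 h)
  have hφ0 : hφD.1.memLp.toLp φ ≠ 0 := by
    -- The bump function is continuous and equal to `1` at a point of the open set `Ω₀`.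
    intro h
    have h1 : φ =ᵐ[volume.restrict Ω] 0 :=
      hφD.1.memLp.coeFn_toLp.symm.trans ((Lp.eq_zero_iff_ae_eq_zero).1 h)
    have h2 : φ =ᵐ[volume.restrict Ω₀] 0 :=
      ae_mono (Measure.restrict_mono hsub le_rfl) h1
    have h3 := Measure.eqOn_open_of_ae_eq h2 hΩ₀ hφ3.continuous.continuousOn
      continuous_zero.continuousOn
    have h4 := h3 hx0
    simp [hφ5] at h4
  obtain ⟨l, hl0, ⟨p, hpV, hp0, hpe⟩, hray⟩ := (dirichletSubmodule Ω Ω₀).exists_minimizer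
    isClosed_dirichletSubmodule
    ⟨(hφD.1.memLp.toLp φ, hφD.1.grad_memLp.toLp _),
      hφD.congr hφD.1.memLp.coeFn_toLp.symm hφD.1.grad_memLp.coeFn_toLp.symm, hφ0⟩
    (fun v M hv hM => exists_cauchySeq_subseq hΩb (fun n => (v n).1) (fun n => (v n).2)
      (fun n => (hv n).1) (M := M) (fun n => (norm_fst_le _).trans (hM n))
      (fun n => (norm_snd_le _).trans (hM n)))
  have hpD : MemHD1 Ω Ω₀ p.1 p.2 := hpV
  have hp0' : ¬ (p.1 : (𝔼 N) → ℝ) =ᵐ[μ] 0 := fun h => hp0 ((Lp.eq_zero_iff_ae_eq_zero).2 h)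
  have in1 : ∀ {w : (𝔼 N) → ℝ} (f : Lp ℝ 2 μ) (hw : MemLp w 2 μ),
      inner ℝ f (hw.toLp w) = ∫ x in Ω, f x * w x := by
    intro w f hw
    rw [L2.inner_def]
    refine integral_congr_ae ?_
    filter_upwards [hw.coeFn_toLp] with z hz
    rw [hz]
    simp [mul_comm]
  have in2 : ∀ {w : (𝔼 N) → 𝔼 N} (f : Lp (𝔼 N) 2 μ) (hw : MemLp w 2 μ),
      inner ℝ f (hw.toLp w) = ∫ x in Ω, inner ℝ (f x) (w x) := by
    intro w f hw
    rw [L2.inner_def]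
    refine integral_congr_ae ?_
    filter_upwards [hw.coeFn_toLp] with z hz
    rw [hz]
  have heig : IsDirichletEigenvalue Ω Ω₀ l := by
    refine ⟨p.1, p.2, hpD, hp0', fun w Dw hw => ?_⟩
    have h1 := hpe (hw.1.memLp.toLp w, hw.1.grad_memLp.toLp Dw)
      (hw.congr hw.1.memLp.coeFn_toLp.symm hw.1.grad_memLp.coeFn_toLp.symm)
    simp only at h1
    rwa [in1, in2] at h1
  have hleast : IsLeast {μ : ℝ | IsDirichletEigenvalue Ω Ω₀ μ} l := by
    refine ⟨heig, ?_⟩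
    rintro ν ⟨ψ, Dψ, hψ, hψ0, hψe⟩
    have h1 := hray (hψ.1.memLp.toLp ψ, hψ.1.grad_memLp.toLp Dψ)
      (hψ.congr hψ.1.memLp.coeFn_toLp.symm hψ.1.grad_memLp.coeFn_toLp.symm)
    simp only at h1
    have e1 : ‖hψ.1.memLp.toLp ψ‖ ^ 2 = ∫ x in Ω, ψ x * ψ x := by
      rw [← real_inner_self_eq_norm_sq, in1]
      refine integral_congr_ae ?_
      filter_upwards [hψ.1.memLp.coeFn_toLp] with z hz
      rw [hz]
    have e2 : ‖hψ.1.grad_memLp.toLp Dψ‖ ^ 2 = ∫ x in Ω, inner ℝ (Dψ x) (Dψ x) := by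
      rw [← real_inner_self_eq_norm_sq, in2]
      refine integral_congr_ae ?_
      filter_upwards [hψ.1.grad_memLp.coeFn_toLp] with z hz
      rw [hz]
    rw [e2, hψe ψ Dψ hψ, ← e1] at h1
    refine le_of_mul_le_mul_right h1 ?_
    have : hψ.1.memLp.toLp ψ ≠ 0 := by
      intro h
      exact hψ0 (hψ.1.memLp.coeFn_toLp.symm.trans ((Lp.eq_zero_iff_ae_eq_zero).1 h))
    have := norm_pos_iff.2 this
    positivity
  have hfirst : firstEigenvalue Ω Ω₀ = l := hleast.csInf_eq
  refine ⟨hfirst ▸ hl0, p.1, p.2, hpD, hp0', ?_⟩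
  have h1 := hpe p hpV
  rw [L2.inner_def, L2.inner_def] at h1
  rw [hfirst]
  simpa [real_inner_self_eq_norm_sq, pow_two] using h1

end Eigenfunction

/-! ### Picone's inequality and its case of equality -/

section Picone

/-- A smooth function `ρ ≥ c₀ / 2` on the line with bounded derivative that is the identity on
`[c₀, ∞)`. Its reciprocal replaces `1 / c` where the sign of `c` is not under control. -/
theorem exists_smooth_positive_identity {c₀ : ℝ} (hc₀ : 0 < c₀) :
    ∃ (ρ ρ' : ℝ → ℝ) (M : ℝ), ContDiff ℝ ∞ ρ ∧ Continuous ρ' ∧ (∀ c, HasDerivAt ρ (ρ' c) c) ∧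
      (∀ c, c₀ ≤ c → ρ c = c) ∧ (∀ c, c₀ ≤ c → ρ' c = 1) ∧ (∀ c, c₀ / 2 ≤ ρ c) ∧
      ∀ c, |ρ' c| ≤ M := by
  set ρ : ℝ → ℝ := fun c => c₀ + (c - c₀) * Real.smoothTransition (3 * c / c₀ - 3 / 2) with hρ
  have hsm : ContDiff ℝ ∞ ρ := by
    refine contDiff_const.add ((contDiff_id.sub contDiff_const).mul ?_)
    exact Real.smoothTransition.contDiff.comp
      (((contDiff_const.mul contDiff_id).div_const c₀).sub contDiff_const)
  have hone : ∀ c, 5 / 6 * c₀ ≤ c → ρ c = c := by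
    intro c hc
    have h1 : 1 ≤ 3 * c / c₀ - 3 / 2 := by
      have : 5 / 2 ≤ 3 * c / c₀ := by rw [le_div_iff₀ hc₀]; linarith
      linarith
    simp [hρ, Real.smoothTransition.one_of_one_le h1]
  have hzero : ∀ c, c ≤ c₀ / 2 → ρ c = c₀ := by
    intro c hc
    have h1 : 3 * c / c₀ - 3 / 2 ≤ 0 := by
      have : 3 * c / c₀ ≤ 3 / 2 := by rw [div_le_iff₀ hc₀]; linarith
      linarith
    simp [hρ, Real.smoothTransition.zero_of_nonpos h1]
  have hd1 : ∀ c, c₀ ≤ c → deriv ρ c = 1 := by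
    intro c hc
    have : ρ =ᶠ[𝓝 c] id := by
      filter_upwards [lt_mem_nhds (show 5 / 6 * c₀ < c by linarith)] with t ht
      exact hone t ht.le
    rw [this.deriv_eq, deriv_id]
  have hd0 : ∀ c, c < c₀ / 2 → deriv ρ c = 0 := by
    intro c hc
    have : ρ =ᶠ[𝓝 c] fun _ => c₀ := by
      filter_upwards [gt_mem_nhds hc] with t ht
      exact hzero t ht.le
    rw [this.deriv_eq, deriv_const]
  have hdc : Continuous (deriv ρ) := hsm.continuous_deriv (by simp)
  obtain ⟨M, hM⟩ := (isCompact_Icc (a := c₀ / 2) (b := c₀)).exists_bound_of_continuousOn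
    hdc.continuousOn
  refine ⟨ρ, deriv ρ, max M 1, hsm, hdc,
    fun c => (hsm.differentiable (by simp) c).hasDerivAt, fun c hc => hone c (by linarith), hd1,
    fun c => ?_, fun c => ?_⟩
  · rcases le_total c (c₀ / 2) with h | h
    · rw [hzero c h]; linarith
    · have h1 := Real.smoothTransition.le_one (3 * c / c₀ - 3 / 2)
      have h2 := Real.smoothTransition.nonneg (3 * c / c₀ - 3 / 2)
      simp only [hρ]
      rcases le_total c c₀ with h3 | h3
      · nlinarith
      · nlinarith
  · rcases lt_or_ge c (c₀ / 2) with h | h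
    · rw [hd0 c h]; simp
    · rcases le_total c c₀ with h3 | h3
      · exact (hM c ⟨h, h3⟩).trans (le_max_left _ _)
      · rw [hd1 c h3]; simp

/-- A smooth function of `(a, b)`, with bounded first derivatives, that vanishes where `a` or `b`
does, is bounded by a multiple of `|a|`, and is close to `b` where `a = b`. With `a` a test
function it truncates `b` to a compact set without enlarging its support. -/
def softTrunc (δ a b : ℝ) : ℝ := 2 * a * b ^ 2 / (a ^ 2 + b ^ 2 + δ)

/-- The derivative of `softTrunc` in its first variable. -/
def softTruncA (δ a b : ℝ) : ℝ := 2 * b ^ 2 * (b ^ 2 + δ - a ^ 2) / (a ^ 2 + b ^ 2 + δ) ^ 2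

/-- The derivative of `softTrunc` in its second variable. -/
def softTruncB (δ a b : ℝ) : ℝ := 4 * a * b * (a ^ 2 + δ) / (a ^ 2 + b ^ 2 + δ) ^ 2

variable {δ : ℝ}

theorem abs_softTrunc_le (hδ : 0 < δ) (a b : ℝ) : |softTrunc δ a b| ≤ 2 * |a| := by
  have h : 0 < a ^ 2 + b ^ 2 + δ := by positivity
  rw [softTrunc, abs_div, abs_of_pos h, div_le_iff₀ h, abs_mul, abs_mul, abs_two,
    abs_of_nonneg (sq_nonneg b)]
  gcongr
  nlinarith [sq_nonneg a]

theorem abs_softTruncA_le (hδ : 0 < δ) (a b : ℝ) : |softTruncA δ a b| ≤ 2 := by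
  have h : 0 < a ^ 2 + b ^ 2 + δ := by positivity
  rw [softTruncA, abs_div, abs_of_pos (pow_pos h 2), div_le_iff₀ (pow_pos h 2), abs_mul, abs_mul,
    abs_two, abs_of_nonneg (sq_nonneg b), mul_assoc]
  gcongr
  rw [pow_two (a ^ 2 + b ^ 2 + δ)]
  gcongr
  · nlinarith [sq_nonneg a]
  · rw [abs_le]
    constructor <;> nlinarith [sq_nonneg a, sq_nonneg b]

theorem abs_softTruncB_le (hδ : 0 < δ) (a b : ℝ) : |softTruncB δ a b| ≤ 2 := by
  have h : 0 < a ^ 2 + b ^ 2 + δ := by positivity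
  have h1 : |2 * (a * b)| ≤ a ^ 2 + b ^ 2 + δ := by
    rw [abs_le]
    constructor <;> nlinarith [sq_nonneg (a + b), sq_nonneg (a - b)]
  have h2 : 0 ≤ a ^ 2 + δ := by positivity
  rw [softTruncB, abs_div, abs_of_pos (pow_pos h 2), div_le_iff₀ (pow_pos h 2),
    show 4 * a * b * (a ^ 2 + δ) = 2 * ((2 * (a * b)) * (a ^ 2 + δ)) by ring, abs_mul, abs_two,
    abs_mul, abs_of_nonneg h2]
  gcongr
  rw [pow_two (a ^ 2 + b ^ 2 + δ)]
  gcongr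
  nlinarith [sq_nonneg b]

variable {N : ℕ} {Ω : Set (𝔼 N)}

theorem tendsto_softTrunc {a ε : ℕ → ℝ} {b : ℝ} (ha : Tendsto a atTop (𝓝 b))
    (hε : Tendsto ε atTop (𝓝 0)) : Tendsto (fun n => softTrunc (ε n) (a n) b) atTop (𝓝 b) := by
  by_cases h0 : b = 0
  · simp [softTrunc, h0]
  · have hne : (b ^ 2 + b ^ 2 + 0) ≠ 0 := by positivity
    have := ((((tendsto_const_nhds (x := (2 : ℝ))).mul ha).mul
      (tendsto_const_nhds (x := b ^ 2)))).div
      (((((ha.pow 2).add (tendsto_const_nhds (x := b ^ 2))).add hε))) hne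
    have e : 2 * b * b ^ 2 / (b ^ 2 + b ^ 2 + 0) = b := by
      field_simp; ring
    rw [e] at this
    exact this

theorem tendsto_softTruncA {a ε : ℕ → ℝ} {b : ℝ} (ha : Tendsto a atTop (𝓝 b))
    (hε : Tendsto ε atTop (𝓝 0)) : Tendsto (fun n => softTruncA (ε n) (a n) b) atTop (𝓝 0) := by
  by_cases h0 : b = 0
  · simp [softTruncA, h0]
  · have hne : (b ^ 2 + b ^ 2 + 0) ^ 2 ≠ 0 := by positivity
    have := (((tendsto_const_nhds (x := 2 * b ^ 2)).mul
      (((tendsto_const_nhds (x := b ^ 2)).add hε).sub (ha.pow 2)))).div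
      (((((ha.pow 2).add (tendsto_const_nhds (x := b ^ 2))).add hε)).pow 2) hne
    have e : 2 * b ^ 2 * (b ^ 2 + 0 - b ^ 2) / (b ^ 2 + b ^ 2 + 0) ^ 2 = 0 := by simp
    rw [e] at this
    exact this

theorem tendsto_softTruncB {a ε : ℕ → ℝ} {b : ℝ} (ha : Tendsto a atTop (𝓝 b))
    (hε : Tendsto ε atTop (𝓝 0)) : Tendsto (fun n => softTruncB (ε n) (a n) b) atTop
      (𝓝 (if b = 0 then (0 : ℝ) else 1)) := by
  by_cases h0 : b = 0
  · simp [softTruncB, h0]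
  · have hne : (b ^ 2 + b ^ 2 + 0) ^ 2 ≠ 0 := by positivity
    have := ((((tendsto_const_nhds (x := (4 : ℝ))).mul ha).mul
      (tendsto_const_nhds (x := b))).mul ((ha.pow 2).add hε)).div
      (((((ha.pow 2).add (tendsto_const_nhds (x := b ^ 2))).add hε)).pow 2) hne
    have e : 4 * b * b * (b ^ 2 + 0) / (b ^ 2 + b ^ 2 + 0) ^ 2 = 1 := by
      field_simp; ring
    rw [e] at this
    rw [if_neg h0]
    exact this

theorem contDiff_softTrunc (hδ : 0 < δ) : ContDiff ℝ ∞ fun p : ℝ × ℝ => softTrunc δ p.1 p.2 :=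
  ((contDiff_const.mul contDiff_fst).mul (contDiff_snd.pow 2)).div
    (((contDiff_fst.pow 2).add (contDiff_snd.pow 2)).add contDiff_const)
    (fun p => by positivity)

theorem continuous_softTruncA (hδ : 0 < δ) :
    Continuous fun p : ℝ × ℝ => softTruncA δ p.1 p.2 := by
  refine Continuous.div (by fun_prop) (by fun_prop) fun p => ?_
  positivity

theorem continuous_softTruncB (hδ : 0 < δ) :
    Continuous fun p : ℝ × ℝ => softTruncB δ p.1 p.2 := by
  refine Continuous.div (by fun_prop) (by fun_prop) fun p => ?_
  positivity

theorem HasGradientAt.softTrunc (hδ : 0 < δ) {α β : (𝔼 N) → ℝ} {α' β' x : 𝔼 N}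
    (hα : HasGradientAt α α' x) (hβ : HasGradientAt β β' x) :
    HasGradientAt (fun y => softTrunc δ (α y) (β y))
      (softTruncA δ (α x) (β x) • α' + softTruncB δ (α x) (β x) • β') x := by
  have h : α x ^ 2 + β x ^ 2 + δ ≠ 0 := by positivity
  rw [hasGradientAt_iff_hasFDerivAt] at hα hβ ⊢
  have h1 := ((hα.const_mul 2).mul (hβ.pow 2)).mul
    ((hasDerivAt_inv h).comp_hasFDerivAt x (((hα.pow 2).add (hβ.pow 2)).add_const δ))
  have e : (fun y => _root_.softTrunc δ (α y) (β y))
      = fun y => 2 * α y * β y ^ 2 * (α y ^ 2 + β y ^ 2 + δ)⁻¹ := by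
    funext y
    rw [_root_.softTrunc, div_eq_mul_inv]
  rw [e]
  refine HasFDerivAt.congr_fderiv (f' := _) h1 ?_
  ext z
  simp [softTruncA, softTruncB]
  field_simp
  ring

theorem MemHD1.ae_eq_zero {Ω₀ : Set (𝔼 N)} (hΩ : MeasurableSet Ω) (hΩ₀ : MeasurableSet Ω₀)
    {ψ : (𝔼 N) → ℝ} {Dψ : (𝔼 N) → 𝔼 N} (hψ : MemHD1 Ω Ω₀ ψ Dψ) :
    ∀ᵐ x ∂volume.restrict Ω, x ∉ Ω₀ → ψ x = 0 := by
  have h := (ae_restrict_iff' (hΩ.diff hΩ₀)).1 hψ.2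
  rw [ae_restrict_iff' hΩ]
  filter_upwards [h] with x hx h1 h2
  exact hx ⟨h1, h2⟩

theorem eq_zero_of_mem_zeroInterior {h : (𝔼 N) → ℝ} {x : 𝔼 N} (hx : x ∈ zeroInterior Ω h) :
    h x = 0 := (interior_subset hx).2

end Picone

section PiconeIdentity

variable {N : ℕ} {Ω : Set (𝔼 N)} {h u ψ : (𝔼 N) → ℝ} {g f : ℝ → ℝ} {Du Dψ : (𝔼 N) → 𝔼 N}
  {l : ℝ}

/-- Picone's inequality for a positive solution `u` and a truncation `v` of `ψ ∈ H_D^1(Ω₀)`: the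
equation is tested with `v² / (u + ε)`, which vanishes where `h` does not. -/
theorem IsWeakSolution.picone_truncated (hΩ : IsOpen Ω) (hΩb : Bornology.IsBounded Ω)
    (hu : IsWeakSolution Ω h g f u Du) (hpos : ∀ᵐ x ∂volume.restrict Ω, 0 < u x)
    (hl : 0 ≤ l) (hg : ∀ t, 0 < t → l * t ≤ g t) (hψ : MemHD1 Ω (zeroInterior Ω h) ψ Dψ)
    {φ : (𝔼 N) → ℝ} (hφ : IsTestFunction Ω φ) {δ ε : ℝ} (hδ : 0 < δ) (hε : 0 < ε) :
    ∫⁻ x in Ω, (‖(softTruncA δ (φ x) (ψ x) • gradient φ x + softTruncB δ (φ x) (ψ x) • Dψ x)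
        - (softTrunc δ (φ x) (ψ x) / (u x + ε)) • Du x‖ₑ ^ 2
        + ENNReal.ofReal (l * (softTrunc δ (φ x) (ψ x) ^ 2 * (u x / (u x + ε)))))
      ≤ ∫⁻ x in Ω,
        ‖softTruncA δ (φ x) (ψ x) • gradient φ x + softTruncB δ (φ x) (ψ x) • Dψ x‖ₑ ^ 2 := by
  obtain ⟨ρ, ρ', Mρ, hρ, hρ'c, hρ', hρ1, hρ'1, hρlow, hρM⟩ := exists_smooth_positive_identity hε
  have hρpos : ∀ c, 0 < ρ c := fun c => lt_of_lt_of_le (by positivity) (hρlow c)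
  obtain ⟨M1, hM1⟩ := hφ.compact.exists_bound_of_continuous hφ.smooth.continuous
  obtain ⟨M2, hM2⟩ := hφ.hasCompactSupport_gradient.exists_bound_of_continuous
    hφ.smooth.continuous_gradient
  have hM10 : 0 ≤ M1 := (norm_nonneg _).trans (hM1 0)
  have hM20 : 0 ≤ M2 := (norm_nonneg _).trans (hM2 0)
  have hMρ0 : 0 ≤ Mρ := (abs_nonneg _).trans (hρM 0)
  have hφc := hφ.smooth.continuous
  have hgc := hφ.smooth.continuous_gradient
  set T : (𝔼 N) → ℝ → ℝ := fun x b => softTrunc δ (φ x) b with hT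
  have hTle : ∀ x b, |T x b| ≤ 2 * M1 := fun x b =>
    (abs_softTrunc_le hδ _ _).trans (by have := hM1 x; rw [Real.norm_eq_abs] at this; linarith)
  have hinv : ∀ c, |(ρ (c + ε))⁻¹| ≤ 2 / ε := by
    intro c
    rw [abs_of_pos (inv_pos.2 (hρpos _)), inv_le_comm₀ (hρpos _) (by positivity), inv_div]
    exact hρlow _
  have hTc : Continuous fun p : (𝔼 N) × ℝ × ℝ => T p.1 p.2.1 :=
    (contDiff_softTrunc hδ).continuous.comp
      ((hφc.comp continuous_fst).prodMk (continuous_fst.comp continuous_snd))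
  have hTAc : Continuous fun p : (𝔼 N) × ℝ × ℝ => softTruncA δ (φ p.1) p.2.1 :=
    (continuous_softTruncA hδ).comp
      ((hφc.comp continuous_fst).prodMk (continuous_fst.comp continuous_snd))
  have hTBc : Continuous fun p : (𝔼 N) × ℝ × ℝ => softTruncB δ (φ p.1) p.2.1 :=
    (continuous_softTruncB hδ).comp
      ((hφc.comp continuous_fst).prodMk (continuous_fst.comp continuous_snd))
  have hρc : Continuous fun p : (𝔼 N) × ℝ × ℝ => (ρ (p.2.2 + ε))⁻¹ :=
    (hρ.continuous.comp (by fun_prop)).inv₀ fun p => (hρpos _).ne'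
  have hρ'cc : Continuous fun p : (𝔼 N) × ℝ × ℝ => ρ' (p.2.2 + ε) := hρ'c.comp (by fun_prop)
  set Bd : ℝ := 2 * (2 * M1) * 2 * (2 / ε) with hBd
  have hBd0 : 0 ≤ Bd := by positivity
  -- The test function `v² / (u + ε)`; as `S` has to be smooth for all real values of its arguments,
  -- `1 / (c + ε)` is replaced by `1 / ρ (c + ε)`, which agrees with it for `c ≥ 0`.
  have hadm := IsAdmissible.comp hΩb hψ.1 hu.memH10
    (S := fun x b c => T x b ^ 2 * (ρ (c + ε))⁻¹)
    (Sx := fun x b c => (2 * T x b * softTruncA δ (φ x) b * (ρ (c + ε))⁻¹) • gradient φ x)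
    (Sb := fun x b c => 2 * T x b * softTruncB δ (φ x) b * (ρ (c + ε))⁻¹)
    (Sc := fun x b c => -(T x b ^ 2 * ρ' (c + ε) * ((ρ (c + ε))⁻¹ * (ρ (c + ε))⁻¹)))
    (M := (2 * M1) ^ 2 * (2 / ε) + Bd * M2 + Bd + (2 * M1) ^ 2 * Mρ * (2 / ε * (2 / ε)))
    hφ.compact hφ.support_subset
    (by
      refine ContDiff.mul (ContDiff.pow ?_ 2) (ContDiff.inv ?_ fun p => (hρpos _).ne')
      · exact (contDiff_softTrunc hδ).comp
          ((hφ.smooth.comp contDiff_fst).prodMk (contDiff_fst.comp contDiff_snd))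
      · exact hρ.comp ((contDiff_snd.comp contDiff_snd).add contDiff_const))
    (by
      intro β γ β' γ' x hβ hγ
      have h1 := (HasGradientAt.softTrunc hδ (hφ.hasGradientAt x) hβ).hasFDerivAt
      have h2 := (hρ' (γ x + ε)).comp_hasFDerivAt x (hγ.hasFDerivAt.add_const ε)
      have h3 := (h1.pow 2).mul ((hasDerivAt_inv (hρpos (γ x + ε)).ne').comp_hasFDerivAt x h2)
      rw [hasGradientAt_iff_hasFDerivAt]
      refine HasFDerivAt.congr_fderiv (f' := _) h3 ?_
      ext z
      simp [hT]
      have := (hρpos (γ x + ε)).ne'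
      field_simp
      ring)
    ((((continuous_const.mul hTc).mul hTAc).mul hρc).smul (hgc.comp continuous_fst))
    (((continuous_const.mul hTc).mul hTBc).mul hρc)
    ((((hTc.pow 2).mul hρ'cc).mul (hρc.mul hρc)).neg)
    (by
      intro x b c
      have h1 : |T x b ^ 2 * (ρ (c + ε))⁻¹| ≤ (2 * M1) ^ 2 * (2 / ε) := by
        rw [abs_mul, abs_pow]
        gcongr
        · exact hTle x b
        · exact hinv c
      refine h1.trans ?_
      have : 0 ≤ (2 * M1) ^ 2 * Mρ * (2 / ε * (2 / ε)) := by positivity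
      nlinarith [mul_nonneg hBd0 hM20])
    (by
      intro x b c
      have h1 : ‖(2 * T x b * softTruncA δ (φ x) b * (ρ (c + ε))⁻¹) • gradient φ x‖ ≤ Bd * M2 := by
        rw [norm_smul, Real.norm_eq_abs, abs_mul, abs_mul, abs_mul, abs_two, hBd]
        gcongr
        · exact hTle x b
        · exact abs_softTruncA_le hδ _ _
        · exact hinv c
        · exact hM2 x
      refine h1.trans ?_
      have : 0 ≤ (2 * M1) ^ 2 * Mρ * (2 / ε * (2 / ε)) := by positivity
      have : 0 ≤ (2 * M1) ^ 2 * (2 / ε) := by positivity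
      linarith)
    (by
      intro x b c
      have h1 : |2 * T x b * softTruncB δ (φ x) b * (ρ (c + ε))⁻¹| ≤ Bd := by
        rw [abs_mul, abs_mul, abs_mul, abs_two, hBd]
        gcongr
        · exact hTle x b
        · exact abs_softTruncB_le hδ _ _
        · exact hinv c
      refine h1.trans ?_
      have : 0 ≤ (2 * M1) ^ 2 * Mρ * (2 / ε * (2 / ε)) := by positivity
      have : 0 ≤ (2 * M1) ^ 2 * (2 / ε) := by positivity
      nlinarith [mul_nonneg hBd0 hM20])
    (by
      intro x b c
      have h1 : |-(T x b ^ 2 * ρ' (c + ε) * ((ρ (c + ε))⁻¹ * (ρ (c + ε))⁻¹))|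
          ≤ (2 * M1) ^ 2 * Mρ * (2 / ε * (2 / ε)) := by
        rw [abs_neg, abs_mul, abs_mul, abs_mul, abs_pow]
        gcongr
        · exact hTle x b
        · exact hρM _
        · exact hinv c
        · exact hinv c
      refine h1.trans ?_
      have : 0 ≤ (2 * M1) ^ 2 * (2 / ε) := by positivity
      nlinarith [mul_nonneg hBd0 hM20])
    (by
      intro x hx b c
      simp [hT, softTrunc, image_eq_zero_of_notMem_tsupport hx])
  obtain ⟨hint, heq⟩ := hu.integral_inner_eq hadm
  set μ := volume.restrict Ω with hμ
  set Dv : (𝔼 N) → 𝔼 N := fun x =>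
    softTruncA δ (φ x) (ψ x) • gradient φ x + softTruncB δ (φ x) (ψ x) • Dψ x with hDv
  set v : (𝔼 N) → ℝ := fun x => softTrunc δ (φ x) (ψ x) with hv
  set w : (𝔼 N) → ℝ := fun x => T x (ψ x) ^ 2 * (ρ (u x + ε))⁻¹ with hw
  set Dw : (𝔼 N) → 𝔼 N := fun x =>
    (2 * T x (ψ x) * softTruncA δ (φ x) (ψ x) * (ρ (u x + ε))⁻¹) • gradient φ x
      + (2 * T x (ψ x) * softTruncB δ (φ x) (ψ x) * (ρ (u x + ε))⁻¹) • Dψ x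
      + (-(T x (ψ x) ^ 2 * ρ' (u x + ε) * ((ρ (u x + ε))⁻¹ * (ρ (u x + ε))⁻¹))) • Du x with hDw
  have hpair : AEStronglyMeasurable (fun x => (φ x, ψ x)) μ :=
    hφc.aestronglyMeasurable.prodMk hψ.1.memLp.1
  have hDvmem : MemLp Dv 2 μ := by
    have m1 : MemLp (fun x => softTruncA δ (φ x) (ψ x) • gradient φ x) 2 μ := by
      refine ((hφ.gradient_memLp μ).const_smul (2 : ℝ)).mono
        (((continuous_softTruncA hδ).comp_aestronglyMeasurable hpair).smul
          hgc.aestronglyMeasurable) (Eventually.of_forall fun x => ?_)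
      simp only [Pi.smul_apply, norm_smul]
      gcongr
      simpa using abs_softTruncA_le hδ _ _
    have m2 : MemLp (fun x => softTruncB δ (φ x) (ψ x) • Dψ x) 2 μ := by
      refine (hψ.1.grad_memLp.const_smul (2 : ℝ)).mono
        (((continuous_softTruncB hδ).comp_aestronglyMeasurable hpair).smul
          hψ.1.grad_memLp.1) (Eventually.of_forall fun x => ?_)
      simp only [Pi.smul_apply, norm_smul]
      gcongr
      simpa using abs_softTruncB_le hδ _ _
    exact m1.add m2
  -- Picone's identity.
  have hpt : ∀ᵐ x ∂μ, ‖Dv x - (v x / (u x + ε)) • Du x‖ ^ 2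
      = ‖Dv x‖ ^ 2 - inner ℝ (Du x) (Dw x) := by
    filter_upwards [hpos] with x hx
    have e1 : ρ (u x + ε) = u x + ε := hρ1 _ (by linarith)
    have e2 : ρ' (u x + ε) = 1 := hρ'1 _ (by linarith)
    have e3 : Dw x = (2 * v x / (u x + ε)) • Dv x - (v x / (u x + ε)) ^ 2 • Du x := by
      simp only [hDw, hDv, hv, hT, e1, e2, smul_add, smul_smul, sub_eq_add_neg, ← neg_smul]
      congr 1
      · congr 1 <;> congr 1 <;> ring
      · congr 1; ring
    rw [e3, norm_sub_sq_real, inner_sub_right, real_inner_smul_right, real_inner_smul_right,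
      real_inner_smul_right, norm_smul, real_inner_self_eq_norm_sq, mul_pow, Real.norm_eq_abs,
      sq_abs, real_inner_comm]
    ring
  have hC : Integrable (fun x => ‖Dv x‖ ^ 2) μ := hDvmem.integrable_norm_pow (by norm_num)
  have hI : Integrable (fun x => inner ℝ (Du x) (Dw x)) μ :=
    hu.memH10.grad_memLp.integrable_inner_two hadm.grad_memLp
  have hA : Integrable (fun x => ‖Dv x - (v x / (u x + ε)) • Du x‖ ^ 2) μ :=
    (hC.sub hI).congr (by filter_upwards [hpt] with x hx using hx.symm)
  -- Outside `Ω₀` both sides vanish with `ψ`; inside, `h = 0`.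
  have hBle : ∀ᵐ x ∂μ, l * (v x ^ 2 * (u x / (u x + ε))) ≤ (g (u x) - h x * f (u x)) * w x := by
    filter_upwards [hpos, hψ.ae_eq_zero hΩ.measurableSet isOpen_interior.measurableSet]
      with x hx hx2
    have e1 : ρ (u x + ε) = u x + ε := hρ1 _ (by linarith)
    by_cases h0 : x ∈ zeroInterior Ω h
    · have h1 := hg _ hx
      have h2 : l * (v x ^ 2 * (u x / (u x + ε))) = (l * u x) * (v x ^ 2 * (u x + ε)⁻¹) := by
        rw [div_eq_mul_inv]; ring
      simp only [hw, e1, eq_zero_of_mem_zeroInterior h0, zero_mul, sub_zero, h2]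
      gcongr
    · simp [hw, hv, hT, softTrunc, hx2 h0]
  have hB0 : ∀ᵐ x ∂μ, 0 ≤ (g (u x) - h x * f (u x)) * w x := by
    filter_upwards [hBle, hpos] with x hx hx2
    exact le_trans (by positivity) hx
  have hAB : (∫ x, ‖Dv x - (v x / (u x + ε)) • Du x‖ ^ 2 ∂μ)
      + ∫ x, (g (u x) - h x * f (u x)) * w x ∂μ = ∫ x, ‖Dv x‖ ^ 2 ∂μ := by
    rw [← heq, integral_congr_ae hpt, integral_sub hC hI]
    ring
  have e1 : ∀ x, ‖Dv x - (v x / (u x + ε)) • Du x‖ₑ ^ 2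
      = ENNReal.ofReal (‖Dv x - (v x / (u x + ε)) • Du x‖ ^ 2) := fun x => by
    rw [ENNReal.ofReal_pow (norm_nonneg _), ofReal_norm]
  calc ∫⁻ x in Ω, (‖Dv x - (v x / (u x + ε)) • Du x‖ₑ ^ 2
        + ENNReal.ofReal (l * (v x ^ 2 * (u x / (u x + ε)))))
      ≤ ∫⁻ x, (ENNReal.ofReal (‖Dv x - (v x / (u x + ε)) • Du x‖ ^ 2)
        + ENNReal.ofReal ((g (u x) - h x * f (u x)) * w x)) ∂μ := by
        refine lintegral_mono_ae ?_
        filter_upwards [hBle] with x hx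
        rw [e1]
        gcongr
    _ = ENNReal.ofReal (∫ x, ‖Dv x - (v x / (u x + ε)) • Du x‖ ^ 2 ∂μ)
        + ENNReal.ofReal (∫ x, (g (u x) - h x * f (u x)) * w x ∂μ) := by
        rw [lintegral_add_left' hA.1.aemeasurable.ennreal_ofReal,
          ofReal_integral_eq_lintegral_ofReal hA (Eventually.of_forall fun x => by positivity),
          ofReal_integral_eq_lintegral_ofReal hint hB0]
    _ = _ := by
        rw [← ENNReal.ofReal_add (integral_nonneg fun x => by positivity)
          (integral_nonneg_of_ae hB0), hAB, hDvmem.lintegral_enorm_sq]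

set_option maxHeartbeats 1000000 in
/-- A first eigenfunction `ψ` and a positive solution `u` have proportional gradients,
`u ∇ψ = ψ ∇u`: this is the case of equality in Picone's inequality. -/
theorem IsWeakSolution.smul_gradient_eq (hΩ : IsOpen Ω) (hΩb : Bornology.IsBounded Ω)
    (hu : IsWeakSolution Ω h g f u Du) (hpos : ∀ᵐ x ∂volume.restrict Ω, 0 < u x)
    (hl : 0 ≤ l) (hg : ∀ t, 0 < t → l * t ≤ g t) (hψ : MemHD1 Ω (zeroInterior Ω h) ψ Dψ)
    (hψe : ∫ x in Ω, ‖Dψ x‖ ^ 2 = l * ∫ x in Ω, ψ x ^ 2) :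
    ∀ᵐ x ∂volume.restrict Ω, u x • Dψ x = ψ x • Du x := by
  classical
  set μ := volume.restrict Ω with hμ
  obtain ⟨φ, hφ, -, hφ2, hφ3, hφ4⟩ := hψ.1.exists_ae_approx
  set ε : ℕ → ℝ := fun n => 1 / ((n : ℝ) + 1) with hε
  have hε0 : ∀ n, 0 < ε n := fun n => by positivity
  have hεt : Tendsto ε atTop (𝓝 0) := tendsto_one_div_add_atTop_nhds_zero_nat
  set v : ℕ → (𝔼 N) → ℝ := fun n x => softTrunc (ε n) (φ n x) (ψ x) with hv
  set Dv : ℕ → (𝔼 N) → 𝔼 N := fun n x => softTruncA (ε n) (φ n x) (ψ x) • gradient (φ n) x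
    + softTruncB (ε n) (φ n x) (ψ x) • Dψ x with hDv
  have hineq : ∀ n, ∫⁻ x in Ω, (‖Dv n x - (v n x / (u x + ε n)) • Du x‖ₑ ^ 2
      + ENNReal.ofReal (l * (v n x ^ 2 * (u x / (u x + ε n))))) ≤ ∫⁻ x in Ω, ‖Dv n x‖ₑ ^ 2 :=
    fun n => hu.picone_truncated hΩ hΩb hpos hl hg hψ (hφ n) (hε0 n) (hε0 n)
  -- The coefficients converge pointwise: to `(0, 1)` where `ψ ≠ 0` and to `(0, 0)` elsewhere.
  -- Hence `Dv n → E`. That `E = Dψ`, i.e. `∇ψ = 0` a.e. on `{ψ = 0}`, is not needed: a defect has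
  -- the favourable sign below, and is forced to vanish with the Picone remainder.
  set E : (𝔼 N) → 𝔼 N := fun x => (0 : ℝ) • Dψ x + (if ψ x = 0 then (0 : ℝ) else 1) • Dψ x with hE
  have hA : ∀ᵐ x ∂μ, Tendsto (fun n => softTruncA (ε n) (φ n x) (ψ x)) atTop (𝓝 0) := by
    filter_upwards [hφ3] with x hx using tendsto_softTruncA hx hεt
  have hB : ∀ᵐ x ∂μ, Tendsto (fun n => softTruncB (ε n) (φ n x) (ψ x)) atTop
      (𝓝 (if ψ x = 0 then (0 : ℝ) else 1)) := by
    filter_upwards [hφ3] with x hx using tendsto_softTruncB hx hεt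
  have hV : ∀ᵐ x ∂μ, Tendsto (fun n => v n x) atTop (𝓝 (ψ x)) := by
    filter_upwards [hφ3] with x hx using tendsto_softTrunc hx hεt
  have hpair : ∀ n, AEStronglyMeasurable (fun x => (φ n x, ψ x)) μ := fun n =>
    (hφ n).smooth.continuous.aestronglyMeasurable.prodMk hψ.1.memLp.1
  have mA : ∀ n, AEStronglyMeasurable (fun x => softTruncA (ε n) (φ n x) (ψ x)) μ := fun n =>
    (continuous_softTruncA (hε0 n)).comp_aestronglyMeasurable (hpair n)
  have mB : ∀ n, AEStronglyMeasurable (fun x => softTruncB (ε n) (φ n x) (ψ x)) μ := fun n =>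
    (continuous_softTruncB (hε0 n)).comp_aestronglyMeasurable (hpair n)
  have mV : ∀ n, AEStronglyMeasurable (v n) μ := fun n =>
    (contDiff_softTrunc (hε0 n)).continuous.comp_aestronglyMeasurable (hpair n)
  have mG : ∀ n, AEStronglyMeasurable (gradient (φ n)) μ := fun n => ((hφ n).gradient_memLp μ).1
  have mDv : ∀ n, AEStronglyMeasurable (Dv n) μ := fun n =>
    ((mA n).smul (mG n)).add ((mB n).smul hψ.1.grad_memLp.1)
  have mE0 : AEStronglyMeasurable (fun x => (if ψ x = 0 then (0 : ℝ) else 1)) μ :=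
    aestronglyMeasurable_of_tendsto_ae _ mB hB
  have memE : MemLp E 2 μ := by
    refine hψ.1.grad_memLp.mono ((hψ.1.grad_memLp.1.const_smul (0 : ℝ)).add
      (mE0.smul hψ.1.grad_memLp.1)) (Eventually.of_forall fun x => ?_)
    simp only [hE]
    split_ifs <;> simp
  have memDv : ∀ n, MemLp (Dv n) 2 μ := by
    intro n
    refine ((((hφ n).gradient_memLp μ).norm.const_mul 2).add
      (hψ.1.grad_memLp.norm.const_mul 2)).mono (mDv n) (Eventually.of_forall fun x => ?_)
    rw [Real.norm_of_nonneg (by simp only [Pi.add_apply]; positivity)]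
    refine (norm_add_le _ _).trans ?_
    rw [norm_smul, norm_smul]
    have h1 := abs_softTruncA_le (hε0 n) (φ n x) (ψ x)
    have h2 := abs_softTruncB_le (hε0 n) (φ n x) (ψ x)
    simp only [Pi.add_apply, Real.norm_eq_abs]
    gcongr
  have hDvE : Tendsto (fun n => eLpNorm (fun x => Dv n x - E x) 2 μ) atTop (𝓝 0) := by
    have t1 := tendsto_eLpNorm_two_smul mA mG hψ.1.grad_memLp
      (fun n x => abs_softTruncA_le (hε0 n) _ _) hA hφ2
    have t2 := tendsto_eLpNorm_two_smul mB (V := fun _ => Dψ) (fun _ => hψ.1.grad_memLp.1)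
      hψ.1.grad_memLp (fun n x => abs_softTruncB_le (hε0 n) _ _) hB (by simp)
    exact tendsto_eLpNorm_two_add
      (fun n => ((mA n).smul (mG n)).sub (hψ.1.grad_memLp.1.const_smul (0 : ℝ)))
      (fun n => ((mB n).smul hψ.1.grad_memLp.1).sub (mE0.smul hψ.1.grad_memLp.1)) t1 t2
  have hDvlim : ∀ᵐ x ∂μ, Tendsto (fun n => Dv n x) atTop (𝓝 (E x)) := by
    filter_upwards [hA, hB, hφ4] with x h1 h2 h3
    exact (h1.smul h3).add (h2.smul tendsto_const_nhds)
  have hfatou : ∫⁻ x in Ω, (‖E x - (ψ x / u x) • Du x‖ₑ ^ 2 + ENNReal.ofReal (l * ψ x ^ 2))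
      ≤ ∫⁻ x in Ω, ‖E x‖ₑ ^ 2 := by
    rw [← (tendsto_lintegral_sq memDv memE hDvE).liminf_eq]
    refine le_trans ?_ (liminf_le_liminf (Eventually.of_forall hineq))
    refine le_trans (le_of_eq ?_) (lintegral_liminf_le' fun n => ?_)
    · refine lintegral_congr_ae ?_
      filter_upwards [hDvlim, hV, hpos] with x h1 h2 h3
      refine (Tendsto.liminf_eq ?_).symm
      have h4 : Tendsto (fun n => u x + ε n) atTop (𝓝 (u x)) := by
        simpa using tendsto_const_nhds.add hεt
      have h5 := ((ENNReal.continuous_pow 2).tendsto _).comp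
        (h1.sub ((h2.div h4 h3.ne').smul (tendsto_const_nhds (x := Du x)))).enorm
      have h6 := (ENNReal.continuous_ofReal.tendsto _).comp
        ((tendsto_const_nhds (x := l)).mul ((h2.pow 2).mul
          ((tendsto_const_nhds (x := u x)).div h4 h3.ne')))
      rw [div_self h3.ne', mul_one] at h6
      exact h5.add h6
    · have mu := hu.memH10.memLp.1
      have m1 : AEStronglyMeasurable (fun x => Dv n x - (v n x / (u x + ε n)) • Du x) μ :=
        (mDv n).sub (((mV n).aemeasurable.div (mu.add aestronglyMeasurable_const).aemeasurable
          ).aestronglyMeasurable.smul hu.memH10.grad_memLp.1)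
      have m2 : AEMeasurable (fun x => l * (v n x ^ 2 * (u x / (u x + ε n)))) μ :=
        (((mV n).aemeasurable.pow_const 2).mul (mu.aemeasurable.div
          (mu.add aestronglyMeasurable_const).aemeasurable)).const_mul l
      exact (m1.enorm.pow_const 2).add m2.ennreal_ofReal
  have mψ2 : Integrable (fun x => ψ x ^ 2) μ := by
    simpa using hψ.1.memLp.integrable_norm_pow (by norm_num)
  have hquot : AEStronglyMeasurable (fun x => E x - (ψ x / u x) • Du x) μ :=
    memE.1.sub ((hψ.1.memLp.1.aemeasurable.div
      hu.memH10.memLp.1.aemeasurable).aestronglyMeasurable.smul hu.memH10.grad_memLp.1)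
  have hdiff : AEStronglyMeasurable (fun x => Dψ x - E x) μ := hψ.1.grad_memLp.1.sub memE.1
  -- `E` is pointwise either `Dψ` or `0`, so the eigenvalue identity splits.
  have hsplit : (∫⁻ x in Ω, ‖E x‖ₑ ^ 2) + ∫⁻ x in Ω, ‖Dψ x - E x‖ₑ ^ 2
      = ∫⁻ x in Ω, ENNReal.ofReal (l * ψ x ^ 2) := by
    rw [← lintegral_add_left' (memE.1.enorm.pow_const 2),
      ← ofReal_integral_eq_lintegral_ofReal (mψ2.const_mul l)
        (Eventually.of_forall fun x => by positivity), integral_const_mul, ← hψe,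
      ← hψ.1.grad_memLp.lintegral_enorm_sq]
    refine lintegral_congr fun x => ?_
    simp only [hE]
    split_ifs <;> simp
  rw [lintegral_add_left' (hquot.enorm.pow_const 2), ← hsplit, add_comm, add_assoc] at hfatou
  have hfin : ∫⁻ x in Ω, ‖E x‖ₑ ^ 2 ≠ ⊤ := by
    rw [← eLpNorm_two_sq]; exact ENNReal.pow_ne_top memE.eLpNorm_ne_top
  have hsum : (∫⁻ x in Ω, ‖Dψ x - E x‖ₑ ^ 2)
      + ∫⁻ x in Ω, ‖E x - (ψ x / u x) • Du x‖ₑ ^ 2 = 0 := by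
    have : (∫⁻ x in Ω, ‖E x‖ₑ ^ 2) + ((∫⁻ x in Ω, ‖Dψ x - E x‖ₑ ^ 2)
      + ∫⁻ x in Ω, ‖E x - (ψ x / u x) • Du x‖ₑ ^ 2) ≤ (∫⁻ x in Ω, ‖E x‖ₑ ^ 2) + 0 := by
      simpa using hfatou
    exact le_antisymm ((ENNReal.add_le_add_iff_left hfin).1 this) zero_le
  rw [add_eq_zero, lintegral_eq_zero_iff' (hdiff.enorm.pow_const 2),
    lintegral_eq_zero_iff' (hquot.enorm.pow_const 2)] at hsum
  filter_upwards [hsum.1, hsum.2, hpos] with x h1 h2 h3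
  have h1' : Dψ x = E x := by simpa [sub_eq_zero] using h1
  have h2' : E x = (ψ x / u x) • Du x := by simpa [sub_eq_zero] using h2
  rw [h1', h2', smul_smul, mul_div_cancel₀ _ h3.ne']

end PiconeIdentity

/-! ### Local proportionality of the eigenfunction and the solution -/

section Constancy

variable {N : ℕ} {Ω : Set (𝔼 N)}

/-- A form of the Poincaré inequality on a ball, obtained by integrating the `L²` modulus of
continuity over all translations. -/
theorem lintegral_lintegral_sub_sq_le {φ : (𝔼 N) → ℝ} (hφ : ContDiff ℝ ∞ φ) (x₀ : 𝔼 N) (R : ℝ) :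
    ∫⁻ x in Metric.ball x₀ R, ∫⁻ x' in Metric.ball x₀ R, ‖φ x' - φ x‖ₑ ^ 2
      ≤ volume (Metric.ball (0 : 𝔼 N) (2 * R)) * (ENNReal.ofReal (2 * R) ^ 2
        * ∫⁻ x in Metric.ball x₀ R, ‖gradient φ x‖ₑ ^ 2) := by
  set D := Metric.ball x₀ R with hD
  have hDm : MeasurableSet D := Metric.isOpen_ball.measurableSet
  have hc := hφ.continuous
  have hjm : Measurable (Function.uncurry fun x y : 𝔼 N =>
      D.indicator (fun x' => ‖φ x' - φ x‖ₑ ^ 2) (x + y)) := by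
    have e : (Function.uncurry fun x y : 𝔼 N => D.indicator (fun x' => ‖φ x' - φ x‖ₑ ^ 2) (x + y))
        = {p : (𝔼 N) × 𝔼 N | p.1 + p.2 ∈ D}.indicator
          fun p => ‖φ (p.1 + p.2) - φ p.1‖ₑ ^ 2 := by
      funext p
      simp only [Function.uncurry, indicator]
      rfl
    rw [e]
    refine Measurable.indicator ?_ ((measurable_fst.add measurable_snd) hDm)
    have : Continuous fun p : (𝔼 N) × 𝔼 N => φ (p.1 + p.2) - φ p.1 :=
      (hc.comp (by fun_prop)).sub (hc.comp continuous_fst)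
    exact this.enorm.measurable.pow_const 2
  calc ∫⁻ x in D, ∫⁻ x' in D, ‖φ x' - φ x‖ₑ ^ 2
      = ∫⁻ x in D, ∫⁻ y, D.indicator (fun x' => ‖φ x' - φ x‖ₑ ^ 2) (x + y) := by
        refine lintegral_congr fun x => ?_
        rw [lintegral_add_left_eq_self, lintegral_indicator hDm]
    _ = ∫⁻ y, ∫⁻ x in D, D.indicator (fun x' => ‖φ x' - φ x‖ₑ ^ 2) (x + y) :=
        lintegral_lintegral_swap hjm.aemeasurable
    _ ≤ ∫⁻ y, (Metric.ball (0 : 𝔼 N) (2 * R)).indicator (fun _ => ENNReal.ofReal (2 * R) ^ 2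
          * ∫⁻ x in D, ‖gradient φ x‖ₑ ^ 2) y := by
        refine lintegral_mono fun y => ?_
        by_cases hy : y ∈ Metric.ball (0 : 𝔼 N) (2 * R)
        · rw [indicator_of_mem hy]
          have h1 := lintegral_translate_sub_sq_le hφ (convex_ball x₀ R) hDm y
          refine le_trans (le_of_eq ?_) (h1.trans (mul_le_mul' ?_ le_rfl))
          · have hm : MeasurableSet {x : 𝔼 N | x + y ∈ Metric.ball x₀ R} :=
              (measurable_id.add_const y) hDm
            rw [inter_comm, ← Measure.restrict_restrict hm, ← lintegral_indicator hm]
            rfl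
          · gcongr
            rw [← ofReal_norm]
            exact ENNReal.ofReal_le_ofReal (by simpa using (mem_ball_zero_iff.1 hy).le)
        · rw [indicator_of_notMem hy]
          refine le_of_eq ?_
          rw [setLIntegral_eq_zero_iff' hDm]
          · refine Eventually.of_forall fun x hx => indicator_of_notMem (fun hxy => hy ?_) _
            rw [mem_ball_zero_iff]
            have h1 := mem_ball_iff_norm.1 hx
            have h2 := mem_ball_iff_norm.1 hxy
            have h3 : y = (x + y - x₀) - (x - x₀) := by abel
            calc ‖y‖ = ‖(x + y - x₀) - (x - x₀)‖ := by rw [← h3]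
              _ ≤ ‖x + y - x₀‖ + ‖x - x₀‖ := norm_sub_le _ _
              _ < 2 * R := by linarith
          · exact (hjm.comp (measurable_id.prodMk measurable_const)).aemeasurable
    _ = _ := by
        rw [lintegral_indicator Metric.isOpen_ball.measurableSet, setLIntegral_const, mul_comm]

/-- An admissible function whose gradient vanishes on a ball is constant on that ball. -/
theorem IsAdmissible.ae_const_of_gradient_eq_zero {z : (𝔼 N) → ℝ} {Dz : (𝔼 N) → 𝔼 N}
    (hz : IsAdmissible Ω z Dz) {x₀ : 𝔼 N} {R : ℝ} (hR : 0 < R) (hball : Metric.ball x₀ R ⊆ Ω)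
    (hDz : ∀ᵐ x ∂volume.restrict (Metric.ball x₀ R), Dz x = 0) :
    ∃ τ : ℝ, ∀ᵐ x ∂volume.restrict (Metric.ball x₀ R), z x = τ := by
  obtain ⟨φ, K, M, -, -, hφ, -, -, hlim, hgrad⟩ := hz.approx
  set D := Metric.ball x₀ R with hD
  have hDm : MeasurableSet D := Metric.isOpen_ball.measurableSet
  have hlimD : ∀ᵐ x ∂volume.restrict D, Tendsto (fun n => φ n x) atTop (𝓝 (z x)) :=
    ae_mono (Measure.restrict_mono hball le_rfl) hlim
  have hg0 : Tendsto (fun n => ∫⁻ x in D, ‖gradient (φ n) x‖ₑ ^ 2) atTop (𝓝 0) := by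
    refine tendsto_of_tendsto_of_tendsto_of_le_of_le tendsto_const_nhds
      (tendsto_eLpNorm_two_iff.1 hgrad) (fun _ => zero_le) fun n => ?_
    calc ∫⁻ x in D, ‖gradient (φ n) x‖ₑ ^ 2 = ∫⁻ x in D, ‖gradient (φ n) x - Dz x‖ₑ ^ 2 := by
          refine lintegral_congr_ae ?_
          filter_upwards [hDz] with x hx
          rw [hx, sub_zero]
      _ ≤ _ := lintegral_mono' (Measure.restrict_mono hball le_rfl) le_rfl
  set G : ℕ → (𝔼 N) → ENNReal := fun n x => ∫⁻ x' in D, ‖φ n x' - φ n x‖ₑ ^ 2 with hG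
  have hGm : ∀ n, Measurable (G n) := by
    intro n
    have hc := (hφ n).smooth.continuous
    have : Measurable (Function.uncurry fun x x' => ‖φ n x' - φ n x‖ₑ ^ 2) :=
      ((hc.comp continuous_snd).sub (hc.comp continuous_fst)).enorm.measurable.pow_const 2
    exact this.lintegral_prod_right
  have hGt : Tendsto (fun n => ∫⁻ x in D, G n x) atTop (𝓝 0) := by
    have hC : volume (Metric.ball (0 : 𝔼 N) (2 * R)) ≠ ⊤ := measure_ball_lt_top.ne
    refine tendsto_of_tendsto_of_tendsto_of_le_of_le tendsto_const_nhds
      (h := fun n => volume (Metric.ball (0 : 𝔼 N) (2 * R)) * (ENNReal.ofReal (2 * R) ^ 2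
        * ∫⁻ x in D, ‖gradient (φ n) x‖ₑ ^ 2)) ?_ (fun _ => zero_le)
      fun n => lintegral_lintegral_sub_sq_le (hφ n).smooth x₀ R
    have := ENNReal.Tendsto.const_mul (ENNReal.Tendsto.const_mul hg0
      (Or.inr (ENNReal.pow_ne_top (n := 2) (ENNReal.ofReal_ne_top (r := 2 * R))))) (Or.inr hC)
    simpa using this
  have hliminf : ∫⁻ x in D, liminf (fun n => G n x) atTop = 0 := by
    refine le_antisymm ?_ zero_le
    rw [← hGt.liminf_eq]
    exact lintegral_liminf_le hGm
  have hae := (lintegral_eq_zero_iff (Measurable.liminf hGm)).1 hliminf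
  have hD0 : volume D ≠ 0 := (Metric.measure_ball_pos volume x₀ hR).ne'
  have : NeBot (ae (volume.restrict D)) := by
    rw [ae_neBot, Ne, Measure.restrict_eq_zero]
    exact hD0
  -- Fatou's lemma gives a point `x` at which the inner integral tends to zero along a subsequence;
  -- the constant is `z x`.
  obtain ⟨x, hx1, hx2⟩ := (hae.and hlimD).exists
  refine ⟨z x, ?_⟩
  have hzm : AEStronglyMeasurable z (volume.restrict D) :=
    aestronglyMeasurable_of_tendsto_ae _
      (fun n => (hφ n).smooth.continuous.aestronglyMeasurable) hlimD
  have h0 : ∫⁻ x' in D, ‖z x' - z x‖ₑ ^ 2 = 0 := by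
    refine le_antisymm ?_ zero_le
    have hx1' : liminf (fun n => G n x) atTop = 0 := hx1
    rw [← hx1']
    refine le_trans (le_of_eq ?_) (lintegral_liminf_le' fun n => ?_)
    · refine lintegral_congr_ae ?_
      filter_upwards [hlimD] with x' hx'
      refine (Tendsto.liminf_eq ?_).symm
      exact ((ENNReal.continuous_pow 2).tendsto _).comp (hx'.sub hx2).enorm
    · exact (((hφ n).smooth.continuous.sub continuous_const).enorm.measurable.pow_const
        2).aemeasurable
  have hsub : AEStronglyMeasurable (fun x' => z x' - z x) (volume.restrict D) :=
    hzm.sub aestronglyMeasurable_const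
  rw [lintegral_eq_zero_iff' (hsub.enorm.pow_const 2)] at h0
  filter_upwards [h0] with x' hx'
  simpa [sub_eq_zero] using hx'

/-- Where `u` is bounded below, `ψ` is locally a constant multiple of `u`: the function
`arctan (ψ / u)` has vanishing gradient. -/
theorem exists_ae_eq_const_mul (hΩb : Bornology.IsBounded Ω) {u ψ : (𝔼 N) → ℝ}
    {Du Dψ : (𝔼 N) → 𝔼 N} (hu : MemH10 Ω u Du) (hψ : MemH10 Ω ψ Dψ)
    (hid : ∀ᵐ x ∂volume.restrict Ω, u x • Dψ x = ψ x • Du x) {x₀ : 𝔼 N} {s c : ℝ} (hs : 0 < s)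
    (hc : 0 < c) (hball : Metric.ball x₀ s ⊆ Ω)
    (hlow : ∀ᵐ x ∂volume.restrict (Metric.ball x₀ s), c ≤ u x) :
    ∃ κ : ℝ, ∀ᵐ x ∂volume.restrict (Metric.ball x₀ (s / 2)), ψ x = κ * u x := by
  obtain ⟨ρ, ρ', Mρ, hρ, hρ'c, hρ', hρ1, hρ'1, hρlow, hρM⟩ := exists_smooth_positive_identity hc
  have hρpos : ∀ t, 0 < ρ t := fun t => (half_pos hc).trans_le (hρlow t)
  have hMρ0 : 0 ≤ Mρ := (abs_nonneg _).trans (hρM 0)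
  let ζ : ContDiffBump x₀ := ⟨s / 2, 3 * s / 4, by positivity, by linarith⟩
  have hζΩ : tsupport ζ ⊆ Ω := by
    rw [ζ.tsupport_eq]
    exact (Metric.closedBall_subset_ball (show 3 * s / 4 < s by linarith)).trans hball
  have hζ : IsTestFunction Ω ζ := ⟨ζ.contDiff, ζ.hasCompactSupport, hζΩ⟩
  obtain ⟨M2, hM2⟩ := hζ.hasCompactSupport_gradient.exists_bound_of_continuous
    hζ.smooth.continuous_gradient
  have hM20 : 0 ≤ M2 := (norm_nonneg _).trans (hM2 0)
  have hζ1 : ∀ x, |ζ x| ≤ 1 := fun x => by rw [abs_of_nonneg ζ.nonneg]; exact ζ.le_one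
  have hζc : Continuous fun p : (𝔼 N) × ℝ × ℝ => ζ p.1 := ζ.continuous.comp continuous_fst
  have hinv : ∀ c', |(ρ c')⁻¹| ≤ 2 / c := by
    intro c'
    rw [abs_of_pos (inv_pos.2 (hρpos _)), inv_le_comm₀ (hρpos _) (by positivity), inv_div]
    exact hρlow _
  have hρc : Continuous fun p : (𝔼 N) × ℝ × ℝ => (ρ p.2.2)⁻¹ :=
    (hρ.continuous.comp (by fun_prop)).inv₀ fun p => (hρpos _).ne'
  have hqc : Continuous fun p : (𝔼 N) × ℝ × ℝ => p.2.1 * (ρ p.2.2)⁻¹ :=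
    (continuous_fst.comp continuous_snd).mul hρc
  have hkc : Continuous fun p : (𝔼 N) × ℝ × ℝ => (1 + (p.2.1 * (ρ p.2.2)⁻¹) ^ 2)⁻¹ :=
    (continuous_const.add (hqc.pow 2)).inv₀ fun p =>
      (by positivity : (0 : ℝ) < 1 + (p.2.1 * (ρ p.2.2)⁻¹) ^ 2).ne'
  have hk1 : ∀ t : ℝ, |(1 + t ^ 2)⁻¹| ≤ 1 := by
    intro t
    rw [abs_of_pos (by positivity)]
    exact inv_le_one_of_one_le₀ (by nlinarith [sq_nonneg t])
  have hk2 : ∀ t : ℝ, |(1 + t ^ 2)⁻¹ * t| ≤ 1 := by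
    intro t
    rw [abs_mul, abs_of_pos (by positivity : (0 : ℝ) < (1 + t ^ 2)⁻¹), inv_mul_le_iff₀
      (by positivity), mul_one, ← sq_abs]
    nlinarith [sq_nonneg (|t| - 1), abs_nonneg t]
  have hat : ∀ t, |Real.arctan t| ≤ 2 := fun t => by
    rw [abs_le]
    have h1 := Real.arctan_lt_pi_div_two t
    have h2 := Real.neg_pi_div_two_lt_arctan t
    have h3 := Real.pi_le_four
    constructor <;> linarith
  have hc2 : 0 ≤ 2 / c := by positivity
  -- The bounded function `arctan (ψ / u)`, localised by a cutoff, is admissible.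
  have hadm := IsAdmissible.comp hΩb hψ hu
    (S := fun x b c => ζ x * Real.arctan (b * (ρ c)⁻¹))
    (Sx := fun x b c => Real.arctan (b * (ρ c)⁻¹) • gradient ζ x)
    (Sb := fun x b c => ζ x * (1 + (b * (ρ c)⁻¹) ^ 2)⁻¹ * (ρ c)⁻¹)
    (Sc := fun x b c => -(ζ x * ((1 + (b * (ρ c)⁻¹) ^ 2)⁻¹ * (b * (ρ c)⁻¹)) * ρ' c * (ρ c)⁻¹))
    (M := 2 + 2 * M2 + 2 / c + Mρ * (2 / c))
    hζ.compact hζ.support_subset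
    (by
      refine (hζ.smooth.comp contDiff_fst).mul (Real.contDiff_arctan.comp ?_)
      exact (contDiff_fst.comp contDiff_snd).mul
        ((hρ.comp (contDiff_snd.comp contDiff_snd)).inv fun p => (hρpos _).ne'))
    (by
      intro β γ β' γ' x hβ hγ
      have h1 := (hρ' (γ x)).comp_hasFDerivAt x hγ.hasFDerivAt
      have h2 := hβ.hasFDerivAt.mul
        ((hasDerivAt_inv (hρpos (γ x)).ne').comp_hasFDerivAt x h1)
      have h3 := (hζ.hasGradientAt x).hasFDerivAt.mul
        ((Real.hasDerivAt_arctan (β x * (ρ (γ x))⁻¹)).comp_hasFDerivAt x h2)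
      rw [hasGradientAt_iff_hasFDerivAt]
      refine HasFDerivAt.congr_fderiv (f' := _) h3 ?_
      ext z
      simp
      ring)
    ((Real.continuous_arctan.comp hqc).smul (hζ.smooth.continuous_gradient.comp continuous_fst))
    ((hζc.mul hkc).mul hρc)
    ((((hζc.mul (hkc.mul hqc)).mul (hρ'c.comp (by fun_prop))).mul hρc).neg)
    (by
      intro x b c'
      have h1 : |ζ x * Real.arctan (b * (ρ c')⁻¹)| ≤ 1 * 2 := by
        rw [abs_mul]
        gcongr
        · exact hζ1 x
        · exact hat _
      have : 0 ≤ Mρ * (2 / c) := by positivity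
      linarith)
    (by
      intro x b c'
      have h1 : ‖Real.arctan (b * (ρ c')⁻¹) • gradient ζ x‖ ≤ 2 * M2 := by
        rw [norm_smul]
        gcongr
        · exact hat _
        · exact hM2 x
      have : 0 ≤ Mρ * (2 / c) := by positivity
      linarith)
    (by
      intro x b c'
      have h1 : |ζ x * (1 + (b * (ρ c')⁻¹) ^ 2)⁻¹ * (ρ c')⁻¹| ≤ 1 * 1 * (2 / c) := by
        rw [abs_mul, abs_mul]
        gcongr
        · exact hζ1 x
        · exact hk1 _
        · exact hinv _
      have : 0 ≤ Mρ * (2 / c) := by positivity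
      linarith)
    (by
      intro x b c'
      have h1 : |-(ζ x * ((1 + (b * (ρ c')⁻¹) ^ 2)⁻¹ * (b * (ρ c')⁻¹)) * ρ' c' * (ρ c')⁻¹)|
          ≤ 1 * 1 * Mρ * (2 / c) := by
        rw [abs_neg, abs_mul, abs_mul, abs_mul]
        gcongr
        · exact hζ1 x
        · exact hk2 _
        · exact hρM _
        · exact hinv _
      linarith)
    (by
      intro x hx b c'
      simp [image_eq_zero_of_notMem_tsupport hx])
  have hsub2 : Metric.ball x₀ (s / 2) ⊆ Metric.ball x₀ s := Metric.ball_subset_ball (by linarith)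
  have hlow2 := ae_mono (Measure.restrict_mono hsub2 le_rfl) hlow
  have hid2 := ae_mono (Measure.restrict_mono (hsub2.trans hball) le_rfl) hid
  have hmem2 : ∀ᵐ x ∂volume.restrict (Metric.ball x₀ (s / 2)), x ∈ Metric.ball x₀ (s / 2) :=
    ae_restrict_mem Metric.isOpen_ball.measurableSet
  obtain ⟨τ, hτ⟩ := hadm.ae_const_of_gradient_eq_zero (x₀ := x₀) (R := s / 2) (by positivity)
    (hsub2.trans hball) (by
      filter_upwards [hlow2, hid2, hmem2] with x h1 h2 h3
      have e1 : ρ (u x) = u x := hρ1 _ h1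
      have e2 : ρ' (u x) = 1 := hρ'1 _ h1
      have hu0 : u x ≠ 0 := (hc.trans_le h1).ne'
      have e3 : gradient ζ x = 0 := by
        have : (ζ : (𝔼 N) → ℝ) =ᶠ[𝓝 x] fun _ => 1 := by
          filter_upwards [Metric.isOpen_ball.mem_nhds h3] with y hy
          exact ζ.one_of_mem_closedBall (Metric.ball_subset_closedBall hy)
        rw [this.gradient_eq]
        simp
      have e4 : Dψ x = (u x)⁻¹ • ψ x • Du x := by
        rw [← h2, smul_smul, inv_mul_cancel₀ hu0, one_smul]
      simp only [e1, e2, e3, e4, smul_zero, zero_add, smul_smul, ← add_smul]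
      convert zero_smul ℝ (Du x) using 2
      ring)
  refine ⟨Real.tan τ, ?_⟩
  filter_upwards [hτ, hlow2, hmem2] with x h1 h2 h3
  have e1 : ρ (u x) = u x := hρ1 _ h2
  have hu0 : u x ≠ 0 := (hc.trans_le h2).ne'
  have e2 : ζ x = 1 := ζ.one_of_mem_closedBall (Metric.ball_subset_closedBall h3)
  rw [e2, one_mul, e1] at h1
  rw [← h1, Real.tan_arctan, mul_assoc, inv_mul_cancel₀ hu0, mul_one]

end Constancy

/-! ### Local positivity of supersolutions -/

section MeanValue

variable {N : ℕ} {Ω : Set (𝔼 N)}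

/-- The radial bump at scale `s` centred at `x`. -/
def scaledBump (s : ℝ) (x z : 𝔼 N) : ℝ := radialBump (s⁻¹ • (z - x))

theorem hasGradientAt_scaledBump (s : ℝ) (x z : 𝔼 N) :
    HasGradientAt (scaledBump s x)
      (-(s⁻¹ • radialKernel (s⁻¹ • (z - x)) • (s⁻¹ • (z - x)))) z := by
  have h1 : HasFDerivAt (fun z : 𝔼 N => s⁻¹ • (z - x)) (s⁻¹ • ContinuousLinearMap.id ℝ (𝔼 N)) z :=
    ((hasFDerivAt_id z).sub_const x).const_smul s⁻¹
  have h2 := (hasGradientAt_radialBump (s⁻¹ • (z - x))).hasFDerivAt.comp z h1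
  rw [hasGradientAt_iff_hasFDerivAt]
  refine HasFDerivAt.congr_fderiv (f' := _) h2 ?_
  ext y
  simp

theorem isTestFunction_scaledBump {s : ℝ} (hs : 0 < s) {x : 𝔼 N}
    (hball : Metric.closedBall x s ⊆ Ω) : IsTestFunction Ω (scaledBump s x) := by
  have hsub : Function.support (scaledBump s x) ⊆ Metric.closedBall x s := by
    intro z hz
    by_contra h
    refine hz (radialBump_eq_zero ?_)
    rw [norm_smul, norm_inv, Real.norm_of_nonneg hs.le, ← div_eq_inv_mul, le_div_iff₀ hs, one_mul,
      ← dist_eq_norm]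
    exact (not_le.1 h).le
  refine ⟨contDiff_radialBump.comp (by fun_prop : ContDiff ℝ ∞ fun z : 𝔼 N => s⁻¹ • (z - x)),
    HasCompactSupport.of_support_subset_isCompact (isCompact_closedBall x s) hsub, ?_⟩
  exact (closure_minimal hsub Metric.isClosed_closedBall).trans hball

/-- The derivative in `s` of `∫ φ(x + s y) K(y) dy` is minus the Dirichlet pairing of `φ` with a
positive multiple of the bump at scale `s`. -/
theorem hasDerivAt_mollify {φ : (𝔼 N) → ℝ} (hφ : IsTestFunction Ω φ) (x : 𝔼 N) {s : ℝ}
    (hs : 0 < s) :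
    HasDerivAt (fun s => ∫ y, φ (x + s • y) * radialKernel y)
      (-(s * (s ^ N)⁻¹ * ∫ z in Ω, inner ℝ (gradient φ z) (gradient (scaledBump s x) z))) s := by
  have hgc := hφ.smooth.continuous_gradient
  have hc := hφ.smooth.continuous
  obtain ⟨M, hM⟩ := hφ.hasCompactSupport_gradient.exists_bound_of_continuous hgc
  have hM0 : 0 ≤ M := (norm_nonneg _).trans (hM 0)
  have hmain := (hasDerivAt_integral_of_dominated_loc_of_deriv_le (μ := (volume : Measure (𝔼 N)))
    (F := fun s y => φ (x + s • y) * radialKernel y)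
    (F' := fun s y => inner ℝ (gradient φ (x + s • y)) y * radialKernel y)
    (x₀ := s) (s := univ) (bound := fun y => M * radialKernel y) univ_mem
    (Eventually.of_forall fun s =>
      ((hc.comp (by fun_prop)).mul continuous_radialKernel).aestronglyMeasurable)
    (((hc.comp (by fun_prop)).mul continuous_radialKernel).integrable_of_hasCompactSupport
      hasCompactSupport_radialKernel.mul_left)
    ((((hgc.comp (by fun_prop)).inner continuous_id).mul
      continuous_radialKernel).aestronglyMeasurable)
    (Eventually.of_forall fun y t _ => by
      rw [norm_mul, Real.norm_of_nonneg (radialKernel_nonneg y)]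
      by_cases hy : 1 ≤ ‖y‖
      · simp [radialKernel_eq_zero hy]
      · gcongr
        · exact radialKernel_nonneg y
        · refine (norm_inner_le_norm _ _).trans ?_
          have := hM (x + t • y)
          nlinarith [norm_nonneg y, norm_nonneg (gradient φ (x + t • y)), not_le.1 hy])
    (integrable_radialKernel.const_mul M)
    (Eventually.of_forall fun y t _ => by
      have h1 : HasDerivAt (fun t : ℝ => x + t • y) y t := by
        simpa using ((hasDerivAt_id t).smul_const y).const_add x
      have h2 := ((hφ.smooth.differentiable (by simp)) (x + t • y)).hasFDerivAt
      rw [inner_gradient_left]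
      exact (h2.comp_hasDerivAt t h1).mul_const _)).2
  refine hmain.congr_deriv (Eq.symm ?_)
  have e1 : ∫ z in Ω, inner ℝ (gradient φ z) (gradient (scaledBump s x) z)
      = ∫ z, inner ℝ (gradient φ z) (gradient (scaledBump s x) z) :=
    setIntegral_eq_integral_of_forall_compl_eq_zero fun z hz => by
      rw [gradient_eq_zero_of_notMem_tsupport fun h => hz (hφ.support_subset h), inner_zero_left]
  have h1 := Measure.integral_comp_smul (volume : Measure (𝔼 N))
    (fun z => inner ℝ (gradient φ (x + z)) (s⁻¹ • z) * radialKernel (s⁻¹ • z)) s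
  have h2 : ∀ y : 𝔼 N, s⁻¹ • s • y = y := fun y => inv_smul_smul₀ hs.ne' y
  simp only [h2, finrank_euclideanSpace, Fintype.card_fin] at h1
  rw [e1, h1, ← integral_add_left_eq_self (μ := volume)
    (fun z => inner ℝ (gradient φ z) (gradient (scaledBump s x) z)) x,
    smul_eq_mul, abs_of_pos (by positivity), ← integral_const_mul, ← integral_neg,
    ← integral_const_mul]
  congr 1 with z
  rw [(hasGradientAt_scaledBump s x (x + z)).gradient, add_sub_cancel_left, inner_neg_right,
    real_inner_smul_right, real_inner_smul_right]
  field_simp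

theorem abs_integral_inner_le {α F : Type*} [MeasurableSpace α] {μ : Measure α}
    [NormedAddCommGroup F] [InnerProductSpace ℝ F] {U V : α → F} (hU : MemLp U 2 μ)
    (hV : MemLp V 2 μ) :
    |∫ x, inner ℝ (U x) (V x) ∂μ| ≤ (eLpNorm U 2 μ).toReal * (eLpNorm V 2 μ).toReal := by
  have key : ∫ x, inner ℝ (U x) (V x) ∂μ = inner ℝ (hU.toLp U) (hV.toLp V) := by
    rw [L2.inner_def]
    refine integral_congr_ae ?_
    filter_upwards [hU.coeFn_toLp, hV.coeFn_toLp] with x h1 h2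
    rw [h1, h2]
  rw [key]
  refine (abs_real_inner_le_norm _ _).trans (le_of_eq ?_)
  rw [Lp.norm_toLp, Lp.norm_toLp]

/-- The means `∫ u(x + s y) K(y) dy` of a supersolution decrease in the scale `s`. The sign of the
derivative in `s` is known for `u` only in the weak form `hsup`, so it is carried over to test
functions approximating `u` with an error that tends to zero. -/
theorem MemH10.mollify_antitone (hΩb : Bornology.IsBounded Ω) {u : (𝔼 N) → ℝ} {Du : (𝔼 N) → 𝔼 N}
    (hu : MemH10 Ω u Du) {x : 𝔼 N} {s t : ℝ} (hs : 0 < s) (hst : s ≤ t)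
    (hball : Metric.closedBall x t ⊆ Ω)
    (hsup : ∀ τ, s ≤ τ → τ ≤ t →
      0 ≤ ∫ z in Ω, inner ℝ (Du z) (gradient (scaledBump τ x) z)) :
    ∫ z in Ω, u z * scaledKernel t x z ≤ ∫ z in Ω, u z * scaledKernel s x z := by
  obtain ⟨φ, hφ, h1, h2, -, -⟩ := hu.exists_ae_approx
  have hfin : IsFiniteMeasure (volume.restrict Ω) := ⟨by simpa using hΩb.measure_lt_top⟩
  have hconv : ∀ τ, Tendsto (fun n => ∫ z in Ω, φ n z * scaledKernel τ x z) atTop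
      (𝓝 (∫ z in Ω, u z * scaledKernel τ x z)) := by
    intro τ
    have := tendsto_integral_inner (memLp_scaledKernel hΩb τ x)
      (fun n => (hφ n).memLp (volume.restrict Ω)) hu.memLp h1
    simpa using this
  obtain ⟨M, hM⟩ := hasCompactSupport_radialKernel.exists_bound_of_continuous
    (continuous_radialKernel (N := N))
  have hM0 : 0 ≤ M := (norm_nonneg _).trans (hM 0)
  -- A bound for `‖∇ (scaledBump τ x)‖₂`, uniform in `τ ≥ s`.
  set B : ℝ := ((volume.restrict Ω) univ ^ (2 : ENNReal).toReal⁻¹ *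
    ENNReal.ofReal (s⁻¹ * M)).toReal with hB
  have hBgrad : ∀ τ, s ≤ τ → (eLpNorm (gradient (scaledBump τ x)) 2 (volume.restrict Ω)).toReal
      ≤ B := by
    intro τ hτ
    have hτ0 : 0 < τ := hs.trans_le hτ
    refine ENNReal.toReal_mono (ENNReal.mul_ne_top (ENNReal.rpow_ne_top_of_nonneg (by positivity)
      (measure_ne_top _ _)) ENNReal.ofReal_ne_top)
      (eLpNorm_le_of_ae_bound (Eventually.of_forall fun z => ?_))
    rw [(hasGradientAt_scaledBump τ x z).gradient, norm_neg, norm_smul, norm_smul, norm_inv,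
      Real.norm_of_nonneg hτ0.le]
    gcongr
    set y := τ⁻¹ • (z - x) with hy
    by_cases h : 1 ≤ ‖y‖
    · rw [radialKernel_eq_zero h]; simpa using hM0
    · have := hM y
      nlinarith [norm_nonneg y, norm_nonneg (radialKernel y), not_le.1 h]
  have hB0 : 0 ≤ B := ENNReal.toReal_nonneg
  set e : ℕ → ℝ := fun n =>
    (eLpNorm (fun z => gradient (φ n) z - Du z) 2 (volume.restrict Ω)).toReal with he
  have het : Tendsto e atTop (𝓝 0) := by
    have := (ENNReal.tendsto_toReal ENNReal.zero_ne_top).comp h2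
    rw [ENNReal.toReal_zero] at this
    exact this
  have ht0 : 0 < t := hs.trans_le hst
  set C : ℝ := t * (s ^ N)⁻¹ * B with hC
  have hstep : ∀ n, (∫ z in Ω, φ n z * scaledKernel t x z)
      - ∫ z in Ω, φ n z * scaledKernel s x z ≤ C * e n * (t - s) := by
    intro n
    rw [(hφ n).setIntegral_mul, (hφ n).setIntegral_mul, integral_mul_scaledKernel hs,
      integral_mul_scaledKernel ht0]
    refine Convex.image_sub_le_mul_sub_of_deriv_le (D := Icc s t) (convex_Icc s t)
      (f := fun s => ∫ y, φ n (x + s • y) * radialKernel y) ?_ ?_ ?_ s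
      (left_mem_Icc.2 hst) t (right_mem_Icc.2 hst) hst
    · intro τ hτ
      exact (hasDerivAt_mollify (hφ n) x (hs.trans_le hτ.1)).continuousAt.continuousWithinAt
    · intro τ hτ
      rw [interior_Icc] at hτ
      exact (hasDerivAt_mollify (hφ n) x (hs.trans hτ.1)).differentiableAt.differentiableWithinAt
    · intro τ hτ
      rw [interior_Icc] at hτ
      have hτ0 := hs.trans hτ.1
      rw [(hasDerivAt_mollify (hφ n) x hτ0).deriv]
      have htest : IsTestFunction Ω (scaledBump τ x) := isTestFunction_scaledBump hτ0
        ((Metric.closedBall_subset_closedBall hτ.2.le).trans hball)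
      have hmem := htest.gradient_memLp (volume.restrict Ω)
      have hgn := (hφ n).gradient_memLp (volume.restrict Ω)
      have i1 := hgn.integrable_inner_two hmem
      have i2 := hu.grad_memLp.integrable_inner_two hmem
      have hsplit : ∫ z in Ω, inner ℝ (gradient (φ n) z - Du z) (gradient (scaledBump τ x) z)
          = (∫ z in Ω, inner ℝ (gradient (φ n) z) (gradient (scaledBump τ x) z))
            - ∫ z in Ω, inner ℝ (Du z) (gradient (scaledBump τ x) z) := by
        rw [← integral_sub i1 i2]
        simp_rw [inner_sub_left]
      have hcs := abs_integral_inner_le (hgn.sub hu.grad_memLp) hmem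
      have hcs2 : -(e n * B)
          ≤ ∫ z in Ω, inner ℝ (gradient (φ n) z - Du z) (gradient (scaledBump τ x) z) := by
        refine (neg_le_neg (hcs.trans ?_)).trans (neg_abs_le _)
        exact mul_le_mul_of_nonneg_left (hBgrad τ hτ.1.le) ENNReal.toReal_nonneg
      have hpos := hsup τ hτ.1.le hτ.2.le
      have hlow : -(e n * B)
          ≤ ∫ z in Ω, inner ℝ (gradient (φ n) z) (gradient (scaledBump τ x) z) := by linarith
      have heB : 0 ≤ e n * B := mul_nonneg ENNReal.toReal_nonneg hB0
      have hcoef : τ * (τ ^ N)⁻¹ ≤ t * (s ^ N)⁻¹ := by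
        gcongr
        · exact hτ.2.le
        · exact hτ.1.le
      have hcoef0 : 0 ≤ τ * (τ ^ N)⁻¹ := by positivity
      calc -(τ * (τ ^ N)⁻¹ * ∫ z in Ω, inner ℝ (gradient (φ n) z) (gradient (scaledBump τ x) z))
          ≤ τ * (τ ^ N)⁻¹ * (e n * B) := by
            rw [← mul_neg]
            exact mul_le_mul_of_nonneg_left (by linarith) hcoef0
        _ ≤ t * (s ^ N)⁻¹ * (e n * B) := mul_le_mul_of_nonneg_right hcoef heB
        _ = C * e n := by rw [hC]; ring
  have hlim := (hconv t).sub (hconv s)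
  have hlim2 : Tendsto (fun n => C * e n * (t - s)) atTop (𝓝 0) := by
    simpa using (het.const_mul C).mul_const (t - s)
  have := le_of_tendsto_of_tendsto hlim hlim2 (Eventually.of_forall hstep)
  linarith

/-- A positive solution is locally bounded below by a positive constant in `Ω₀`, where it is
superharmonic. -/
theorem IsWeakSolution.exists_lower_bound_zeroInterior (hΩb : Bornology.IsBounded Ω)
    {h u : (𝔼 N) → ℝ} {g f : ℝ → ℝ} {Du : (𝔼 N) → 𝔼 N}
    (hu : IsWeakSolution Ω h g f u Du) (hpos : ∀ᵐ x ∂volume.restrict Ω, 0 < u x)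
    (hg : ∀ t, 0 < t → 0 ≤ g t) {x₀ : 𝔼 N} (hx₀ : x₀ ∈ zeroInterior Ω h) :
    ∃ s > 0, ∃ c > 0, Metric.ball x₀ s ⊆ Ω ∧
      ∀ᵐ x ∂volume.restrict (Metric.ball x₀ s), c ≤ u x := by
  have hsubΩ : zeroInterior Ω h ⊆ Ω := fun x hx => (interior_subset hx).1
  obtain ⟨R, hR, hRsub⟩ := Metric.isOpen_iff.1
    (isOpen_interior : IsOpen (zeroInterior Ω h)) x₀ hx₀
  have hsup : ∀ Ψ, IsTestFunction Ω Ψ → (∀ z, 0 ≤ Ψ z) → (∀ z ∉ zeroInterior Ω h, Ψ z = 0) →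
      0 ≤ ∫ z in Ω, inner ℝ (Du z) (gradient Ψ z) := by
    intro Ψ hΨ hΨ0 hΨ1
    rw [(hu.integral_inner_eq hΨ.isAdmissible).2]
    refine integral_nonneg_of_ae ?_
    filter_upwards [hpos] with z hz
    by_cases hz0 : z ∈ zeroInterior Ω h
    · simp only [eq_zero_of_mem_zeroInterior hz0, zero_mul, sub_zero]
      exact mul_nonneg (hg _ hz) (hΨ0 z)
    · simp [hΨ1 z hz0]
  set D := Metric.ball x₀ (R / 8) with hD
  have hDR : D ⊆ Metric.ball x₀ R := Metric.ball_subset_ball (by linarith)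
  have hDΩ : D ⊆ Ω := (hDR.trans hRsub).trans hsubΩ
  set t := R / 2 with ht
  have ht0 : 0 < t := by positivity
  have hballx : ∀ x ∈ D, Metric.closedBall x t ⊆ zeroInterior Ω h := by
    intro x hx
    refine Subset.trans ?_ hRsub
    intro z hz
    rw [Metric.mem_ball] at hx ⊢
    rw [Metric.mem_closedBall] at hz
    calc dist z x₀ ≤ dist z x + dist x x₀ := dist_triangle _ _ _
      _ < R := by linarith
  have hmono : ∀ x ∈ D, ∀ s, 0 < s → s ≤ t →
      ∫ z in Ω, u z * scaledKernel t x z ≤ ∫ z in Ω, u z * scaledKernel s x z := by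
    intro x hx s hs hst
    refine hu.memH10.mollify_antitone hΩb hs hst ((hballx x hx).trans hsubΩ) fun τ h1 h2 => ?_
    have hτ0 : 0 < τ := hs.trans_le h1
    have hsubτ := (Metric.closedBall_subset_closedBall h2).trans (hballx x hx)
    have htest : IsTestFunction (zeroInterior Ω h) (scaledBump τ x) :=
      isTestFunction_scaledBump hτ0 hsubτ
    exact hsup _ ⟨htest.smooth, htest.compact, htest.support_subset.trans hsubΩ⟩
      (fun z => radialBump_nonneg _)
      fun z hz => image_eq_zero_of_notMem_tsupport fun hz' => hz (htest.support_subset hz')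
  -- Letting `s → 0`, the mean at scale `t` bounds `u` from below.
  set ε : ℕ → ℝ := fun n => 1 / ((n : ℝ) + 1) with hε
  have hε0 : ∀ n, 0 < ε n := fun n => by positivity
  have hεt : Tendsto ε atTop (𝓝 0) := tendsto_one_div_add_atTop_nhds_zero_nat
  set A : ℕ → (𝔼 N) → ℝ := fun n x => ∫ z in Ω, u z * scaledKernel (ε n) x z with hA
  have hAm : ∀ n, AEStronglyMeasurable (A n) (volume.restrict Ω) := by
    intro n
    have hfin : IsFiniteMeasure (volume.restrict Ω) := ⟨by simpa using hΩb.measure_lt_top⟩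
    have hj : AEStronglyMeasurable (Function.uncurry fun x z : 𝔼 N =>
        u z * scaledKernel (ε n) x z) ((volume.restrict Ω).prod (volume.restrict Ω)) :=
      hu.memH10.memLp.1.comp_snd.mul (continuous_scaledKernel (ε n)).aestronglyMeasurable
    exact hj.integral_prod_right'
  have hAt : Tendsto (fun n => eLpNorm (fun x => A n x - radialMass N * u x) 2
      (volume.restrict Ω)) atTop (𝓝 0) := by
    rw [tendsto_eLpNorm_two_iff]
    refine tendsto_of_tendsto_of_tendsto_of_le_of_le tendsto_const_nhds
      (h := fun n => ENNReal.ofReal (radialMass N) ^ 2 * ‖ε n‖ₑ ^ 2 * ∫⁻ x in Ω, ‖Du x‖ₑ ^ 2)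
      ?_ (fun _ => zero_le) fun n => hu.memH10.lintegral_mollify_sub_sq_le hΩb (hε0 n)
    have hfin : ∫⁻ x in Ω, ‖Du x‖ₑ ^ 2 ≠ ⊤ := by
      rw [← eLpNorm_two_sq]; exact ENNReal.pow_ne_top hu.memH10.grad_memLp.eLpNorm_ne_top
    have h1 : Tendsto (fun n => ‖ε n‖ₑ ^ 2) atTop (𝓝 0) := by
      have := ((ENNReal.continuous_pow 2).tendsto _).comp hεt.enorm
      simpa [Function.comp_def] using this
    have h2 := ENNReal.Tendsto.mul_const (ENNReal.Tendsto.const_mul h1 (Or.inr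
      (ENNReal.pow_ne_top (n := 2) (ENNReal.ofReal_ne_top (r := radialMass N))))) (Or.inr hfin)
    simpa using h2
  obtain ⟨ns, hns, hlim⟩ := (tendstoInMeasure_of_tendsto_eLpNorm (p := 2) (by norm_num) hAm
    (hu.memH10.memLp.1.const_mul (radialMass N)) hAt).exists_seq_tendsto_ae
  have hlimD := ae_mono (Measure.restrict_mono hDΩ le_rfl) hlim
  have hposD := ae_mono (Measure.restrict_mono hDΩ le_rfl) hpos
  have hmemD : ∀ᵐ x ∂volume.restrict D, x ∈ D := ae_restrict_mem Metric.isOpen_ball.measurableSet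
  have hmain : ∀ᵐ x ∂volume.restrict D,
      ∫ z in Ω, u z * scaledKernel t x z ≤ radialMass N * u x := by
    filter_upwards [hlimD, hmemD] with x hx hxD
    refine ge_of_tendsto hx ?_
    have : Tendsto (fun i => ε (ns i)) atTop (𝓝 0) := hεt.comp hns.tendsto_atTop
    filter_upwards [this.eventually_le_const ht0] with i hi
    exact hmono x hxD _ (hε0 _) hi
  -- The kernel at scale `t` is bounded below on `D`, uniformly in the centre.
  have hfinΩ : IsFiniteMeasure (volume.restrict Ω) := ⟨by simpa using hΩb.measure_lt_top⟩
  have huint : IntegrableOn u Ω := hu.memH10.memLp.integrable (by norm_num)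
  have huintD : IntegrableOn u D := huint.mono_set hDΩ
  have hk0 : ∃ k > 0, ∀ y : 𝔼 N, ‖y‖ ≤ 1 / 2 → k ≤ radialKernel y := by
    obtain ⟨y₁, hy₁, hmin⟩ := (isCompact_closedBall (0 : 𝔼 N) (1 / 2)).exists_isMinOn
      ⟨0, by simp⟩ continuous_radialKernel.continuousOn
    have hy₁' : ‖y₁‖ ≤ 1 / 2 := by simpa using hy₁
    exact ⟨radialKernel y₁, radialKernel_pos (by linarith), fun y hy => hmin (by simpa using hy)⟩
  obtain ⟨k, hk, hkle⟩ := hk0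
  have hintpos : 0 < ∫ z in D, u z := by
    rw [setIntegral_pos_iff_support_of_nonneg_ae]
    · have h1 : D =ᵐ[volume] (Function.support u ∩ D : Set (𝔼 N)) := by
        have := (ae_restrict_iff' Metric.isOpen_ball.measurableSet).1 hposD
        filter_upwards [this] with z hz
        refine propext ⟨fun hzD => ⟨(hz hzD).ne', hzD⟩, fun hzD => hzD.2⟩
      rw [← measure_congr h1]
      exact Metric.measure_ball_pos volume x₀ (by positivity)
    · filter_upwards [hposD] with z hz using hz.le
    · exact huintD
  have hlowA : ∀ x ∈ D, (t ^ N)⁻¹ * k * ∫ z in D, u z ≤ ∫ z in Ω, u z * scaledKernel t x z := by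
    intro x hx
    obtain ⟨C, hC⟩ := exists_scaledKernel_le N t
    have hi : IntegrableOn (fun z => u z * scaledKernel t x z) Ω :=
      huint.mul_bdd (c := C) ((continuous_scaledKernel t).comp
        (continuous_const.prodMk continuous_id)).aestronglyMeasurable
        (Eventually.of_forall fun z => hC x z)
    have hnn : ∀ z, 0 ≤ scaledKernel t x z := fun z =>
      mul_nonneg (by positivity) (radialKernel_nonneg _)
    calc (t ^ N)⁻¹ * k * ∫ z in D, u z = ∫ z in D, (t ^ N)⁻¹ * k * u z :=
          (integral_const_mul _ _).symm
      _ ≤ ∫ z in D, u z * scaledKernel t x z := by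
          refine integral_mono_ae (huintD.const_mul _) (hi.mono_set hDΩ) ?_
          filter_upwards [hposD, hmemD] with z hz hzD
          rw [mul_comm (u z)]
          refine mul_le_mul_of_nonneg_right ?_ hz.le
          refine mul_le_mul_of_nonneg_left (hkle _ ?_) (by positivity)
          rw [norm_smul, norm_inv, Real.norm_of_nonneg ht0.le, ← div_eq_inv_mul,
            div_le_iff₀ ht0, ← dist_eq_norm]
          rw [hD, Metric.mem_ball] at hzD hx
          have := dist_triangle_right z x x₀
          linarith
      _ ≤ ∫ z in Ω, u z * scaledKernel t x z := by
          refine setIntegral_mono_set hi ?_ (Eventually.of_forall hDΩ)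
          filter_upwards [hpos] with z hz
          exact mul_nonneg hz.le (hnn z)
  have hm := radialMass_pos N
  refine ⟨R / 8, by positivity, (t ^ N)⁻¹ * k * (∫ z in D, u z) / radialMass N, by positivity,
    hDΩ, ?_⟩
  filter_upwards [hmain, hmemD] with x hx hxD
  rw [div_le_iff₀ hm, mul_comm (u x)]
  exact (hlowA x hxD).trans hx

end MeanValue

/-! ### A barrier across a sphere -/

section Barrier

variable {N : ℕ} {Ω : Set (𝔼 N)}

/-- The divergence of the radial field `x - y₀` is `N`. -/
theorem integral_fderiv_radial {W : (𝔼 N) → ℝ} (hW : ContDiff ℝ 1 W) (hWc : HasCompactSupport W)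
    (y₀ : 𝔼 N) : ∫ x, fderiv ℝ W x (x - y₀) = -(N * ∫ x, W x) := by
  have hWd : Differentiable ℝ W := hW.differentiable (by simp)
  have hfc : Continuous (fderiv ℝ W) := hW.continuous_fderiv (by simp)
  have hexp : ∀ x, fderiv ℝ W x (x - y₀)
      = ∑ i : Fin N, (x i - y₀ i) * fderiv ℝ W x (EuclideanSpace.single i 1) := by
    intro x
    have h1 : x - y₀ = ∑ i : Fin N, (x i - y₀ i) • EuclideanSpace.single i (1 : ℝ) := by
      have := (EuclideanSpace.basisFun (Fin N) ℝ).sum_repr (x - y₀)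
      simpa using this.symm
    conv_lhs => rw [h1]
    simp [map_sum]
  have hcomp : ∀ i : Fin N, Continuous fun x : 𝔼 N => x i - y₀ i := fun i => by fun_prop
  have hint : ∀ i : Fin N, Integrable fun x : 𝔼 N =>
      (x i - y₀ i) * fderiv ℝ W x (EuclideanSpace.single i 1) := fun i =>
    ((hcomp i).mul (hfc.clm_apply continuous_const)).integrable_of_hasCompactSupport
      ((hWc.fderiv_apply ℝ _).mul_left)
  have hWi : Integrable W := hW.continuous.integrable_of_hasCompactSupport hWc
  have hd : ∀ (i : Fin N) (x : 𝔼 N), HasFDerivAt (fun x : 𝔼 N => x i - y₀ i)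
      (EuclideanSpace.proj i : (𝔼 N) →L[ℝ] ℝ) x := fun i x =>
    ((EuclideanSpace.proj i : (𝔼 N) →L[ℝ] ℝ).hasFDerivAt).sub_const _
  have hpart : ∀ i : Fin N, ∫ x : 𝔼 N, (x i - y₀ i) * fderiv ℝ W x (EuclideanSpace.single i 1)
      = -∫ x, W x := by
    intro i
    have e : ∀ x : 𝔼 N, fderiv ℝ (fun x : 𝔼 N => x i - y₀ i) x (EuclideanSpace.single i 1) = 1 := by
      intro x
      rw [(hd i x).fderiv]
      simp
    have := integral_mul_fderiv_eq_neg_fderiv_mul_of_integrable (μ := (volume : Measure (𝔼 N)))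
      (f := fun x : 𝔼 N => x i - y₀ i) (g := W) (v := EuclideanSpace.single i 1)
      (by simpa only [e, one_mul] using hWi) (hint i)
      (((hcomp i).mul hW.continuous).integrable_of_hasCompactSupport hWc.mul_left)
      (fun x _ => (hd i x).differentiableAt) (fun x _ => hWd x)
    simpa only [e, one_mul] using this
  simp_rw [hexp]
  rw [integral_finsetSum _ fun i _ => hint i]
  simp [hpart]

/-- Integration by parts against the gradient of the Gaussian `exp (-α |x - y₀|²)`. -/
theorem IsTestFunction.integral_gaussian {φ : (𝔼 N) → ℝ} (hφ : IsTestFunction Ω φ) (y₀ : 𝔼 N)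
    (α : ℝ) :
    ∫ x in Ω, inner ℝ (Real.exp (-α * ‖x - y₀‖ ^ 2) • (x - y₀)) (gradient φ x)
      = -∫ x in Ω, Real.exp (-α * ‖x - y₀‖ ^ 2) * (N - 2 * α * ‖x - y₀‖ ^ 2) * φ x := by
  set E : (𝔼 N) → ℝ := fun x => Real.exp (-α * ‖x - y₀‖ ^ 2) with hE
  have hEs : ContDiff ℝ ∞ E := by
    refine Real.contDiff_exp.comp (contDiff_const.mul ?_)
    exact (contDiff_id.sub contDiff_const).norm_sq ℝ
  have hEd : ∀ x, HasFDerivAt E ((E x * (-α)) • (2 • innerSL ℝ (x - y₀))) x := by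
    intro x
    have h1 : HasFDerivAt (fun x : 𝔼 N => ‖x - y₀‖ ^ 2) (2 • innerSL ℝ (x - y₀)) x := by
      have := (hasStrictFDerivAt_norm_sq (x - y₀)).hasFDerivAt.comp x
        ((hasFDerivAt_id x).sub_const y₀)
      exact this.congr_fderiv (by ext; simp)
    have h2 := (h1.const_mul (-α)).exp
    refine h2.congr_fderiv ?_
    ext z
    simp [hE]
    ring
  have hout : ∀ x ∉ Ω, φ x = 0 := fun x hx =>
    image_eq_zero_of_notMem_tsupport fun h => hx (hφ.support_subset h)
  have houtg : ∀ x ∉ Ω, gradient φ x = 0 := fun x hx =>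
    gradient_eq_zero_of_notMem_tsupport fun h => hx (hφ.support_subset h)
  rw [setIntegral_eq_integral_of_forall_compl_eq_zero
      (fun x hx => by rw [houtg x hx, inner_zero_right]),
    setIntegral_eq_integral_of_forall_compl_eq_zero (fun x hx => by rw [hout x hx, mul_zero])]
  have hφs := hφ.smooth
  have hφd : Differentiable ℝ φ := hφs.differentiable (by simp)
  have hW := integral_fderiv_radial (W := fun x => E x * φ x)
    ((hEs.mul hφs).of_le (by simp)) hφ.compact.mul_left y₀
  have hfd : ∀ x, fderiv ℝ (fun x => E x * φ x) x (x - y₀)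
      = inner ℝ (E x • (x - y₀)) (gradient φ x) - 2 * α * ‖x - y₀‖ ^ 2 * E x * φ x := by
    intro x
    have h1 := (hEd x).mul (hφd x).hasFDerivAt
    have h2 : HasFDerivAt (fun x => E x * φ x) _ x := h1
    rw [h2.fderiv, real_inner_smul_left, real_inner_comm, inner_gradient_left,
      ← real_inner_self_eq_norm_sq]
    generalize x - y₀ = z
    simp only [add_apply, smul_apply,
      innerSL_apply_apply, smul_eq_mul, nsmul_eq_mul]
    ring
  simp_rw [hfd] at hW
  have hEc := hEs.continuous
  have i1 : Integrable fun x => inner ℝ (E x • (x - y₀)) (gradient φ x) := by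
    refine Continuous.integrable_of_hasCompactSupport
      ((hEc.smul (continuous_id.sub continuous_const)).inner hφs.continuous_gradient)
      (HasCompactSupport.intro hφ.compact fun x hx => ?_)
    rw [gradient_eq_zero_of_notMem_tsupport hx, inner_zero_right]
  have i2 : Integrable fun x => 2 * α * ‖x - y₀‖ ^ 2 * E x * φ x :=
    Continuous.integrable_of_hasCompactSupport
      (((by fun_prop : Continuous fun x : 𝔼 N => 2 * α * ‖x - y₀‖ ^ 2).mul hEc).mul
        hφs.continuous) hφ.compact.mul_left
  have i3 : Integrable fun x => N * (E x * φ x) :=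
    (Continuous.integrable_of_hasCompactSupport (hEc.mul hφs.continuous)
      hφ.compact.mul_left).const_mul _
  rw [integral_sub i1 i2, ← integral_const_mul] at hW
  have e : ∫ x, E x * (N - 2 * α * ‖x - y₀‖ ^ 2) * φ x
      = (∫ x, N * (E x * φ x)) - ∫ x, 2 * α * ‖x - y₀‖ ^ 2 * E x * φ x := by
    rw [← integral_sub i3 i2]
    congr 1 with x
    ring
  rw [e]
  linarith

theorem memLp_of_continuous_of_isBounded {F : Type*} [NormedAddCommGroup F]
    (hΩb : Bornology.IsBounded Ω) {k : (𝔼 N) → F} (hk : Continuous k)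
    (hkm : AEStronglyMeasurable k (volume.restrict Ω)) (hΩ : MeasurableSet Ω) {p : ENNReal} :
    MemLp k p (volume.restrict Ω) := by
  have hfin : IsFiniteMeasure (volume.restrict Ω) := ⟨by simpa using hΩb.measure_lt_top⟩
  obtain ⟨C, hC⟩ := hΩb.isCompact_closure.exists_bound_of_continuousOn hk.continuousOn
  refine MemLp.of_bound hkm C ?_
  filter_upwards [ae_restrict_mem hΩ] with x hx
  exact hC x (subset_closure hx)

theorem IsAdmissible.integral_gaussian (hΩ : MeasurableSet Ω) (hΩb : Bornology.IsBounded Ω)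
    {w : (𝔼 N) → ℝ} {Dw : (𝔼 N) → 𝔼 N} (hw : IsAdmissible Ω w Dw) (y₀ : 𝔼 N) (α : ℝ) :
    IntegrableOn (fun x => Real.exp (-α * ‖x - y₀‖ ^ 2) * (N - 2 * α * ‖x - y₀‖ ^ 2) * w x) Ω ∧
      ∫ x in Ω, inner ℝ (Real.exp (-α * ‖x - y₀‖ ^ 2) • (x - y₀)) (Dw x)
        = -∫ x in Ω, Real.exp (-α * ‖x - y₀‖ ^ 2) * (N - 2 * α * ‖x - y₀‖ ^ 2) * w x := by
  obtain ⟨φ, K, M, -, -, hφ, -, hφM, hlim, hgrad⟩ := hw.approx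
  set k : (𝔼 N) → ℝ := fun x => Real.exp (-α * ‖x - y₀‖ ^ 2) * (N - 2 * α * ‖x - y₀‖ ^ 2) with hk
  have hkc : Continuous k := by fun_prop
  have hkL : MemLp k 1 (volume.restrict Ω) :=
    memLp_of_continuous_of_isBounded hΩb hkc hkc.aestronglyMeasurable hΩ
  have hki : Integrable k (volume.restrict Ω) := memLp_one_iff_integrable.1 hkL
  have hbound : Integrable (fun x => ‖k x‖ * M) (volume.restrict Ω) := hki.norm.mul_const M
  have hle : ∀ n x, ‖k x * φ n x‖ ≤ ‖k x‖ * M := fun n x => by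
    rw [norm_mul]
    gcongr
    exact hφM n x
  have hm : ∀ n, AEStronglyMeasurable (fun x => k x * φ n x) (volume.restrict Ω) := fun n =>
    (hkc.mul (hφ n).smooth.continuous).aestronglyMeasurable
  have hlim' : ∀ᵐ x ∂volume.restrict Ω,
      Tendsto (fun n => k x * φ n x) atTop (𝓝 (k x * w x)) := by
    filter_upwards [hlim] with x hx
    exact hx.const_mul _
  have hT1 := tendsto_integral_of_dominated_convergence _ hm hbound
    (fun n => Eventually.of_forall (hle n)) hlim'
  have hVc : Continuous fun x : 𝔼 N => Real.exp (-α * ‖x - y₀‖ ^ 2) • (x - y₀) := by fun_prop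
  have hT2 := tendsto_integral_inner
    (memLp_of_continuous_of_isBounded hΩb hVc hVc.aestronglyMeasurable hΩ)
    (fun n => (hφ n).gradient_memLp (volume.restrict Ω)) hw.grad_memLp hgrad
  refine ⟨?_, ?_⟩
  · refine hbound.mono' (aestronglyMeasurable_of_tendsto_ae _ hm hlim') ?_
    filter_upwards [hlim'] with x hx
    exact le_of_tendsto hx.norm (Eventually.of_forall fun n => hle n x)
  · simp_rw [fun n => (hφ n).integral_gaussian y₀ α] at hT2
    exact tendsto_nhds_unique hT2 hT1.neg

/-- The derivative of `expNegInvGlue`. -/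
def expNegInvGlueDeriv (t : ℝ) : ℝ := t⁻¹ ^ 2 * expNegInvGlue t

theorem hasDerivAt_expNegInvGlue (t : ℝ) :
    HasDerivAt expNegInvGlue (expNegInvGlueDeriv t) t := by
  simpa [expNegInvGlueDeriv] using expNegInvGlue.hasDerivAt_polynomial_eval_inv_mul 1 t

theorem continuous_expNegInvGlueDeriv : Continuous expNegInvGlueDeriv := by
  have h := expNegInvGlue.continuous_polynomial_eval_inv_mul (Polynomial.X ^ 2)
  simp only [Polynomial.eval_pow, Polynomial.eval_X] at h
  exact h

theorem expNegInvGlue_le_one (t : ℝ) : expNegInvGlue t ≤ 1 := by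
  unfold expNegInvGlue
  split_ifs with h
  · exact zero_le_one
  · exact Real.exp_le_one_iff.2 (by simpa using (not_le.1 h).le)

theorem expNegInvGlueDeriv_nonneg (t : ℝ) : 0 ≤ expNegInvGlueDeriv t :=
  mul_nonneg (sq_nonneg _) (expNegInvGlue.nonneg t)

theorem expNegInvGlueDeriv_le_two (t : ℝ) : expNegInvGlueDeriv t ≤ 2 := by
  rcases le_or_gt t 0 with h | h
  · simp [expNegInvGlueDeriv, expNegInvGlue.zero_of_nonpos h]
  · have h1 : 0 ≤ t⁻¹ := by positivity
    have h2 := Real.quadratic_le_exp_of_nonneg h1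
    rw [expNegInvGlueDeriv, expNegInvGlue, if_neg (not_le.2 h), Real.exp_neg,
      ← div_eq_mul_inv, div_le_iff₀ (Real.exp_pos _)]
    nlinarith

set_option maxHeartbeats 1000000 in
/-- A barrier argument: if `h` vanishes in the ball of radius `r` about `y₀` and the solution `u`
is bounded below in the ball of radius `r / 2`, then `u` is bounded below in a ball of radius
`r' > r`. The comparison function is `b(x) = c (exp (-α |x - y₀|²) - exp (-α R²))`, with `α` so
large that `b` is strictly subharmonic for `|x - y₀| ≥ r / 2`, and with `R > r` so close to `r` that
`b` is small in the shell `r < |x - y₀| < R`. Where `u < b` in the shell, `f(u)` is small as well,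
and `h f(u)` cannot compete with `Δb`. -/
theorem IsWeakSolution.exists_lower_bound_larger_ball (hΩ : IsOpen Ω)
    (hΩb : Bornology.IsBounded Ω) {h u : (𝔼 N) → ℝ} {g f : ℝ → ℝ} {Du : (𝔼 N) → 𝔼 N}
    (hu : IsWeakSolution Ω h g f u Du) (hpos : ∀ᵐ x ∂volume.restrict Ω, 0 < u x)
    (hg : ∀ t, 0 < t → 0 ≤ g t) (hfc : Continuous f) (hf0 : f 0 = 0)
    {H : ℝ} (hH : ∀ᵐ x ∂volume.restrict Ω, 0 ≤ h x ∧ h x ≤ H)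
    {y₀ : 𝔼 N} {r : ℝ} (hr : 0 < r) (hball : Metric.closedBall y₀ (2 * r) ⊆ Ω)
    (hh0 : ∀ᵐ x ∂volume.restrict (Metric.ball y₀ r), h x = 0) {c : ℝ} (hc : 0 < c)
    (hlow : ∀ᵐ x ∂volume.restrict (Metric.ball y₀ (r / 2)), c ≤ u x) :
    ∃ r' > r, ∃ c' > 0, Metric.ball y₀ r' ⊆ Ω ∧
      ∀ᵐ x ∂volume.restrict (Metric.ball y₀ r'), c' ≤ u x := by
  set α : ℝ := 2 * (N + 1) / r ^ 2 with hα
  have hα0 : 0 < α := by positivity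
  set E : (𝔼 N) → ℝ := fun x => Real.exp (-α * ‖x - y₀‖ ^ 2) with hE
  have hE0 : ∀ x, 0 < E x := fun x => Real.exp_pos _
  set η : ℝ := α * c * Real.exp (-α * (2 * r) ^ 2) / (|H| + 1) with hη
  have hη0 : 0 < η := by positivity
  -- `f` is at most `η` on `[0, τ]`.
  obtain ⟨τ, hτ, hfτ⟩ : ∃ τ > 0, ∀ t, |t| < τ → f t ≤ η := by
    have h1 := (hfc.tendsto 0)
    rw [hf0] at h1
    obtain ⟨τ, hτ, h2⟩ := Metric.eventually_nhds_iff.1 (h1.eventually_le_const hη0)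
    exact ⟨τ, hτ, fun t ht => h2 (by simpa using ht)⟩
  obtain ⟨R, hRr, hR2, hRτ⟩ : ∃ R, r < R ∧ R < 2 * r ∧
      c * (Real.exp (-α * r ^ 2) - Real.exp (-α * R ^ 2)) < τ := by
    have hcont : Continuous fun R : ℝ =>
        c * (Real.exp (-α * r ^ 2) - Real.exp (-α * R ^ 2)) := by fun_prop
    have h1 := (hcont.tendsto r)
    simp only [sub_self, mul_zero] at h1
    have h2 : ∀ᶠ R in 𝓝[>] r, R ∈ Ioo r (2 * r) := Ioo_mem_nhdsGT (by linarith)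
    obtain ⟨R, h3, h4⟩ := (h2.and ((h1.eventually_lt_const hτ).filter_mono
      nhdsWithin_le_nhds)).exists
    exact ⟨R, h3.1, h3.2, h4⟩
  have hR0 : 0 < R := hr.trans hRr
  set b : (𝔼 N) → ℝ := fun x => c * (E x - Real.exp (-α * R ^ 2)) with hb
  have hEs : ContDiff ℝ ∞ E := by
    refine Real.contDiff_exp.comp (contDiff_const.mul ?_)
    exact (contDiff_id.sub contDiff_const).norm_sq ℝ
  have hbs : ContDiff ℝ ∞ b := contDiff_const.mul (hEs.sub contDiff_const)
  set Db : (𝔼 N) → 𝔼 N := fun x => (-2 * α * c) • (E x • (x - y₀)) with hDb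
  have hbd : ∀ x, HasGradientAt b (Db x) x := by
    intro x
    have h1 : HasFDerivAt (fun x : 𝔼 N => ‖x - y₀‖ ^ 2) (2 • innerSL ℝ (x - y₀)) x := by
      have := (hasStrictFDerivAt_norm_sq (x - y₀)).hasFDerivAt.comp x
        ((hasFDerivAt_id x).sub_const y₀)
      exact this.congr_fderiv (by ext; simp)
    have h2 := (((h1.const_mul (-α)).exp).sub_const (Real.exp (-α * R ^ 2))).const_mul c
    rw [hasGradientAt_iff_hasFDerivAt]
    refine h2.congr_fderiv ?_
    ext z
    simp [hE, hDb]
    ring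
  have hDbc : Continuous Db :=
    (hEs.continuous.smul (continuous_id.sub continuous_const)).const_smul (-2 * α * c)
  let ζ : ContDiffBump y₀ := ⟨R, 2 * r, hR0, hR2⟩
  have hζ : IsTestFunction Ω ζ :=
    ⟨ζ.contDiff, ζ.hasCompactSupport, by rw [ζ.tsupport_eq]; exact hball⟩
  obtain ⟨M2, hM2⟩ := hζ.hasCompactSupport_gradient.exists_bound_of_continuous
    hζ.smooth.continuous_gradient
  have hM20 : 0 ≤ M2 := (norm_nonneg _).trans (hM2 0)
  obtain ⟨M3, hM3⟩ := (hζ.compact.smul_right (f' := Db)).exists_bound_of_continuous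
    (hζ.smooth.continuous.smul hDbc)
  have hM30 : 0 ≤ M3 := (norm_nonneg _).trans (hM3 0)
  have hζ0 : ∀ x, 0 ≤ ζ x := fun x => ζ.nonneg
  have hζ1 : ∀ x, |ζ x| ≤ 1 := fun x => by rw [abs_of_nonneg (hζ0 x)]; exact ζ.le_one
  have hζc : Continuous fun p : (𝔼 N) × ℝ × ℝ => ζ p.1 := ζ.continuous.comp continuous_fst
  have hbc : Continuous fun p : (𝔼 N) × ℝ × ℝ => b p.1 - p.2.2 :=
    (hbs.continuous.comp continuous_fst).sub (continuous_snd.comp continuous_snd)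
  have hq1 : ∀ t, |expNegInvGlue t| ≤ 1 := fun t => by
    rw [abs_of_nonneg (expNegInvGlue.nonneg t)]; exact expNegInvGlue_le_one t
  have hq2 : ∀ t, |expNegInvGlueDeriv t| ≤ 2 := fun t => by
    rw [abs_of_nonneg (expNegInvGlueDeriv_nonneg t)]; exact expNegInvGlueDeriv_le_two t
  -- The test function `q (b - u)`, where `q = expNegInvGlue` is a smooth nondecreasing function that
  -- vanishes exactly on `(-∞, 0]`. The slot of the first `H_0^1` function is not needed.
  have hadm := IsAdmissible.comp hΩb hu.memH10 hu.memH10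
    (S := fun x _ t => ζ x * expNegInvGlue (b x - t))
    (Sx := fun x _ t => expNegInvGlue (b x - t) • gradient ζ x
      + expNegInvGlueDeriv (b x - t) • (ζ x • Db x))
    (Sb := fun _ _ _ => 0)
    (Sc := fun x _ t => -(ζ x * expNegInvGlueDeriv (b x - t)))
    (M := 2 + M2 + 2 * M3) hζ.compact hζ.support_subset
    ((hζ.smooth.comp contDiff_fst).mul (expNegInvGlue.contDiff.comp
      ((hbs.comp contDiff_fst).sub (contDiff_snd.comp contDiff_snd))))
    (by
      intro β γ β' γ' x hβ hγ
      have h1 := (hζ.hasGradientAt x).hasFDerivAt.mul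
        ((hasDerivAt_expNegInvGlue (b x - γ x)).comp_hasFDerivAt x
          ((hbd x).hasFDerivAt.sub hγ.hasFDerivAt))
      rw [hasGradientAt_iff_hasFDerivAt]
      refine HasFDerivAt.congr_fderiv (f' := _) h1 ?_
      ext z
      simp
      ring)
    (((expNegInvGlue.contDiff (n := 0)).continuous.comp hbc |>.smul
      (hζ.smooth.continuous_gradient.comp continuous_fst)).add
      ((continuous_expNegInvGlueDeriv.comp hbc).smul (hζc.smul (hDbc.comp continuous_fst))))
    continuous_const
    ((hζc.mul (continuous_expNegInvGlueDeriv.comp hbc)).neg)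
    (by
      intro x _ t
      have h1 : |ζ x * expNegInvGlue (b x - t)| ≤ 1 * 1 := by
        rw [abs_mul]
        gcongr
        · exact hζ1 x
        · exact hq1 _
      linarith)
    (by
      intro x _ t
      have h1 : ‖expNegInvGlue (b x - t) • gradient ζ x‖ ≤ 1 * M2 := by
        rw [norm_smul]
        gcongr
        · exact hq1 _
        · exact hM2 x
      have h2 : ‖expNegInvGlueDeriv (b x - t) • (ζ x • Db x)‖ ≤ 2 * M3 := by
        rw [norm_smul]
        gcongr
        · exact hq2 _
        · exact hM3 x
      refine (norm_add_le _ _).trans ?_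
      linarith)
    (by
      intro x _ t
      rw [abs_zero]
      positivity)
    (by
      intro x _ t
      have h1 : |-(ζ x * expNegInvGlueDeriv (b x - t))| ≤ 1 * 2 := by
        rw [abs_neg, abs_mul]
        gcongr
        · exact hζ1 x
        · exact hq2 _
      linarith)
    (by
      intro x hx _ t
      simp [image_eq_zero_of_notMem_tsupport hx])
  obtain ⟨hint, heq⟩ := hu.integral_inner_eq hadm
  obtain ⟨hgi, hge⟩ := hadm.integral_gaussian hΩ.measurableSet hΩb y₀ α
  set w : (𝔼 N) → ℝ := fun x => ζ x * expNegInvGlue (b x - u x) with hw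
  set Dw : (𝔼 N) → 𝔼 N := fun x => expNegInvGlue (b x - u x) • gradient ζ x
      + expNegInvGlueDeriv (b x - u x) • (ζ x • Db x) + (0 : ℝ) • Du x
      + (-(ζ x * expNegInvGlueDeriv (b x - u x))) • Du x with hDw
  set μ := volume.restrict Ω with hμ
  have hw0 : ∀ x, 0 ≤ w x := fun x => mul_nonneg (hζ0 x) (expNegInvGlue.nonneg _)
  -- Geometric facts about the barrier.
  have hb_out : ∀ x, R ≤ ‖x - y₀‖ → b x ≤ 0 := by
    intro x hx
    refine mul_nonpos_of_nonneg_of_nonpos hc.le (sub_nonpos.2 (Real.exp_le_exp.2 ?_))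
    nlinarith [pow_le_pow_left₀ hR0.le hx 2]
  have hb_le : ∀ x, b x ≤ c := by
    intro x
    have h1 : E x ≤ 1 := Real.exp_le_one_iff.2 (by nlinarith [sq_nonneg ‖x - y₀‖])
    have h2 := Real.exp_pos (-α * R ^ 2)
    simp only [hb]
    nlinarith
  have hb_shell : ∀ x, r ≤ ‖x - y₀‖ → b x < τ := by
    intro x hx
    refine lt_of_le_of_lt ?_ hRτ
    refine mul_le_mul_of_nonneg_left (sub_le_sub_right (Real.exp_le_exp.2 ?_) _) hc.le
    nlinarith [pow_le_pow_left₀ hr.le hx 2]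
  have hlow' : ∀ᵐ x ∂μ, x ∈ Metric.ball y₀ (r / 2) → c ≤ u x :=
    ae_restrict_of_ae ((ae_restrict_iff' Metric.isOpen_ball.measurableSet).1 hlow)
  have hh0' : ∀ᵐ x ∂μ, x ∈ Metric.ball y₀ r → h x = 0 :=
    ae_restrict_of_ae ((ae_restrict_iff' Metric.isOpen_ball.measurableSet).1 hh0)
  -- Where the test function does not vanish.
  have hwpos : ∀ᵐ x ∂μ, w x ≠ 0 → r / 2 ≤ ‖x - y₀‖ ∧ ‖x - y₀‖ < R ∧ u x < b x := by
    filter_upwards [hlow', hpos] with x h1 h2 h3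
    have h4 : u x < b x := by
      by_contra h5
      exact h3 (by simp [hw, expNegInvGlue.zero_of_nonpos (sub_nonpos.2 (not_lt.1 h5))])
    refine ⟨?_, ?_, h4⟩
    · by_contra h5
      have := h1 (by rw [Metric.mem_ball, dist_eq_norm]; exact not_le.1 h5)
      linarith [hb_le x]
    · by_contra h5
      linarith [hb_out x (not_lt.1 h5)]
  -- The cutoff is `1` where `b > 0`, so only the monotonicity of `q` enters.
  have hgrad_nonneg : ∀ᵐ x ∂μ, 0 ≤ inner ℝ (Db x - Du x) (Dw x) := by
    filter_upwards [hpos] with x hx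
    have e1 : expNegInvGlue (b x - u x) • gradient ζ x = 0 := by
      by_cases h1 : ‖x - y₀‖ < R
      · have : (ζ : (𝔼 N) → ℝ) =ᶠ[𝓝 x] fun _ => 1 := by
          have h2 : x ∈ Metric.ball y₀ R := by rwa [Metric.mem_ball, dist_eq_norm]
          filter_upwards [Metric.isOpen_ball.mem_nhds h2] with y hy
          exact ζ.one_of_mem_closedBall (Metric.ball_subset_closedBall hy)
        rw [this.gradient_eq]
        simp
      · have h2 := hb_out x (not_lt.1 h1)
        rw [expNegInvGlue.zero_of_nonpos (by linarith), zero_smul]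
    have e2 : Dw x = (ζ x * expNegInvGlueDeriv (b x - u x)) • (Db x - Du x) := by
      simp only [hDw, e1, zero_add, zero_smul, add_zero, smul_sub, smul_smul, neg_smul]
      rw [mul_comm, ← sub_eq_add_neg]
    rw [e2, real_inner_smul_right, real_inner_self_eq_norm_sq]
    exact mul_nonneg (mul_nonneg (hζ0 x) (expNegInvGlueDeriv_nonneg _)) (sq_nonneg _)
  have hDbL : MemLp Db 2 μ :=
    memLp_of_continuous_of_isBounded hΩb hDbc hDbc.aestronglyMeasurable hΩ.measurableSet
  have i1 := hDbL.integrable_inner_two hadm.grad_memLp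
  have i2 := hu.memH10.grad_memLp.integrable_inner_two hadm.grad_memLp
  have hDbw : ∫ x in Ω, inner ℝ (Db x) (Dw x)
      = ∫ x in Ω, 2 * α * c * (E x * (N - 2 * α * ‖x - y₀‖ ^ 2) * w x) := by
    rw [integral_const_mul]
    have : ∀ x, inner ℝ (Db x) (Dw x) = (-2 * α * c) * inner ℝ (E x • (x - y₀)) (Dw x) :=
      fun x => real_inner_smul_left _ _ _
    simp_rw [this]
    rw [integral_const_mul, hge]
    ring
  have hmain : 0 ≤ ∫ x in Ω, (2 * α * c * (E x * (N - 2 * α * ‖x - y₀‖ ^ 2) * w x)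
      - (g (u x) - h x * f (u x)) * w x) := by
    rw [integral_sub (hgi.const_mul _) hint, ← hDbw, ← heq, ← integral_sub i1 i2]
    refine integral_nonneg_of_ae ?_
    filter_upwards [hgrad_nonneg] with x hx
    rw [inner_sub_left] at hx
    exact hx
  have hpt : ∀ᵐ x ∂μ, (2 * α * c * (E x * (N - 2 * α * ‖x - y₀‖ ^ 2) * w x)
      - (g (u x) - h x * f (u x)) * w x) ≤ -(α * c * E x * w x) := by
    filter_upwards [hwpos, hpos, hH, hh0'] with x h1 h2 h3 h4
    by_cases hwx : w x = 0
    · simp [hwx]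
    obtain ⟨h5, h6, h7⟩ := h1 hwx
    -- Strict subharmonicity of `b` away from the centre, by the choice of `α`.
    have h8 : (N : ℝ) - 2 * α * ‖x - y₀‖ ^ 2 ≤ -1 := by
      have h9 : (r / 2) ^ 2 ≤ ‖x - y₀‖ ^ 2 := pow_le_pow_left₀ (by positivity) h5 2
      have h10 : 2 * α * (r / 2) ^ 2 = N + 1 := by rw [hα]; field_simp
      have h11 := mul_le_mul_of_nonneg_left h9 (by positivity : 0 ≤ 2 * α)
      linarith
    -- In the ball the weight vanishes; in the shell `u < b < τ`.
    have h11 : h x * f (u x) ≤ α * c * E x := by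
      by_cases h12 : ‖x - y₀‖ < r
      · rw [h4 (by rwa [Metric.mem_ball, dist_eq_norm]), zero_mul]
        have := hE0 x
        positivity
      · have h13 : u x < τ := h7.trans (hb_shell x (not_lt.1 h12))
        have h14 : f (u x) ≤ η := hfτ _ (by rwa [abs_of_pos h2])
        have h15 : Real.exp (-α * (2 * r) ^ 2) ≤ E x := by
          refine Real.exp_le_exp.2 ?_
          nlinarith [pow_le_pow_left₀ (norm_nonneg (x - y₀)) (h6.trans hR2).le 2]
        calc h x * f (u x) ≤ h x * η := mul_le_mul_of_nonneg_left h14 h3.1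
          _ ≤ (|H| + 1) * η := by
            refine mul_le_mul_of_nonneg_right ?_ hη0.le
            linarith [h3.2, le_abs_self H]
          _ = α * c * Real.exp (-α * (2 * r) ^ 2) := by rw [hη]; field_simp
          _ ≤ α * c * E x := by gcongr
    have h16 := hg _ h2
    have h17 : 2 * α * c * (E x * (N - 2 * α * ‖x - y₀‖ ^ 2)) - (g (u x) - h x * f (u x))
        ≤ -(α * c * E x) := by
      have h18 : 0 < α * c * E x := mul_pos (mul_pos hα0 hc) (hE0 x)
      have h19 : 2 * α * c * (E x * (N - 2 * α * ‖x - y₀‖ ^ 2))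
          = 2 * (α * c * E x) * (N - 2 * α * ‖x - y₀‖ ^ 2) := by ring
      have h20 := mul_le_mul_of_nonneg_left h8 h18.le
      rw [h19]
      linarith
    have h21 := mul_le_mul_of_nonneg_right h17 (hw0 x)
    linarith
  -- Both sides have a sign, so the test function vanishes.
  have hwm : AEStronglyMeasurable w μ := by
    exact (ζ.continuous.aestronglyMeasurable).mul
      ((expNegInvGlue.contDiff (n := 0)).continuous.comp_aestronglyMeasurable
        (hbs.continuous.aestronglyMeasurable.sub hu.memH10.memLp.1))
  have hzero : ∀ᵐ x ∂μ, w x = 0 := by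
    have hfin : IsFiniteMeasure μ := ⟨by simpa [hμ] using hΩb.measure_lt_top⟩
    have i3 : Integrable (fun x => α * c * E x * w x) μ := by
      have hEi : Integrable (fun x => α * c * E x) μ := memLp_one_iff_integrable.1
        (memLp_of_continuous_of_isBounded hΩb (continuous_const.mul hEs.continuous)
          (continuous_const.mul hEs.continuous).aestronglyMeasurable hΩ.measurableSet)
      refine hEi.mul_bdd (c := 1) hwm (Eventually.of_forall fun x => ?_)
      rw [hw, Real.norm_eq_abs, abs_mul]
      exact mul_le_one₀ (hζ1 x) (abs_nonneg _) (hq1 _)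
    have hEw0 : ∀ x, 0 ≤ α * c * E x * w x := fun x =>
      mul_nonneg (mul_pos (mul_pos hα0 hc) (hE0 x)).le (hw0 x)
    have h1 : ∫ x, α * c * E x * w x ∂μ ≤ 0 := by
      have h2 := integral_mono_ae ((hgi.const_mul (2 * α * c)).sub hint) i3.neg hpt
      have h3 : ∫ x, (-fun x => α * c * E x * w x) x ∂μ = -∫ x, α * c * E x * w x ∂μ :=
        integral_neg _
      rw [h3] at h2
      have h4 := hmain.trans h2
      linarith
    have h2 := (integral_eq_zero_iff_of_nonneg hEw0 i3).1
      (le_antisymm h1 (integral_nonneg hEw0))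
    filter_upwards [h2] with x hx
    have := mul_pos (mul_pos hα0 hc) (hE0 x)
    exact (mul_eq_zero.1 hx).resolve_left this.ne'
  have hRΩ : Metric.ball y₀ R ⊆ Ω :=
    (Metric.ball_subset_closedBall.trans (Metric.closedBall_subset_closedBall hR2.le)).trans hball
  have hsub : Metric.ball y₀ ((r + R) / 2) ⊆ Metric.ball y₀ R :=
    Metric.ball_subset_ball (by linarith)
  refine ⟨(r + R) / 2, by linarith,
    c * (Real.exp (-α * ((r + R) / 2) ^ 2) - Real.exp (-α * R ^ 2)), ?_, hsub.trans hRΩ, ?_⟩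
  · refine mul_pos hc (sub_pos.2 (Real.exp_lt_exp.2 ?_))
    have h1 : ((r + R) / 2) ^ 2 < R ^ 2 :=
      pow_lt_pow_left₀ (by linarith) (by positivity) two_ne_zero
    have h2 := mul_lt_mul_of_pos_left h1 hα0
    linarith
  · have hz := ae_mono (Measure.restrict_mono (hsub.trans hRΩ) le_rfl) hzero
    filter_upwards [hz, ae_restrict_mem Metric.isOpen_ball.measurableSet] with x h1 h2
    have e1 : ζ x = 1 := ζ.one_of_mem_closedBall (Metric.ball_subset_closedBall (hsub h2))
    simp only [hw, e1, one_mul, expNegInvGlue.zero_iff_nonpos] at h1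
    refine le_trans ?_ (sub_nonpos.1 h1)
    refine mul_le_mul_of_nonneg_left (sub_le_sub_right (Real.exp_le_exp.2 ?_) _) hc.le
    rw [Metric.mem_ball, dist_eq_norm] at h2
    nlinarith [pow_le_pow_left₀ (norm_nonneg (x - y₀)) h2.le 2]

end Barrier

/-! ### Propagation of proportionality -/

section Propagation

variable {N : ℕ} {Ω : Set (𝔼 N)} {u ψ : (𝔼 N) → ℝ}

/-- The set of points of `Ω` near which `u` is bounded below by a positive constant and `ψ` is a
nonzero multiple of `u`. -/
def proportionalSet (Ω : Set (𝔼 N)) (u ψ : (𝔼 N) → ℝ) : Set (𝔼 N) :=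
  {x | ∃ κ ≠ (0 : ℝ), ∃ s > 0, ∃ c > 0, Metric.ball x s ⊆ Ω ∧
    ∀ᵐ y ∂volume.restrict (Metric.ball x s), c ≤ u y ∧ ψ y = κ * u y}

theorem proportionalSet_subset : proportionalSet Ω u ψ ⊆ Ω := by
  rintro x ⟨κ, -, s, hs, c, -, hsub, -⟩
  exact hsub (Metric.mem_ball_self hs)

theorem isOpen_proportionalSet : IsOpen (proportionalSet Ω u ψ) := by
  refine Metric.isOpen_iff.2 ?_
  rintro x ⟨κ, hκ, s, hs, c, hc, hsub, hae⟩
  refine ⟨s, hs, fun y hy => ?_⟩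
  obtain ⟨s', hs', hsub'⟩ := Metric.isOpen_iff.1 Metric.isOpen_ball y hy
  exact ⟨κ, hκ, s', hs', c, hc, hsub'.trans hsub, ae_mono (Measure.restrict_mono hsub' le_rfl) hae⟩

/-- On a compact subset of the proportional set, `u` has a uniform positive lower bound. -/
theorem exists_lower_bound_of_isCompact {K : Set (𝔼 N)} (hK : IsCompact K)
    (hKQ : K ⊆ proportionalSet Ω u ψ) :
    ∃ c > 0, ∀ᵐ y ∂volume.restrict K, c ≤ u y := by
  refine hK.induction_on (p := fun K => ∃ c > 0, ∀ᵐ y ∂volume.restrict K, c ≤ u y)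
    ⟨1, one_pos, by simp⟩ ?_ ?_ ?_
  · rintro s t hst ⟨c, hc, h⟩
    exact ⟨c, hc, ae_mono (Measure.restrict_mono hst le_rfl) h⟩
  · rintro s t ⟨c, hc, h⟩ ⟨c', hc', h'⟩
    refine ⟨min c c', lt_min hc hc', ae_restrict_union_iff _ _ _ |>.2 ⟨?_, ?_⟩⟩
    · filter_upwards [h] with y hy using (min_le_left _ _).trans hy
    · filter_upwards [h'] with y hy using (min_le_right _ _).trans hy
  · intro x hx
    obtain ⟨κ, -, s, hs, c, hc, -, hae⟩ := hKQ hx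
    exact ⟨Metric.ball x s, mem_nhdsWithin_of_mem_nhds (Metric.ball_mem_nhds x hs), c, hc,
      hae.mono fun y hy => hy.1⟩

/-- A property that holds a.e. near each point of an open set holds a.e. in that set. -/
theorem ae_restrict_of_forall_exists_ball {p : (𝔼 N) → Prop} {U : Set (𝔼 N)}
    (h : ∀ x ∈ U, ∃ s > 0, ∀ᵐ y ∂volume.restrict (Metric.ball x s), p y) (hU : IsOpen U) :
    ∀ᵐ y ∂volume.restrict U, p y := by
  rw [ae_restrict_iff' hU.measurableSet, ae_iff]
  refine measure_null_of_locally_null _ fun x hx => ?_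
  simp only [mem_ofPred_eq, Classical.not_imp] at hx
  obtain ⟨s, hs, hae⟩ := h x hx.1
  rw [ae_restrict_iff' Metric.isOpen_ball.measurableSet, ae_iff] at hae
  refine ⟨Metric.ball x s ∩ {y | ¬ (y ∈ U → p y)},
    inter_mem (mem_nhdsWithin_of_mem_nhds (Metric.ball_mem_nhds x hs)) self_mem_nhdsWithin,
    measure_mono_null ?_ hae⟩
  rintro y ⟨hy1, hy2⟩
  simp only [mem_ofPred_eq, Classical.not_imp] at hy2 ⊢
  exact ⟨hy1, hy2.2⟩

theorem ae_ne_zero_on_proportionalSet :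
    ∀ᵐ y ∂volume.restrict (proportionalSet Ω u ψ), ψ y ≠ 0 := by
  refine ae_restrict_of_forall_exists_ball ?_ isOpen_proportionalSet
  rintro x ⟨κ, hκ, s, hs, c, hc, -, hae⟩
  refine ⟨s, hs, ?_⟩
  filter_upwards [hae] with y hy
  rw [hy.2]
  exact mul_ne_zero hκ (hc.trans_le hy.1).ne'

/-- The proportional set has no boundary in `Ω`: the barrier carries the lower bound for `u`, and
with it the proportionality, across the boundary of a ball inscribed in it. -/
theorem IsWeakSolution.closure_proportionalSet_inter_subset (hΩ : IsOpen Ω)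
    (hΩb : Bornology.IsBounded Ω) {h : (𝔼 N) → ℝ} {g f : ℝ → ℝ} {Du Dψ : (𝔼 N) → 𝔼 N}
    (hu : IsWeakSolution Ω h g f u Du) (hpos : ∀ᵐ x ∂volume.restrict Ω, 0 < u x)
    (hg : ∀ t, 0 < t → 0 ≤ g t) (hfc : Continuous f) (hf0 : f 0 = 0)
    {H : ℝ} (hH : ∀ᵐ x ∂volume.restrict Ω, 0 ≤ h x ∧ h x ≤ H)
    (hψ : MemHD1 Ω (zeroInterior Ω h) ψ Dψ)
    (hid : ∀ᵐ x ∂volume.restrict Ω, u x • Dψ x = ψ x • Du x) :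
    closure (proportionalSet Ω u ψ) ∩ Ω ⊆ proportionalSet Ω u ψ := by
  set Q := proportionalSet Ω u ψ with hQ
  have hQo : IsOpen Q := isOpen_proportionalSet
  rintro x₁ ⟨hx₁, hx₁Ω⟩
  by_contra hx₁Q
  obtain ⟨d, hd, hdΩ⟩ := Metric.isOpen_iff.1 hΩ x₁ hx₁Ω
  obtain ⟨y₀, hy₀Q, hy₀⟩ := Metric.mem_closure_iff.1 hx₁ (d / 3) (by positivity)
  obtain ⟨x₀, hx₀Q, hx₀⟩ := hQo.isClosed_compl.exists_infDist_eq_dist ⟨x₁, hx₁Q⟩ y₀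
  -- The ball about `y₀` that touches the complement of `Q` at `x₀`.
  set r := dist y₀ x₀ with hr
  have hr0 : 0 < r := dist_pos.2 fun h => hx₀Q (h ▸ hy₀Q)
  have hrd : r < d / 3 := by
    rw [← hx₀]
    refine (Metric.infDist_le_dist_of_mem (show x₁ ∈ Qᶜ from hx₁Q)).trans_lt ?_
    rwa [dist_comm]
  have hball : Metric.ball y₀ r ⊆ Q := by
    intro y hy
    by_contra hyQ
    have := Metric.infDist_le_dist_of_mem (show y ∈ Qᶜ from hyQ) (x := y₀)
    rw [Metric.mem_ball, dist_comm] at hy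
    linarith
  have h2r : Metric.closedBall y₀ (2 * r) ⊆ Ω := by
    intro y hy
    refine hdΩ ?_
    have h1 := dist_triangle y y₀ x₁
    rw [dist_comm y₀ x₁] at h1
    rw [Metric.mem_closedBall] at hy
    rw [Metric.mem_ball]
    linarith
  have hne : ∀ᵐ y ∂volume.restrict (Metric.ball y₀ r), ψ y ≠ 0 :=
    ae_mono (Measure.restrict_mono hball le_rfl) ae_ne_zero_on_proportionalSet
  -- `ψ` vanishes a.e. outside `Ω₀`, so the ball is contained in `Ω₀` up to a null set.
  have hh0 : ∀ᵐ y ∂volume.restrict (Metric.ball y₀ r), h y = 0 := by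
    have h1 := ae_mono (Measure.restrict_mono (hball.trans proportionalSet_subset) le_rfl)
      (hψ.ae_eq_zero hΩ.measurableSet isOpen_interior.measurableSet)
    filter_upwards [hne, h1] with y h2 h3
    by_contra h4
    exact h2 (h3 fun h5 => h4 (eq_zero_of_mem_zeroInterior h5))
  obtain ⟨c, hc, hlow⟩ := exists_lower_bound_of_isCompact
    (isCompact_closedBall y₀ (r / 2)) ((Metric.closedBall_subset_ball (by linarith)).trans hball)
  obtain ⟨r', hr', c', hc', hr'Ω, hlow'⟩ := hu.exists_lower_bound_larger_ball hΩ hΩb hpos hg hfc hf0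
    hH hr0 h2r hh0 hc (ae_mono (Measure.restrict_mono Metric.ball_subset_closedBall le_rfl) hlow)
  have hsub : Metric.ball x₀ (r' - r) ⊆ Metric.ball y₀ r' := by
    refine Metric.ball_subset_ball' ?_
    rw [dist_comm x₀ y₀]
    linarith
  obtain ⟨κ, hκ⟩ := exists_ae_eq_const_mul hΩb hu.memH10 hψ.1 hid (sub_pos.2 hr') hc'
    (hsub.trans hr'Ω) (ae_mono (Measure.restrict_mono hsub le_rfl) hlow')
  have hsub' : Metric.ball x₀ ((r' - r) / 2) ⊆ Metric.ball x₀ (r' - r) :=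
    Metric.ball_subset_ball (by linarith)
  -- The factor is nonzero, since `ψ` does not vanish in the part of the ball inside `Q`.
  have hκ0 : κ ≠ 0 := by
    rintro rfl
    have hx₀c : x₀ ∈ closure (Metric.ball y₀ r) := by
      rw [closure_ball _ hr0.ne', Metric.mem_closedBall, dist_comm]
    obtain ⟨z, hz1, hz2⟩ := mem_closure_iff.1 hx₀c _ Metric.isOpen_ball
      (Metric.mem_ball_self (by linarith : 0 < (r' - r) / 2))
    have hopen : IsOpen (Metric.ball x₀ ((r' - r) / 2) ∩ Metric.ball y₀ r) :=
      Metric.isOpen_ball.inter Metric.isOpen_ball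
    have h1 : ∀ᵐ y ∂volume.restrict (Metric.ball x₀ ((r' - r) / 2) ∩ Metric.ball y₀ r), False := by
      filter_upwards [ae_mono (Measure.restrict_mono inter_subset_left le_rfl) hκ,
        ae_mono (Measure.restrict_mono inter_subset_right le_rfl) hne] with y h2 h3
      exact h3 (by rw [h2, zero_mul])
    rw [ae_iff] at h1
    simp only [not_false_eq_true, ofPred_true, Measure.restrict_apply_univ] at h1
    exact (hopen.measure_pos volume ⟨z, hz1, hz2⟩).ne' h1
  refine hx₀Q ⟨κ, hκ0, (r' - r) / 2, by linarith, c', hc', hsub'.trans (hsub.trans hr'Ω), ?_⟩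
  filter_upwards [hκ, ae_mono (Measure.restrict_mono (hsub'.trans hsub) le_rfl) hlow'] with y h1 h2
  exact ⟨h2, h1⟩

end Propagation

end

/-! ### Nonexistence of positive solutions -/

theorem proposition5p2 (N : ℕ) (hN : 1 ≤ N) (Ω : Set (EuclideanSpace ℝ (Fin N)))
    (hΩ : IsSmoothBoundedDomain Ω)
    (h : EuclideanSpace ℝ (Fin N) → ℝ) (hh : IsDegenerateWeight Ω h)
    (g f : ℝ → ℝ) (hg : IsAsymptoticallyLinear g) (hf : IsSuperlinear f)
    (hslope : ∀ t : ℝ, t ≠ 0 → firstEigenvalue Ω (zeroInterior Ω h) ≤ g t / t) :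
    ¬ ∃ (u : EuclideanSpace ℝ (Fin N) → ℝ)
        (Du : EuclideanSpace ℝ (Fin N) → EuclideanSpace ℝ (Fin N)),
        IsWeakSolution Ω h g f u Du ∧ ∀ᵐ x ∂(volume.restrict Ω), 0 < u x := by
  rintro ⟨u, Du, hu, hpos⟩
  have hΩo := hΩ.isOpen
  have hΩb := hΩ.isBounded
  have hΩ₀o : IsOpen (zeroInterior Ω h) := isOpen_interior
  have hΩ₀sub : zeroInterior Ω h ⊆ Ω := fun x hx => (interior_subset hx).1
  obtain ⟨hl, ψ, Dψ, hψ, hψ0, hψe⟩ := exists_firstEigenfunction hΩb hΩ₀o hΩ₀sub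
    (nonempty_of_measure_ne_zero hh.volume_pos.ne')
  have hgl : ∀ t, 0 < t → firstEigenvalue Ω (zeroInterior Ω h) * t ≤ g t := fun t ht =>
    (le_div_iff₀ ht).1 (hslope t ht.ne')
  have hg0 : ∀ t, 0 < t → 0 ≤ g t := fun t ht => (mul_nonneg hl ht.le).trans (hgl t ht)
  have hid := hu.smul_gradient_eq hΩo hΩb hpos hl hgl hψ hψe
  obtain ⟨H, hH⟩ : ∃ H : ℝ, ∀ᵐ x ∂volume.restrict Ω, 0 ≤ h x ∧ h x ≤ H := by
    refine ⟨(eLpNormEssSup h (volume.restrict Ω)).toReal, ?_⟩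
    have hfin : eLpNormEssSup h (volume.restrict Ω) ≠ ⊤ := by
      rw [← eLpNorm_exponent_top]
      exact hh.memLp_top.2.ne
    filter_upwards [hh.nonneg, ae_le_eLpNormEssSup (f := h) (μ := volume.restrict Ω)] with x h1 h2
    refine ⟨h1, (le_abs_self _).trans ?_⟩
    have := ENNReal.toReal_mono hfin h2
    simpa using this
  -- Near some point of `Ω₀`, `ψ` is a nonzero multiple of `u`.
  have hne : (proportionalSet Ω u ψ).Nonempty := by
    by_contra hempty
    rw [not_nonempty_iff_eq_empty] at hempty
    have h0 : ∀ᵐ x ∂volume.restrict (zeroInterior Ω h), ψ x = 0 := by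
      refine ae_restrict_of_forall_exists_ball (fun x hx => ?_) hΩ₀o
      obtain ⟨s, hs, c, hc, hsub, hlow⟩ := hu.exists_lower_bound_zeroInterior hΩb hpos hg0 hx
      obtain ⟨κ, hκ⟩ := exists_ae_eq_const_mul hΩb hu.memH10 hψ.1 hid hs hc hsub hlow
      have hsub' : Metric.ball x (s / 2) ⊆ Metric.ball x s :=
        Metric.ball_subset_ball (by linarith)
      refine ⟨s / 2, by linarith, ?_⟩
      by_cases hκ0 : κ = 0
      · filter_upwards [hκ] with y hy
        rw [hy, hκ0, zero_mul]
      · have : x ∈ proportionalSet Ω u ψ := by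
          refine ⟨κ, hκ0, s / 2, by linarith, c, hc, hsub'.trans hsub, ?_⟩
          filter_upwards [hκ, ae_mono (Measure.restrict_mono hsub' le_rfl) hlow] with y h1 h2
          exact ⟨h2, h1⟩
        rw [hempty] at this
        exact this.elim
    refine hψ0 ?_
    filter_upwards [hψ.ae_eq_zero hΩo.measurableSet hΩ₀o.measurableSet,
      ae_restrict_of_ae ((ae_restrict_iff' hΩ₀o.measurableSet).1 h0)] with x h1 h2
    by_cases hx : x ∈ zeroInterior Ω h
    · exact h2 hx
    · exact h1 hx
  have hsubset : Ω ⊆ proportionalSet Ω u ψ := by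
    refine hΩ.isConnected.isPreconnected.subset_of_closure_inter_subset isOpen_proportionalSet
      ?_ (hu.closure_proportionalSet_inter_subset hΩo hΩb hpos hg0 hf.continuous hf.map_zero hH
        hψ hid)
    obtain ⟨x, hx⟩ := hne
    exact ⟨x, proportionalSet_subset hx, hx⟩
  -- Thus `ψ ≠ 0` a.e. in `Ω`, whereas `ψ` vanishes wherever `h` does not.
  refine hh.ne_zero ?_
  filter_upwards [ae_mono (Measure.restrict_mono hsubset le_rfl)
    (ae_ne_zero_on_proportionalSet (Ω := Ω) (u := u) (ψ := ψ)),
    hψ.ae_eq_zero hΩo.measurableSet hΩ₀o.measurableSet] with x h1 h2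
  by_contra h3
  exact h1 (h2 fun h4 => h3 (eq_zero_of_mem_zeroInterior h4))
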